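/- For a positive integer $n$ and $A,B\in[0,1]$, let $(X,G)\sim\mathrm{SSBM}(n,2,A,B)$ mean: the labels $X_1,\dots,X_n$ are i.i.d. uniform on $\{1,2\}$ and, given $X$, $G$ is the random simple graph on $[n]$ in which each pair $u<v$ is joined independently, with probability $A$ if $X_u=X_v$ and $B$ if $X_u\neq X_v$. For a graph $G$ on $[n]$ let $C_m$ be the number of $m$-cycles in $G$ (subgraphs isomorphic to the cycle on $m$ vertices), let $m_n=\lfloor(\log n)^{1/4}\rfloor$ with the natural logarithm, and put $$\hat d_n=\frac{2|E(G)|}{n},\qquad \hat f_n=\bigl(2m_nC_{m_n}-\hat d_n^{\,m_n}\bigr)^{1/m_n}$$ (with an arbitrary conventional value of $\hat f_n$ where the radicand is negative or $m_n=0$). Let $a\ge b\ge 0$ be real numbers with $(a-b)^2>2(a+b)$, and let $G\sim\mathrm{SSBM}(n,2,a/n,b/n)$ for $n\ge a$. Then: 1. $\hat d_n+\hat f_n$ and $\hat d_n-\hat f_n$ are consistent estimators of $a$ and $b$ respectively: for every $\varepsilon>0$, $\mathbb P\{|\hat d_n+\hat f_n-a|\ge\varepsilon\}\to0$ and $\mathbb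 P\{|\hat d_n-\hat f_n-b|\ge\varepsilon\}\to0$ as $n\to\infty$. 2. $\hat d_n$ and $\hat f_n$ can be calculated in polynomial time, with high probability over $G$: there is a single deterministic algorithm, not depending on $a$ and $b$, which takes as input a graph $G$ on $n$ vertices and a precision $k\in\mathbb N$, always halts in time polynomial in $n+k$ (on a random access machine with logarithmic cost), and is such that for all $a,b$ as above, with probability $1-o(1)$ as $n\to\infty$, for every $k$ it outputs $\hat d_n$ exactly, as a fraction, and a fraction within $2^{-k}$ of $\hat f_n$. -/

import Mathlib

open Filter Topology

noncomputable section

/-! ### The stochastic block model -/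

/-- The pairs `u < v` of vertices. -/
def vertexPairs (n : ℕ) : Finset (Fin n × Fin n) :=
  Finset.univ.filter fun e => e.1 < e.2

/-- The probability that `SBM(n, p, W)` gives to the labelling `x` and the graph `G`: the labels are
i.i.d. with law `p`, and given the labels each pair `u < v` is joined independently with
probability `W (x u) (x v)`. -/
def sbmMass {n k : ℕ} (p : Fin k → ℝ) (W : Matrix (Fin k) (Fin k) ℝ)
    (x : Fin n → Fin k) (G : SimpleGraph (Fin n)) : ℝ :=
  open Classical in
  (∏ u, p (x u)) *
    ∏ e ∈ vertexPairs n, if G.Adj e.1 e.2 then W (x e.1) (x e.2) else 1 - W (x e.1) (x e.2)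

/-- The probability of an event `S` about `(X, G)` when `(X, G)` is drawn under `SBM(n, p, W)`. -/
def sbmProb {n k : ℕ} (p : Fin k → ℝ) (W : Matrix (Fin k) (Fin k) ℝ)
    (S : Set ((Fin n → Fin k) × SimpleGraph (Fin n))) : ℝ :=
  open Classical in
  ∑ x : Fin n → Fin k, ∑ G : SimpleGraph (Fin n), if (x, G) ∈ S then sbmMass p W x G else 0

/-- The probability of an event `S` about `(X, G)` when `(X, G)` is drawn under
`SSBM(n, k, A, B)`: uniform labels, and `W` equal to `A` on the diagonal and to `B` off it. -/
def ssbmProb (n k : ℕ) (A B : ℝ) (S : Set ((Fin n → Fin k) × SimpleGraph (Fin n))) : ℝ :=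
  sbmProb (fun _ => 1 / (k : ℝ)) (Matrix.of fun i j => if i = j then A else B) S

/-! ### The estimators -/

/-- The number `C_m` of `m`-cycles of `G`: the number of subgraphs of `G` isomorphic to the cycle
graph on `m` vertices. -/
def cycleCount {n : ℕ} (G : SimpleGraph (Fin n)) (m : ℕ) : ℕ :=
  G.copyCount (SimpleGraph.cycleGraph m)

/-- `m_n = ⌊(log n) ^ (1/4)⌋`. -/
def cycleLength (n : ℕ) : ℕ := ⌊Real.log n ^ (1 / 4 : ℝ)⌋₊

/-- The average degree `2 |E(G)| / n`. -/
def dHat {n : ℕ} (G : SimpleGraph (Fin n)) : ℝ := 2 * (G.edgeSet.ncard : ℝ) / n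

/-- The number `2 m_n C_{m_n} - d̂_n ^ m_n`. -/
def radicand {n : ℕ} (G : SimpleGraph (Fin n)) : ℝ :=
  2 * (cycleLength n : ℝ) * (cycleCount G (cycleLength n) : ℝ) - dHat G ^ cycleLength n

/-- The `m_n`-th root of `radicand G`. Where the radicand is negative there is no such real root in
general and the value is a junk value of the real power. -/
def fHat {n : ℕ} (G : SimpleGraph (Fin n)) : ℝ :=
  radicand G ^ (1 / (cycleLength n : ℝ))

/-- `est` is a (weakly) consistent estimator of `θ` under `SSBM(n, 2, a/n, b/n)`: it converges in
probability to `θ` as `n → ∞`. -/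
def IsConsistent (a b : ℝ) (est : ∀ n : ℕ, SimpleGraph (Fin n) → ℝ) (θ : ℝ) : Prop :=
  ∀ ε : ℝ, 0 < ε →
    Tendsto (fun n : ℕ => ssbmProb n 2 (a / n) (b / n) {z | ε ≤ |est n z.2 - θ|}) atTop (𝓝 0)

end

/-! ### Random access machines with logarithmic cost -/

namespace RAM

/-- Arithmetic operations on natural numbers (subtraction is truncated, division is rounded
down). -/
inductive Op where
  | add | sub | mul | div

/-- The value of an operation. -/
def Op.eval : Op → ℕ → ℕ → ℕ
  | .add, x, y => x + y
  | .sub, x, y => x - y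
  | .mul, x, y => x * y
  | .div, x, y => x / y

/-- A state: registers (of which a program can only name finitely many) and an array that is
addressed indirectly. -/
@[ext]
structure State where
  reg : ℕ → ℕ
  mem : ℕ → ℕ

/-- Overwrite a register. -/
def State.setReg (s : State) (i v : ℕ) : State := { s with reg := Function.update s.reg i v }

/-- Overwrite an array cell. -/
def State.setMem (s : State) (i v : ℕ) : State := { s with mem := Function.update s.mem i v }

/-- Programs. -/
inductive Prog where
  | skip
  /-- `reg i := c` -/
  | const (i c : ℕ)
  /-- `reg i := reg j op reg l` -/
  | op (o : Op) (i j l : ℕ)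
  /-- `reg i := mem (reg j)` -/
  | load (i j : ℕ)
  /-- `mem (reg i) := reg j` -/
  | store (i j : ℕ)
  | seq (P Q : Prog)
  /-- `if reg i < reg j then P else Q` -/
  | ifLt (i j : ℕ) (P Q : Prog)
  /-- `while reg i < reg j do P` -/
  | whileLt (i j : ℕ) (P : Prog)

/-- `Exec P s s' t`: started in the state `s`, the program `P` halts in the state `s'` after time
`t`. Every elementary step is charged one plus the number of bits of all numbers (operands,
addresses and results) that it handles. -/
inductive Exec : Prog → State → State → ℕ → Prop where
  | skip (s : State) : Exec .skip s s 1
  | const (s : State) (i c : ℕ) : Exec (.const i c) s (s.setReg i c) (1 + Nat.size c)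
  | op (s : State) (o : Op) (i j l : ℕ) :
      Exec (.op o i j l) s (s.setReg i (o.eval (s.reg j) (s.reg l)))
        (1 + Nat.size (s.reg j) + Nat.size (s.reg l) + Nat.size (o.eval (s.reg j) (s.reg l)))
  | load (s : State) (i j : ℕ) :
      Exec (.load i j) s (s.setReg i (s.mem (s.reg j)))
        (1 + Nat.size (s.reg j) + Nat.size (s.mem (s.reg j)))
  | store (s : State) (i j : ℕ) :
      Exec (.store i j) s (s.setMem (s.reg i) (s.reg j))
        (1 + Nat.size (s.reg i) + Nat.size (s.reg j))
  | seq {P Q : Prog} {s₁ s₂ s₃ : State} {t₁ t₂ : ℕ}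
      (h₁ : Exec P s₁ s₂ t₁) (h₂ : Exec Q s₂ s₃ t₂) : Exec (.seq P Q) s₁ s₃ (t₁ + t₂)
  | ifTrue {i j : ℕ} {P Q : Prog} {s s' : State} {t : ℕ}
      (hlt : s.reg i < s.reg j) (h : Exec P s s' t) :
      Exec (.ifLt i j P Q) s s' (1 + Nat.size (s.reg i) + Nat.size (s.reg j) + t)
  | ifFalse {i j : ℕ} {P Q : Prog} {s s' : State} {t : ℕ}
      (hlt : ¬ s.reg i < s.reg j) (h : Exec Q s s' t) :
      Exec (.ifLt i j P Q) s s' (1 + Nat.size (s.reg i) + Nat.size (s.reg j) + t)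
  | whileTrue {i j : ℕ} {P : Prog} {s₁ s₂ s₃ : State} {t₁ t₂ : ℕ}
      (hlt : s₁.reg i < s₁.reg j) (h₁ : Exec P s₁ s₂ t₁) (h₂ : Exec (.whileLt i j P) s₂ s₃ t₂) :
      Exec (.whileLt i j P) s₁ s₃ (1 + Nat.size (s₁.reg i) + Nat.size (s₁.reg j) + t₁ + t₂)
  | whileFalse {i j : ℕ} {P : Prog} {s : State} (hlt : ¬ s.reg i < s.reg j) :
      Exec (.whileLt i j P) s s (1 + Nat.size (s.reg i) + Nat.size (s.reg j))

open Classical in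
/-- The initial state on input a graph `G` on `n` vertices and a precision `k`: register `0` holds
`n`, register `1` holds `k`, the array holds the adjacency matrix of `G` row by row, and everything
else is zero. -/
noncomputable def input {n : ℕ} (G : SimpleGraph (Fin n)) (k : ℕ) : State where
  reg i := if i = 0 then n else if i = 1 then k else 0
  mem i := if ∃ u v : Fin n, i = u * n + v ∧ G.Adj u v then 1 else 0

/-- On every graph `G` and every precision `k`, the program halts within a time that is polynomial
in the number of vertices and `k`. -/
def PolyTime (P : Prog) : Prop :=
  ∃ c : ℕ, ∀ (n : ℕ) (G : SimpleGraph (Fin n)) (k : ℕ),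
    ∃ (s : State) (t : ℕ), Exec P (input G k) s t ∧ t ≤ (n + k + 2) ^ c

/-- On input `G` and any precision `k`, the program outputs `d` exactly, as the quotient of
registers `0` and `1`, and `f` up to an error of at most `2 ^ (-k)`, as the quotient of registers
`2` and `3`. -/
def Calculates (P : Prog) {n : ℕ} (G : SimpleGraph (Fin n)) (d f : ℝ) : Prop :=
  ∀ k : ℕ, ∃ (s : State) (t : ℕ), Exec P (input G k) s t ∧
    0 < s.reg 1 ∧ d = (s.reg 0 : ℝ) / (s.reg 1 : ℝ) ∧
    0 < s.reg 3 ∧ |f - (s.reg 2 : ℝ) / (s.reg 3 : ℝ)| ≤ (1 / 2 : ℝ) ^ k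

end RAM

/-!
Put `d = (a + b) / 2` and `f = (a - b) / 2`. The density of the `m`-cycle in the model is the
trace of the `m`-th power of a matrix whose eigenvalues are `d / n` and `f / n`, so that `2 m C_m`
has mean about `d ^ m + f ^ m`. If two distinct `m`-cycles meet, their union has more edges than
vertices, and such pairs contribute to the second moment only in proportion to `1 / n`. Hence the
variance of `2 m C_m` is about `2 m (d ^ m + f ^ m)`, which is negligible against `f ^ (2 m)`
because `d < f ^ 2`. The same argument for single edges puts `2 |E| / n` so close to `d` that also
the `m`-th powers are close. So the radicand is `f ^ m` up to a constant factor, which the `m`-th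
root sends to `1`.

To calculate the estimators, count the cycles by a depth first search over self-avoiding walks; by
Markov's inequality there are at most `n ^ 2` of these with high probability, so the search may
give up after `n ^ 2` nodes. The length `m` is the largest number with `e ^ (m ^ 4) ≤ n`. A
partial sum of the exponential series decides this for all large `n`, because Niven's polynomials
keep `e ^ M` away from the integers by more than the tail of the series. The root is found by
bisection.
-/

/-! ### Homomorphism densities in the stochastic block model -/

section StochasticBlockModel

open scoped Classical in
/-- The expectation of a function of the graph under `SBM(n, p, W)`. -/
noncomputable def sbmExp {n k : ℕ} (p : Fin k → ℝ) (W : Matrix (Fin k) (Fin k) ℝ) :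
    (SimpleGraph (Fin n) → ℝ) →ₗ[ℝ] ℝ :=
  ∑ x, ∑ G, sbmMass p W x G • LinearMap.proj G

/-- The symmetric matrix whose entries are the values of a function of unordered pairs. -/
def symMatrix {κ : Type*} (w : Sym2 κ → ℝ) : Matrix κ κ ℝ :=
  Matrix.of fun i j => w s(i, j)

open scoped Classical in
/-- The probability that the graph `H`, placed anywhere in the stochastic block model with label
law `p` and edge probabilities `w`, is present. -/
noncomputable def homDensity {ι : Type*} [Fintype ι] {k : ℕ} (p : Fin k → ℝ)
    (w : Sym2 (Fin k) → ℝ) (H : SimpleGraph ι) : ℝ :=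
  ∑ y : ι → Fin k, (∏ i, p (y i)) * ∏ e ∈ H.edgeFinset, w (e.map y)

variable {n k : ℕ} {p : Fin k → ℝ}

theorem homDensity_def {ι : Type*} [Fintype ι] [DecidableEq ι] (w : Sym2 (Fin k) → ℝ)
    (H : SimpleGraph ι) [Fintype H.edgeSet] :
    homDensity p w H = ∑ y : ι → Fin k, (∏ i, p (y i)) * ∏ e ∈ H.edgeFinset, w (e.map y) := by
  unfold homDensity
  congr!

theorem sbmExp_apply (W : Matrix (Fin k) (Fin k) ℝ) (F : SimpleGraph (Fin n) → ℝ) :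
    open scoped Classical in sbmExp p W F = ∑ x, ∑ G, sbmMass p W x G * F G := by
  simp only [sbmExp, LinearMap.sum_apply, LinearMap.smul_apply, LinearMap.proj_apply, smul_eq_mul]

theorem sbmProb_snd_eq_sbmExp (W : Matrix (Fin k) (Fin k) ℝ) (S : Set (SimpleGraph (Fin n))) :
    sbmProb p W {z | z.2 ∈ S} = sbmExp p W (S.indicator 1) := by
  classical
  simp only [sbmProb, sbmExp_apply, Set.indicator_apply, Set.mem_ofPred_eq, Pi.one_apply, mul_ite,
    mul_one, mul_zero]

theorem prod_vertexPairs (f : Sym2 (Fin n) → ℝ) :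
    open scoped Classical in
    ∏ e ∈ vertexPairs n, f s(e.1, e.2) = ∏ e ∈ (⊤ : SimpleGraph (Fin n)).edgeFinset, f e := by
  refine Finset.prod_bij (fun e _ => s(e.1, e.2)) ?_ ?_ ?_ fun _ _ => rfl
  · intro e he
    simpa [vertexPairs] using (Finset.mem_filter.1 he).2.ne
  · rintro ⟨u, v⟩ huv ⟨u', v'⟩ huv' h
    simp only [vertexPairs, Finset.mem_filter, Finset.mem_univ, true_and, Sym2.eq_iff,
      Prod.mk.injEq] at huv huv' h ⊢
    omega
  · intro e he
    induction e with | _ u v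
    have huv : u ≠ v := by simpa using he
    rcases huv.lt_or_gt with huv | huv
    · exact ⟨(u, v), by simpa [vertexPairs] using huv, rfl⟩
    · exact ⟨(v, u), by simpa [vertexPairs] using huv, Sym2.eq_swap⟩

theorem sbmMass_symMatrix (w : Sym2 (Fin k) → ℝ) (x : Fin n → Fin k) (G : SimpleGraph (Fin n)) :
    open scoped Classical in
    sbmMass p (symMatrix w) x G = (∏ u, p (x u)) *
      ((∏ e ∈ G.edgeFinset, w (e.map x)) *
        ∏ e ∈ (⊤ : SimpleGraph (Fin n)).edgeFinset \ G.edgeFinset, (1 - w (e.map x))) := by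
  classical
  have hG : G.edgeFinset ⊆ (⊤ : SimpleGraph (Fin n)).edgeFinset :=
    SimpleGraph.edgeFinset_mono le_top
  have h := prod_vertexPairs fun e : Sym2 (Fin n) =>
    if e ∈ G.edgeFinset then w (e.map x) else 1 - w (e.map x)
  simp only [SimpleGraph.mem_edgeFinset, SimpleGraph.mem_edgeSet, Sym2.map_mk] at h
  simp only [sbmMass, symMatrix, Matrix.of_apply]
  congr 1
  convert h using 1
  rw [← Finset.prod_sdiff hG, mul_comm]
  congr 1
  · exact Finset.prod_congr rfl fun e he => by
      rw [if_neg (by simpa using (Finset.mem_sdiff.1 he).2)]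
  · exact Finset.prod_congr rfl fun e he => by rw [if_pos (by simpa using he)]

theorem sum_simpleGraph {V : Type*} [Fintype V] (f : Finset (Sym2 V) → ℝ) :
    open scoped Classical in
    ∑ G : SimpleGraph V, f G.edgeFinset = ∑ S ∈ (⊤ : SimpleGraph V).edgeFinset.powerset, f S := by
  classical
  refine Finset.sum_bij' (fun G _ => G.edgeFinset)
    (fun S _ => SimpleGraph.fromEdgeSet (S : Set (Sym2 V))) ?_ ?_ ?_ ?_ ?_
  · exact fun G _ => Finset.mem_powerset.2 (SimpleGraph.edgeFinset_mono le_top)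
  · exact fun _ _ => Finset.mem_univ _
  · intro G _
    simp
  · intro S hS
    ext e
    have he : e ∈ S → ¬ e.IsDiag := fun h => by
      simpa using Finset.mem_powerset.1 hS h
    simpa using he
  · exact fun _ _ => rfl

/-- Expanding `∏ (w e + (1 - w e))` over the pairs outside `H`. -/
theorem sum_ge_prod_mul_prod_one_sub {V : Type*} [Fintype V] (H : SimpleGraph V)
    (w : Sym2 V → ℝ) :
    open scoped Classical in
    ∑ G : SimpleGraph V, ((∏ e ∈ G.edgeFinset, w e) *
      ∏ e ∈ (⊤ : SimpleGraph V).edgeFinset \ G.edgeFinset, (1 - w e)) *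
        (Set.Ici H).indicator 1 G = ∏ e ∈ H.edgeFinset, w e := by
  classical
  have hH : H.edgeFinset ⊆ (⊤ : SimpleGraph V).edgeFinset := SimpleGraph.edgeFinset_mono le_top
  have hterm : ∀ G : SimpleGraph V, ((∏ e ∈ G.edgeFinset, w e) *
      ∏ e ∈ (⊤ : SimpleGraph V).edgeFinset \ G.edgeFinset, (1 - w e)) *
        (Set.Ici H).indicator 1 G = (∏ e ∈ G.edgeFinset, w e) *
      ∏ e ∈ (⊤ : SimpleGraph V).edgeFinset \ G.edgeFinset,
        if e ∈ H.edgeFinset then 0 else 1 - w e := by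
    intro G
    rw [mul_assoc]
    congr 1
    by_cases hG : H ≤ G
    · rw [Set.indicator_of_mem (Set.mem_Ici.2 hG), Pi.one_apply, mul_one]
      refine Finset.prod_congr rfl fun e he => (if_neg fun heH => ?_).symm
      exact (Finset.mem_sdiff.1 he).2 (SimpleGraph.edgeFinset_mono hG heH)
    · rw [Set.indicator_of_notMem hG, mul_zero]
      rw [← SimpleGraph.edgeFinset_subset_edgeFinset] at hG
      obtain ⟨e, heH, heG⟩ := Finset.not_subset.1 hG
      refine (Finset.prod_eq_zero (Finset.mem_sdiff.2 ⟨hH heH, heG⟩) ?_).symm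
      exact if_pos heH
  rw [Finset.sum_congr rfl fun G _ => hterm G, sum_simpleGraph fun S => (∏ e ∈ S, w e) *
    ∏ e ∈ (⊤ : SimpleGraph V).edgeFinset \ S, if e ∈ H.edgeFinset then 0 else 1 - w e,
    ← Finset.prod_add, ← Finset.prod_sdiff hH, Finset.prod_eq_one, one_mul]
  · exact Finset.prod_congr rfl fun e he => by rw [if_pos he, add_zero]
  · exact fun e he => by rw [if_neg (Finset.mem_sdiff.1 he).2, add_sub_cancel]

theorem sbmExp_indicator_Ici (w : Sym2 (Fin k) → ℝ) (H : SimpleGraph (Fin n)) :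
    sbmExp p (symMatrix w) ((Set.Ici H).indicator 1) = homDensity p w H := by
  classical
  simp only [sbmExp_apply, homDensity_def, sbmMass_symMatrix, mul_assoc, ← Finset.mul_sum]
  refine Finset.sum_congr rfl fun x _ => ?_
  rw [← sum_ge_prod_mul_prod_one_sub H fun e => w (e.map x)]
  simp only [mul_assoc]
  congr!

section Embedding

variable {ι κ β : Type*} [Fintype ι] [Fintype κ] [Fintype β]

theorem sum_prod_comp_eq_one [DecidableEq ι] {q : β → ℝ} (hq : ∑ b, q b = 1) :
    ∑ y : ι → β, ∏ i, q (y i) = 1 := by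
  rw [← Fintype.piFinset_univ, ← Finset.prod_univ_sum]
  simp only [hq, Finset.prod_const_one]

/-- The labels outside the range of `g` sum out to `1`. -/
theorem sum_prod_mul_comp_embedding {q : β → ℝ} (hq : ∑ b, q b = 1) (g : ι ↪ κ)
    (F : (ι → β) → ℝ) :
    open scoped Classical in
    ∑ x : κ → β, (∏ v, q (x v)) * F (x ∘ g) = ∑ y : ι → β, (∏ i, q (y i)) * F y := by
  classical
  let e : (κ → β) ≃ (ι → β) × ({v // v ∉ Set.range g} → β) :=
    (Equiv.piEquivPiSubtypeProd (fun v => v ∈ Set.range g) fun _ => β).trans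
      (Equiv.prodCongr ((Equiv.ofInjective g g.injective).symm.arrowCongr (.refl β)) (.refl _))
  have hprod : ∀ x : κ → β, ∏ v, q (x v) =
      (∏ i, q ((e x).1 i)) * ∏ v, q ((e x).2 v) := by
    intro x
    rw [← Fintype.prod_subtype_mul_prod_subtype fun v => v ∈ Set.range g]
    congr 1
    convert ((Equiv.ofInjective g g.injective).prod_comp fun v => q (x v)).symm
    rfl
  have hcomp : ∀ x : κ → β, x ∘ g = (e x).1 := fun _ => rfl
  simp only [hprod, hcomp]
  rw [e.sum_comp fun z => (∏ i, q (z.1 i)) * (∏ v, q (z.2 v)) * F z.1, Fintype.sum_prod_type]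
  refine Finset.sum_congr rfl fun y _ => ?_
  calc ∑ z : {v // v ∉ Set.range g} → β, (∏ i, q (y i)) * (∏ v, q (z v)) * F y
      = (∏ i, q (y i)) * F y * ∑ z : {v // v ∉ Set.range g} → β, ∏ v, q (z v) := by
        rw [Finset.mul_sum]
        exact Finset.sum_congr rfl fun z _ => by ring
    _ = (∏ i, q (y i)) * F y := by rw [sum_prod_comp_eq_one hq, mul_one]

theorem homDensity_map {w : Sym2 (Fin k) → ℝ} (hp : ∑ i, p i = 1) (g : ι ↪ κ)
    (H : SimpleGraph ι) : homDensity p w (H.map g) = homDensity p w H := by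
  classical
  rw [homDensity_def, homDensity_def,
    ← sum_prod_mul_comp_embedding hp g fun y => ∏ e ∈ H.edgeFinset, w (e.map y)]
  refine Finset.sum_congr rfl fun x _ => ?_
  have hE : (H.map g).edgeFinset = H.edgeFinset.map g.sym2Map := by
    ext e
    simp
  rw [hE, Finset.prod_map]
  simp only [Function.Embedding.sym2Map_apply, Sym2.map_map]

end Embedding

variable {ι : Type*} [Fintype ι]

theorem sum_eq_map_inl_sup_map_inr {α β : Type*} (H : SimpleGraph α) (H' : SimpleGraph β) :
    H ⊕g H' = H.map Function.Embedding.inl ⊔ H'.map Function.Embedding.inr := by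
  ext u v
  simp only [SimpleGraph.sup_adj, SimpleGraph.map_adj]
  rcases u with u | u <;> rcases v with v | v <;> simp

theorem homDensity_sum {κ : Type*} [Fintype κ] (w : Sym2 (Fin k) → ℝ) (H : SimpleGraph ι)
    (H' : SimpleGraph κ) :
    homDensity p w (H ⊕g H') = homDensity p w H * homDensity p w H' := by
  classical
  have hE : (H ⊕g H').edgeFinset =
      H.edgeFinset.map Function.Embedding.inl.sym2Map ∪
        H'.edgeFinset.map Function.Embedding.inr.sym2Map := by
    rw [← SimpleGraph.edgeFinset_map, ← SimpleGraph.edgeFinset_map, ← SimpleGraph.edgeFinset_sup]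
    congr!
    exact sum_eq_map_inl_sup_map_inr H H'
  have hdisj : Disjoint (H.edgeFinset.map Function.Embedding.inl.sym2Map)
      (H'.edgeFinset.map (Function.Embedding.inr : κ ↪ ι ⊕ κ).sym2Map) := by
    simp [Finset.disjoint_left, Sym2.forall]
  simp only [homDensity_def]
  rw [Finset.sum_mul_sum, ← Fintype.sum_prod_type',
    ← (Equiv.sumArrowEquivProdArrow ι κ (Fin k)).sum_comp]
  refine Finset.sum_congr rfl fun y _ => ?_
  rw [hE, Finset.prod_union hdisj, Finset.prod_map, Finset.prod_map, Fintype.prod_sum_type]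
  simp only [Function.Embedding.sym2Map_apply, Sym2.map_map, Function.Embedding.inl_apply]
  exact mul_mul_mul_comm ..

theorem homDensity_le_pow (hp₀ : ∀ i, 0 ≤ p i) (hp : ∑ i, p i = 1) {w : Sym2 (Fin k) → ℝ}
    (hw₀ : ∀ e, 0 ≤ w e) {A : ℝ} (hwA : ∀ e, w e ≤ A) (H : SimpleGraph ι) :
    homDensity p w H ≤ A ^ H.edgeSet.ncard := by
  classical
  rw [Set.ncard_eq_toFinset_card', ← SimpleGraph.edgeFinset]
  calc homDensity p w H
      ≤ ∑ y : ι → Fin k, (∏ i, p (y i)) * ∏ _e ∈ H.edgeFinset, A := by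
        rw [homDensity_def]
        gcongr with y _ e _
        · exact Finset.prod_nonneg fun i _ => hp₀ _
        · exact fun _ _ => hw₀ _
        · exact hwA _
    _ = A ^ H.edgeFinset.card := by
      rw [← Finset.sum_mul, sum_prod_comp_eq_one hp, one_mul, Finset.prod_const]

theorem homDensity_anti (hp₀ : ∀ i, 0 ≤ p i) {w : Sym2 (Fin k) → ℝ}
    (hw₀ : ∀ e, 0 ≤ w e) (hw₁ : ∀ e, w e ≤ 1) : Antitone (homDensity (ι := ι) p w) := by
  intro H H' hH
  classical
  simp only [homDensity_def]
  refine Finset.sum_le_sum fun y _ => mul_le_mul_of_nonneg_left ?_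
    (Finset.prod_nonneg fun i _ => hp₀ _)
  exact Finset.prod_le_prod_of_subset_of_le_one (SimpleGraph.edgeFinset_mono hH)
    (fun _ _ => hw₀ _) fun _ _ _ => hw₁ _

theorem homDensity_nonneg (hp₀ : ∀ i, 0 ≤ p i) {w : Sym2 (Fin k) → ℝ} (hw₀ : ∀ e, 0 ≤ w e)
    (H : SimpleGraph ι) : 0 ≤ homDensity p w H :=
  Finset.sum_nonneg fun _ _ => mul_nonneg (Finset.prod_nonneg fun _ _ => hp₀ _)
    (Finset.prod_nonneg fun _ _ => hw₀ _)

theorem sbmMass_nonneg (hp₀ : ∀ i, 0 ≤ p i) {W : Matrix (Fin k) (Fin k) ℝ}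
    (hW₀ : ∀ i j, 0 ≤ W i j) (hW₁ : ∀ i j, W i j ≤ 1)
    (x : Fin n → Fin k) (G : SimpleGraph (Fin n)) : 0 ≤ sbmMass p W x G := by
  unfold sbmMass
  refine mul_nonneg (Finset.prod_nonneg fun _ _ => hp₀ _) (Finset.prod_nonneg fun e _ => ?_)
  split_ifs
  · exact hW₀ _ _
  · exact sub_nonneg.2 (hW₁ _ _)

theorem sbmExp_mono (hp₀ : ∀ i, 0 ≤ p i) {W : Matrix (Fin k) (Fin k) ℝ} (hW₀ : ∀ i j, 0 ≤ W i j)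
    (hW₁ : ∀ i j, W i j ≤ 1) : Monotone (sbmExp (n := n) p W) := by
  intro F F' hF
  simp only [sbmExp_apply]
  gcongr with x _ G _
  · exact sbmMass_nonneg hp₀ hW₀ hW₁ x G
  · exact hF G

theorem sbmExp_one (hp : ∑ i, p i = 1) (w : Sym2 (Fin k) → ℝ) :
    sbmExp (n := n) p (symMatrix w) 1 = 1 := by
  classical
  have h := sbmExp_indicator_Ici (n := n) (p := p) w ⊥
  rw [Set.Ici_bot, Set.indicator_univ] at h
  rw [h, homDensity_def]
  simp only [SimpleGraph.edgeFinset_bot, Finset.prod_empty, mul_one]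
  exact sum_prod_comp_eq_one hp

end StochasticBlockModel

/-! ### Moments of labelled copy counts -/

section CopyMoments

variable {n k : ℕ} {p : Fin k → ℝ} {w : Sym2 (Fin k) → ℝ} {ι : Type*} [Fintype ι]

open scoped Classical in
theorem labelledCopyCount_eq_sum_embedding {V : Type*} [Fintype V] (G : SimpleGraph V)
    (H : SimpleGraph ι) :
    G.labelledCopyCount H = ∑ g : ι ↪ V, if H.map g ≤ G then 1 else 0 := by
  let e : H.Copy G ≃ {g : ι ↪ V // H.map g ≤ G} :=
    { toFun := fun f => ⟨f.toEmbedding, (SimpleGraph.map_le_iff_le_comap ..).2 fun _ _ h =>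
        f.toHom.map_adj h⟩
      invFun := fun g =>
        ⟨⟨g.1, fun h => (SimpleGraph.map_le_iff_le_comap ..).1 g.2 h⟩, g.1.injective⟩
      left_inv := fun _ => rfl
      right_inv := fun _ => rfl }
  rw [Finset.sum_boole, Nat.cast_id, SimpleGraph.labelledCopyCount, ← Fintype.card_subtype]
  exact Fintype.card_congr e

theorem cast_labelledCopyCount {V : Type*} [Fintype V] (G : SimpleGraph V) (H : SimpleGraph ι) :
    (G.labelledCopyCount H : ℝ) = ∑ g : ι ↪ V, (Set.Ici (H.map g)).indicator 1 G := by
  classical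
  simp only [labelledCopyCount_eq_sum_embedding, Set.indicator_apply, Set.mem_Ici, Pi.one_apply,
    Nat.cast_sum, Nat.cast_ite, Nat.cast_one, Nat.cast_zero]

theorem sbmExp_labelledCopyCount (hp : ∑ i, p i = 1) (H : SimpleGraph ι) :
    sbmExp p (symMatrix w) (fun G : SimpleGraph (Fin n) => (G.labelledCopyCount H : ℝ)) =
      n.descFactorial (Fintype.card ι) * homDensity p w H := by
  classical
  have hsum : (fun G : SimpleGraph (Fin n) => (G.labelledCopyCount H : ℝ)) =
      ∑ g : ι ↪ Fin n, (Set.Ici (H.map g)).indicator 1 := by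
    ext G
    rw [cast_labelledCopyCount, Finset.sum_apply]
  rw [hsum, map_sum]
  simp only [sbmExp_indicator_Ici, homDensity_map hp, Finset.sum_const, Finset.card_univ,
    Fintype.card_embedding_eq, Fintype.card_fin, nsmul_eq_mul]

theorem sbmExp_labelledCopyCount_sq (H : SimpleGraph ι) :
    sbmExp p (symMatrix w) (fun G : SimpleGraph (Fin n) => (G.labelledCopyCount H : ℝ) ^ 2) =
      ∑ g : ι ↪ Fin n, ∑ h : ι ↪ Fin n, homDensity p w (H.map g ⊔ H.map h) := by
  have hsum : (fun G : SimpleGraph (Fin n) => (G.labelledCopyCount H : ℝ) ^ 2) =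
      ∑ g : ι ↪ Fin n, ∑ h : ι ↪ Fin n, (Set.Ici (H.map g ⊔ H.map h)).indicator 1 := by
    ext G
    simp only [cast_labelledCopyCount, sq, Finset.sum_mul_sum, Finset.sum_apply,
      ← Set.Ici_inter_Ici, Set.inter_indicator_one, Pi.mul_apply]
  simp only [hsum, map_sum, sbmExp_indicator_Ici]

theorem sbmExp_sub_sq (hp : ∑ i, p i = 1) (F : SimpleGraph (Fin n) → ℝ) :
    sbmExp p (symMatrix w) (fun G => (F G - sbmExp p (symMatrix w) F) ^ 2) =
      sbmExp p (symMatrix w) (fun G => F G ^ 2) - sbmExp p (symMatrix w) F ^ 2 := by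
  set c := sbmExp p (symMatrix w) F with hc
  have h : (fun G => (F G - c) ^ 2) = (fun G => F G ^ 2) - (2 * c) • F + c ^ 2 • 1 := by
    ext G
    simp only [Pi.add_apply, Pi.sub_apply, Pi.smul_apply, Pi.one_apply, smul_eq_mul]
    ring
  rw [h, map_add, map_sub, map_smul, map_smul, sbmExp_one hp, ← hc, smul_eq_mul, smul_eq_mul]
  ring

open scoped Classical in
/-- The number of places at which `h` takes a value of `g`. -/
noncomputable def overlap {V : Type*} (g h : ι → V) : ℕ :=
  (Finset.univ.filter fun i => h i ∈ Set.range g).card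

theorem card_le_overlap {V : Type*} {g h : ι → V} {J : Finset ι}
    (hJ : ∀ i ∈ J, h i ∈ Set.range g) : J.card ≤ overlap g h := by
  classical
  exact Finset.card_le_card fun i hi => Finset.mem_filter.2 ⟨Finset.mem_univ i, hJ i hi⟩

theorem overlap_eq_zero {V : Type*} {g h : ι → V} :
    overlap g h = 0 ↔ ∀ i, h i ∉ Set.range g := by
  simp [overlap, Finset.filter_eq_empty_iff]

/-- The sum over all maps `h` factorizes over the places; at each place the values of `g`
contribute at most `n * card ι` and the other values at most `n`. -/
theorem sum_pow_overlap_le (g : ι → Fin n) :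
    ∑ h : ι ↪ Fin n, (n : ℝ) ^ overlap g h ≤
      (n : ℝ) ^ Fintype.card ι * (Fintype.card ι + 1 : ℝ) ^ Fintype.card ι := by
  classical
  have hfactor : ∀ h : ι → Fin n, (n : ℝ) ^ overlap g h =
      ∏ i, (if h i ∈ Set.range g then (n : ℝ) else 1) := by
    intro h
    rw [Finset.prod_ite, Finset.prod_const, Finset.prod_const_one, mul_one, overlap]
    congr!
  have hplace : ∑ v : Fin n, (if v ∈ Set.range g then (n : ℝ) else 1) ≤
      n * (Fintype.card ι + 1) := by
    have hcard : (Finset.univ.filter fun v => v ∈ Set.range g).card ≤ Fintype.card ι := by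
      rw [← Fintype.card_subtype]
      exact Fintype.card_range_le g
    calc ∑ v : Fin n, (if v ∈ Set.range g then (n : ℝ) else 1)
        ≤ ∑ v : Fin n, ((if v ∈ Set.range g then (n : ℝ) else 0) + 1) :=
          Finset.sum_le_sum fun v _ => by split_ifs <;> simp
      _ = (Finset.univ.filter fun v => v ∈ Set.range g).card * n + n := by
          simp [Finset.sum_add_distrib, ← Finset.sum_filter]
      _ ≤ Fintype.card ι * n + n := by gcongr
      _ = n * (Fintype.card ι + 1) := by ring
  calc ∑ h : ι ↪ Fin n, (n : ℝ) ^ overlap g h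
      = ∑ h ∈ (Finset.univ : Finset (ι ↪ Fin n)).map ⟨_, DFunLike.coe_injective⟩,
          (n : ℝ) ^ overlap g h := by rw [Finset.sum_map]; rfl
    _ ≤ ∑ h : ι → Fin n, (n : ℝ) ^ overlap g h :=
        Finset.sum_le_sum_of_subset_of_nonneg (Finset.subset_univ _) fun _ _ _ => by positivity
    _ = ∏ _i : ι, ∑ v : Fin n, (if v ∈ Set.range g then (n : ℝ) else 1) := by
        simp only [hfactor, Finset.prod_univ_sum, Fintype.piFinset_univ]
    _ ≤ ∏ _i : ι, (n * (Fintype.card ι + 1) : ℝ) :=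
        Finset.prod_le_prod (fun i _ => Finset.sum_nonneg fun v _ => by positivity)
          fun i _ => hplace
    _ = _ := by rw [Finset.prod_const, Finset.card_univ, mul_pow]

theorem homDensity_map_sup_map_of_overlap_eq_zero {V : Type*} [Fintype V] (hp : ∑ i, p i = 1)
    (H : SimpleGraph ι) {g h : ι ↪ V} (hgh : overlap g h = 0) :
    homDensity p w (H.map g ⊔ H.map h) = homDensity p w H ^ 2 := by
  have hdisj : ∀ i j, g i ≠ h j := fun i j hij => overlap_eq_zero.1 hgh j ⟨i, hij⟩
  let gh : ι ⊕ ι ↪ V := ⟨Sum.elim g h, g.injective.sumElim h.injective hdisj⟩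
  have hmap : H.map g ⊔ H.map h = (H ⊕g H).map gh := by
    ext u v
    simp only [SimpleGraph.sup_adj, SimpleGraph.map_adj, Sum.exists]
    simp [gh]
  rw [hmap, homDensity_map hp, homDensity_sum, sq]

open scoped Classical in
/-- A pair of copies whose union has few edges, relative to the number of shared vertices, is not
controlled by counting; it only contributes the density of one copy. -/
theorem homDensity_map_sup_map_le (hp₀ : ∀ i, 0 ≤ p i) (hp : ∑ i, p i = 1) (hw₀ : ∀ e, 0 ≤ w e)
    (hw₁ : ∀ e, w e ≤ 1) {a : ℝ} (ha : 1 ≤ a) (hwa : ∀ e, w e ≤ a / n) (H : SimpleGraph ι)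
    (g h : ι ↪ Fin n) :
    homDensity p w (H.map g ⊔ H.map h) ≤ homDensity p w H ^ 2 +
      (if overlap g h ≠ 0 ∧ (H.map g ⊔ H.map h).edgeSet.ncard + overlap g h ≤
        2 * H.edgeSet.ncard then homDensity p w H else 0) +
      a ^ (2 * H.edgeSet.ncard) / (n : ℝ) ^ (2 * H.edgeSet.ncard + 1) *
        (n : ℝ) ^ overlap g h := by
  set e := H.edgeSet.ncard
  set e' := (H.map g ⊔ H.map h).edgeSet.ncard with he'
  have _ha₀ : 0 ≤ a := zero_le_one.trans ha
  have hsq : 0 ≤ homDensity p w H ^ 2 := sq_nonneg _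
  have hc : 0 ≤ a ^ (2 * e) / (n : ℝ) ^ (2 * e + 1) * (n : ℝ) ^ overlap g h := by positivity
  by_cases h₀ : overlap g h = 0
  · rw [homDensity_map_sup_map_of_overlap_eq_zero hp H h₀, if_neg (by simp [h₀])]
    linarith
  by_cases hexc : e' + overlap g h ≤ 2 * e
  · rw [if_pos ⟨h₀, hexc⟩]
    have := (homDensity_anti hp₀ hw₀ hw₁ (le_sup_left (a := H.map g) (b := H.map h))).trans_eq
      (homDensity_map hp g H)
    linarith
  rw [if_neg fun hexc' => hexc hexc'.2]
  have hn : (1 : ℝ) ≤ n := by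
    obtain ⟨i⟩ : Nonempty ι := not_isEmpty_iff.1 fun _ => h₀ (overlap_eq_zero.2 isEmptyElim)
    exact_mod_cast (g i).pos
  have he₂ : e' ≤ 2 * e := by
    rw [he', SimpleGraph.edgeSet_sup, two_mul]
    refine (Set.ncard_union_le _ _).trans_eq ?_
    rw [SimpleGraph.edgeSet_map, SimpleGraph.edgeSet_map,
      Set.ncard_image_of_injective _ g.sym2Map.injective,
      Set.ncard_image_of_injective _ h.sym2Map.injective]
  have hpow : (n : ℝ) ^ (2 * e + 1) ≤ (n : ℝ) ^ overlap g h * (n : ℝ) ^ e' := by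
    rw [← pow_add]
    exact pow_le_pow_right₀ hn (by omega)
  calc homDensity p w (H.map g ⊔ H.map h) ≤ (a / n) ^ e' :=
        homDensity_le_pow hp₀ hp hw₀ hwa _
    _ = a ^ e' / (n : ℝ) ^ e' := div_pow ..
    _ ≤ a ^ (2 * e) / (n : ℝ) ^ e' := by gcongr
    _ ≤ a ^ (2 * e) / (n : ℝ) ^ (2 * e + 1) * (n : ℝ) ^ overlap g h := by
        rw [div_mul_eq_mul_div, div_le_div_iff₀ (by positivity) (by positivity), mul_assoc]
        gcongr
    _ ≤ _ := by linarith

theorem sbmExp_labelledCopyCount_sub_sq_le (hp₀ : ∀ i, 0 ≤ p i) (hp : ∑ i, p i = 1)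
    (hw₀ : ∀ e, 0 ≤ w e) (hw₁ : ∀ e, w e ≤ 1) {a : ℝ} (ha : 1 ≤ a) (hwa : ∀ e, w e ≤ a / n)
    (H : SimpleGraph ι) {L : ℕ}
    (hL : ∀ g : ι ↪ Fin n, {h : ι ↪ Fin n | overlap g h ≠ 0 ∧
      (H.map g ⊔ H.map h).edgeSet.ncard + overlap g h ≤ 2 * H.edgeSet.ncard}.ncard ≤ L) :
    sbmExp p (symMatrix w) (fun G : SimpleGraph (Fin n) => ((G.labelledCopyCount H : ℝ) -
        n.descFactorial (Fintype.card ι) * homDensity p w H) ^ 2) ≤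
      (n : ℝ) ^ Fintype.card ι * (L * homDensity p w H +
        a ^ (2 * H.edgeSet.ncard) / (n : ℝ) ^ (2 * H.edgeSet.ncard + 1) *
          ((n : ℝ) ^ Fintype.card ι * (Fintype.card ι + 1 : ℝ) ^ Fintype.card ι)) := by
  set q := homDensity p w H
  set c := a ^ (2 * H.edgeSet.ncard) / (n : ℝ) ^ (2 * H.edgeSet.ncard + 1)
  set S := (n : ℝ) ^ Fintype.card ι * (Fintype.card ι + 1 : ℝ) ^ Fintype.card ι
  have hq : 0 ≤ q := homDensity_nonneg hp₀ hw₀ H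
  have _hc : 0 ≤ c := by positivity
  have hcard : ((Finset.univ : Finset (ι ↪ Fin n)).card : ℝ) =
      n.descFactorial (Fintype.card ι) := by
    rw [Finset.card_univ, Fintype.card_embedding_eq, Fintype.card_fin]
  have hinner : ∀ g : ι ↪ Fin n, ∑ h : ι ↪ Fin n, homDensity p w (H.map g ⊔ H.map h) ≤
      n.descFactorial (Fintype.card ι) * q ^ 2 + L * q + c * S := by
    intro g
    classical
    refine (Finset.sum_le_sum fun h _ =>
      homDensity_map_sup_map_le hp₀ hp hw₀ hw₁ ha hwa H g h).trans ?_
    rw [Finset.sum_add_distrib, Finset.sum_add_distrib, Finset.sum_const, nsmul_eq_mul, hcard,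
      ← Finset.sum_filter, Finset.sum_const, nsmul_eq_mul, ← Finset.mul_sum]
    gcongr
    · simpa only [Set.ncard_eq_toFinset_card', Set.toFinset_ofPred] using hL g
    · exact sum_pow_overlap_le g
  have hmean := sbmExp_labelledCopyCount (n := n) (w := w) hp H
  rw [← hmean, sbmExp_sub_sq hp, hmean, sbmExp_labelledCopyCount_sq]
  calc ∑ g : ι ↪ Fin n, ∑ h : ι ↪ Fin n, homDensity p w (H.map g ⊔ H.map h) -
        (n.descFactorial (Fintype.card ι) * q) ^ 2
      ≤ n.descFactorial (Fintype.card ι) *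
          (n.descFactorial (Fintype.card ι) * q ^ 2 + L * q + c * S) -
        (n.descFactorial (Fintype.card ι) * q) ^ 2 := by
        gcongr
        rw [← hcard, ← nsmul_eq_mul, ← Finset.sum_const, hcard]
        exact Finset.sum_le_sum fun g _ => hinner g
    _ = n.descFactorial (Fintype.card ι) * (L * q + c * S) := by ring
    _ ≤ (n : ℝ) ^ Fintype.card ι * (L * q + c * S) := by
        gcongr
        exact_mod_cast Nat.descFactorial_le_pow n _

end CopyMoments

/-! ### Copies of cycles -/

section Automorphisms

variable {ι V : Type*} {H : SimpleGraph ι}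

theorem exists_iso_of_map_eq [Finite ι] {g h : ι ↪ V} (hgh : H.map g = H.map h)
    (hrange : ∀ i, h i ∈ Set.range g) : ∃ σ : H ≃g H, ∀ i, g (σ i) = h i := by
  choose σ hσ using hrange
  have hσ_inj : Function.Injective σ := fun i j hij => h.injective (by rw [← hσ, ← hσ, hij])
  refine ⟨⟨Equiv.ofBijective σ (Finite.injective_iff_bijective.1 hσ_inj), fun {i j} => ?_⟩, hσ⟩
  rw [Equiv.ofBijective_apply, Equiv.ofBijective_apply, ← SimpleGraph.map_adj_apply (f := g), hσ,
    hσ, hgh, SimpleGraph.map_adj_apply]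

theorem map_comp_iso (g : ι ↪ V) (σ : H ≃g H) :
    H.map (σ.toEquiv.toEmbedding.trans g) = H.map g := by
  ext u v
  simp only [SimpleGraph.map_adj]
  constructor
  · rintro ⟨i, j, hij, rfl, rfl⟩
    exact ⟨σ i, σ j, σ.map_adj_iff.2 hij, rfl, rfl⟩
  · rintro ⟨i, j, hij, rfl, rfl⟩
    exact ⟨σ.symm i, σ.symm j, σ.symm.map_adj_iff.2 hij, by simp, by simp⟩

theorem mem_range_of_map_eq {g h : ι ↪ V} (hH : ∀ i, ∃ j, H.Adj i j) (hgh : H.map g = H.map h)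
    (i : ι) : h i ∈ Set.range g := by
  obtain ⟨j, hij⟩ := hH i
  have hadj : (H.map g).Adj (h i) (h j) := by rwa [hgh, SimpleGraph.map_adj_apply]
  obtain ⟨i', -, -, hi', -⟩ := (SimpleGraph.map_adj _ _ _ _).1 hadj
  exact ⟨i', hi'⟩

instance finite_graph_iso [Finite ι] : Finite (H ≃g H) := DFunLike.finite _

theorem ncard_setOf_map_eq_le [Finite ι] (hH : ∀ i, ∃ j, H.Adj i j) (g : ι ↪ V) :
    {h : ι ↪ V | H.map g = H.map h}.ncard ≤ Nat.card (H ≃g H) := by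
  rw [← Set.ncard_univ]
  refine (Set.ncard_le_ncard (t := (fun σ : H ≃g H => σ.toEquiv.toEmbedding.trans g) '' Set.univ)
    (fun h hgh => ?_) (Set.toFinite _)).trans (Set.ncard_image_le (Set.toFinite _))
  obtain ⟨σ, hσ⟩ := exists_iso_of_map_eq hgh (mem_range_of_map_eq hH hgh)
  exact ⟨σ, Set.mem_univ σ, DFunLike.ext _ _ hσ⟩

theorem toSubgraph_adj_iff {G : SimpleGraph V} (f : H.Copy G) {u v : V} :
    f.toSubgraph.Adj u v ↔ (H.map f.toEmbedding).Adj u v := by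
  simp only [SimpleGraph.Subgraph.map_adj, SimpleGraph.map_adj, Relation.Map,
    SimpleGraph.Subgraph.top_adj]
  rfl

theorem toSubgraph_eq_iff_exists_iso [Finite ι] {G : SimpleGraph V} {f f' : H.Copy G} :
    f'.toSubgraph = f.toSubgraph ↔ ∃ σ : H ≃g H, f.comp σ.toCopy = f' := by
  constructor
  · intro hff
    have hmap : H.map f.toEmbedding = H.map f'.toEmbedding := by
      ext u v
      rw [← toSubgraph_adj_iff, ← toSubgraph_adj_iff, hff]
    have hrange : ∀ i, f'.toEmbedding i ∈ Set.range f.toEmbedding := by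
      intro i
      have hi : f' i ∈ f'.toSubgraph.verts := by simp
      rw [hff] at hi
      obtain ⟨j, -, hj⟩ := hi
      exact ⟨j, hj⟩
    obtain ⟨σ, hσ⟩ := exists_iso_of_map_eq hmap hrange
    exact ⟨σ, SimpleGraph.Copy.ext hσ⟩
  · rintro ⟨σ, rfl⟩
    refine SimpleGraph.Subgraph.ext ?_ ?_
    · ext v
      simp only [SimpleGraph.Subgraph.map_verts, SimpleGraph.Subgraph.verts_top, Set.image_univ,
        SimpleGraph.Copy.coe_toHom, SimpleGraph.Copy.coe_comp]
      exact Set.ext_iff.1 (σ.surjective.range_comp f) v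
    · ext u v
      rw [toSubgraph_adj_iff, toSubgraph_adj_iff, ← map_comp_iso f.toEmbedding σ]
      rfl

theorem labelledCopyCount_eq_card_iso_mul_copyCount [Fintype ι] [Fintype V] (G : SimpleGraph V)
    (H : SimpleGraph ι) :
    G.labelledCopyCount H = Nat.card (H ≃g H) * G.copyCount H := by
  classical
  have := Fintype.ofFinite (H ≃g H)
  have hfiber : ∀ S ∈ (Finset.univ : Finset (H.Copy G)).image SimpleGraph.Copy.toSubgraph,
      (Finset.univ.filter fun f : H.Copy G => f.toSubgraph = S).card = Nat.card (H ≃g H) := by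
    intro S hS
    obtain ⟨f, -, rfl⟩ := Finset.mem_image.1 hS
    have himage : (Finset.univ.filter fun f' : H.Copy G => f'.toSubgraph = f.toSubgraph) =
        Finset.univ.image fun σ : H ≃g H => f.comp σ.toCopy := by
      ext f'
      simp only [Finset.mem_filter, Finset.mem_univ, true_and, Finset.mem_image,
        toSubgraph_eq_iff_exists_iso]
    rw [himage, Finset.card_image_of_injective, Finset.card_univ, Nat.card_eq_fintype_card]
    intro σ τ hστ
    exact DFunLike.ext _ _ fun i => f.injective (DFunLike.congr_fun hστ i)
  rw [SimpleGraph.copyCount_eq_card_image_copyToSubgraph, SimpleGraph.labelledCopyCount,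
    ← Finset.card_univ, Finset.card_eq_sum_card_image SimpleGraph.Copy.toSubgraph,
    Finset.sum_congr rfl hfiber, Finset.sum_const, smul_eq_mul, mul_comm]

end Automorphisms

section CycleGraph

variable {m : ℕ} [NeZero m]

theorem fin_one_add_one_ne_zero (hm : 3 ≤ m) : (1 + 1 : Fin m) ≠ 0 := by
  obtain ⟨k, rfl⟩ := Nat.exists_eq_add_of_le' hm
  rw [Ne, Fin.ext_iff]
  simp [Fin.val_add, Nat.mod_eq_of_lt (show 2 < k + 3 by omega)]

theorem fin_cyclic_induction {P : Fin m → Prop} (i : Fin m) (hi : P i)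
    (hsucc : ∀ j, P j → P (j + 1)) (j : Fin m) : P j := by
  have hshift : ∀ k : ℕ, P (i + Fin.ofNat m k) := by
    intro k
    induction k with
    | zero => simpa using hi
    | succ k ih =>
      convert hsucc _ ih using 1
      rw [add_assoc]
      congr 1
      ext
      simp [Fin.val_add]
  simpa using hshift (j - i).val

theorem cycleGraph_adj_iff (hm : 2 ≤ m) {i j : Fin m} :
    (SimpleGraph.cycleGraph m).Adj i j ↔ j = i + 1 ∨ i = j + 1 := by
  obtain ⟨k, rfl⟩ := Nat.exists_eq_add_of_le' hm
  rw [SimpleGraph.cycleGraph_adj, sub_eq_iff_eq_add', sub_eq_iff_eq_add', or_comm,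
    add_comm j, add_comm i]

theorem cycleEdge_injective (hm : 3 ≤ m) :
    Function.Injective fun i : Fin m => s(i, i + 1) := by
  intro i j hij
  rcases Sym2.eq_iff.1 hij with ⟨h, -⟩ | ⟨h₁, h₂⟩
  · exact h
  · rw [h₁, add_assoc, add_eq_left] at h₂
    exact absurd h₂ (fin_one_add_one_ne_zero hm)

theorem cycleGraph_edgeFinset (hm : 3 ≤ m) [Fintype (SimpleGraph.cycleGraph m).edgeSet] :
    (SimpleGraph.cycleGraph m).edgeFinset = Finset.univ.map ⟨_, cycleEdge_injective hm⟩ := by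
  ext e
  induction e with | _ i j =>
  simp only [SimpleGraph.mem_edgeFinset, SimpleGraph.mem_edgeSet,
    cycleGraph_adj_iff (by lia : 2 ≤ m), Finset.mem_map, Finset.mem_univ, true_and,
    Function.Embedding.coeFn_mk, Sym2.eq_iff]
  constructor
  · rintro (rfl | rfl)
    · exact ⟨i, Or.inl ⟨rfl, rfl⟩⟩
    · exact ⟨j, Or.inr ⟨rfl, rfl⟩⟩
  · rintro ⟨l, ⟨rfl, rfl⟩ | ⟨rfl, rfl⟩⟩
    · exact Or.inl rfl
    · exact Or.inr rfl

theorem ncard_edgeSet_cycleGraph (hm : 3 ≤ m) :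
    (SimpleGraph.cycleGraph m).edgeSet.ncard = m := by
  classical
  rw [Set.ncard_eq_toFinset_card', ← SimpleGraph.edgeFinset, cycleGraph_edgeFinset hm,
    Finset.card_map, Finset.card_univ, Fintype.card_fin]

theorem eq_add_or_eq_sub_of_cycleGraph_iso (hm : 3 ≤ m)
    (σ : SimpleGraph.cycleGraph m ≃g SimpleGraph.cycleGraph m) :
    (∀ i, σ i = σ 0 + i) ∨ ∀ i, σ i = σ 0 - i := by
  have hstep : ∀ i, σ (i + 1) = σ i + 1 ∨ σ (i + 1) = σ i - 1 := by
    intro i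
    have hadj : (SimpleGraph.cycleGraph m).Adj (σ i) (σ (i + 1)) :=
      σ.map_adj_iff.2 ((cycleGraph_adj_iff (by lia)).2 (Or.inl rfl))
    exact ((cycleGraph_adj_iff (by lia)).1 hadj).imp_right fun h => eq_sub_of_add_eq h.symm
  have hne : ∀ i, σ (i + 1 + 1) ≠ σ i := by
    intro i hi
    have := σ.injective hi
    rw [add_assoc, add_eq_left] at this
    exact fin_one_add_one_ne_zero hm this
  refine (hstep 0).imp (fun h₀ i => ?_) fun h₀ i => ?_
  · refine (fin_cyclic_induction (P := fun i => σ i = σ 0 + i ∧ σ (i + 1) = σ i + 1) 0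
      ⟨(add_zero _).symm, h₀⟩ (fun j hj => ⟨by rw [hj.2, hj.1, add_assoc], ?_⟩) i).1
    exact (hstep (j + 1)).resolve_right fun h => hne j (by rw [h, hj.2, add_sub_cancel_right])
  · refine (fin_cyclic_induction (P := fun i => σ i = σ 0 - i ∧ σ (i + 1) = σ i - 1) 0
      ⟨(sub_zero _).symm, h₀⟩ (fun j hj => ⟨by rw [hj.2, hj.1, sub_sub], ?_⟩) i).1
    exact (hstep (j + 1)).resolve_left fun h => hne j (by rw [h, hj.2, sub_add_cancel])

/-- The rotation `i ↦ c + i` or the reflection `i ↦ c - i` of the cycle. -/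
def cycleIso (hm : 2 ≤ m) : Fin m × Bool → (SimpleGraph.cycleGraph m ≃g SimpleGraph.cycleGraph m)
  | (c, true) => ⟨Equiv.addLeft c, by
      simp [cycleGraph_adj_iff hm, add_assoc]⟩
  | (c, false) => ⟨Equiv.subLeft c, by
      intro i j
      simp only [cycleGraph_adj_iff hm, Equiv.subLeft_apply, sub_add, sub_right_inj]
      simp only [eq_sub_iff_add_eq, eq_comm, or_comm]⟩

theorem card_cycleGraph_iso (hm : 3 ≤ m) :
    Nat.card (SimpleGraph.cycleGraph m ≃g SimpleGraph.cycleGraph m) = 2 * m := by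
  have hm₂ : 2 ≤ m := by lia
  have hbij : Function.Bijective (cycleIso hm₂) := by
    constructor
    · rintro ⟨c, ε⟩ ⟨c', ε'⟩ h
      have h₀ : c = c' := by
        have := DFunLike.congr_fun h 0
        cases ε <;> cases ε' <;> simpa [cycleIso] using this
      subst h₀
      have h₁ := DFunLike.congr_fun h 1
      have hne : c - 1 ≠ c + 1 := fun h => fin_one_add_one_ne_zero hm <| by
        rwa [sub_eq_iff_eq_add, add_assoc, eq_comm, add_eq_left] at h
      cases ε <;> cases ε'
      · rfl
      · exact absurd h₁ hne
      · exact absurd h₁ hne.symm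
      · rfl
    · intro σ
      rcases eq_add_or_eq_sub_of_cycleGraph_iso hm σ with hσ | hσ
      · exact ⟨(σ 0, true), DFunLike.ext _ _ fun i => (hσ i).symm⟩
      · exact ⟨(σ 0, false), DFunLike.ext _ _ fun i => (hσ i).symm⟩
  rw [← Nat.card_congr (Equiv.ofBijective _ hbij), Nat.card_prod, Nat.card_fin,
    Nat.card_eq_fintype_card, Fintype.card_bool, mul_comm]

theorem two_mul_mul_copyCount_cycleGraph (hm : 3 ≤ m) {V : Type*} [Fintype V]
    (G : SimpleGraph V) :
    2 * m * G.copyCount (SimpleGraph.cycleGraph m) =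
      G.labelledCopyCount (SimpleGraph.cycleGraph m) := by
  rw [labelledCopyCount_eq_card_iso_mul_copyCount, card_cycleGraph_iso hm]

theorem ncard_edgeSet_map_cycleGraph (hm : 3 ≤ m) {V : Type*} (g : Fin m ↪ V) :
    ((SimpleGraph.cycleGraph m).map g).edgeSet.ncard = m := by
  rw [SimpleGraph.edgeSet_map, Set.ncard_image_of_injective _ g.sym2Map.injective,
    ncard_edgeSet_cycleGraph hm]

theorem map_cycleGraph_le_iff (hm : 2 ≤ m) {V : Type*} {g : Fin m ↪ V} {G : SimpleGraph V} :
    (SimpleGraph.cycleGraph m).map g ≤ G ↔ ∀ i, G.Adj (g i) (g (i + 1)) := by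
  rw [SimpleGraph.map_le_iff_le_comap]
  constructor
  · exact fun hG i => hG ((cycleGraph_adj_iff hm).2 (Or.inl rfl))
  · rintro hG i j hij
    rcases (cycleGraph_adj_iff hm).1 hij with rfl | rfl
    · exact hG i
    · exact (hG j).symm

/-- The shared edges, as a proper subset of the edges of a cycle, touch more vertices than there are
edges. -/
theorem ncard_edgeSet_inter_lt_overlap (hm : 3 ≤ m) {V : Type*} [Finite V] {g h : Fin m ↪ V}
    (hgh : (SimpleGraph.cycleGraph m).map g ≠ (SimpleGraph.cycleGraph m).map h)
    (ho : overlap g h ≠ 0) :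
    (((SimpleGraph.cycleGraph m).map g).edgeSet ∩
      ((SimpleGraph.cycleGraph m).map h).edgeSet).ncard < overlap g h := by
  classical
  set C := SimpleGraph.cycleGraph m
  have hm₂ : 2 ≤ m := by lia
  let J : Finset (Fin m) := Finset.univ.filter fun i => (C.map g).Adj (h i) (h (i + 1))
  have hJ_card : ((C.map g).edgeSet ∩ (C.map h).edgeSet).ncard ≤ J.card := by
    rw [← Set.ncard_coe_finset J]
    refine (Set.ncard_le_ncard (t := (fun i => s(h i, h (i + 1))) '' J) ?_).trans
      (Set.ncard_image_le J.finite_toSet)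
    rintro e ⟨hg, hh⟩
    rw [SimpleGraph.edgeSet_map] at hh
    obtain ⟨e, he, rfl⟩ := hh
    rw [← SimpleGraph.coe_edgeFinset, cycleGraph_edgeFinset hm] at he
    obtain ⟨i, -, rfl⟩ := Finset.mem_map.1 (Finset.mem_coe.1 he)
    exact ⟨i, Finset.mem_coe.2 (Finset.mem_filter.2 ⟨Finset.mem_univ i, hg⟩), rfl⟩
  have hJ_range : ∀ i ∈ J, h i ∈ Set.range g ∧ h (i + 1) ∈ Set.range g := by
    intro i hi
    obtain ⟨j, j', -, hj, hj'⟩ := (SimpleGraph.map_adj _ _ _ _).1 (Finset.mem_filter.1 hi).2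
    exact ⟨⟨j, hj⟩, ⟨j', hj'⟩⟩
  refine hJ_card.trans_lt ?_
  rcases J.eq_empty_or_nonempty with hJ | ⟨i₀, hi₀⟩
  · rw [hJ, Finset.card_empty]
    exact Nat.pos_of_ne_zero ho
  obtain ⟨i, hi, hi'⟩ : ∃ i ∈ J, i + 1 ∉ J := by
    by_contra! hclosed
    have hle : C.map h ≤ C.map g := (map_cycleGraph_le_iff hm₂).2 fun i =>
      (Finset.mem_filter.1 (fin_cyclic_induction (P := (· ∈ J)) i₀ hi₀ hclosed i)).2
    refine hgh (SimpleGraph.edgeSet_injective (Set.eq_of_subset_of_ncard_le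
      (SimpleGraph.edgeSet_mono hle) ?_)).symm
    rw [ncard_edgeSet_map_cycleGraph hm, ncard_edgeSet_map_cycleGraph hm]
  rw [Nat.lt_iff_add_one_le, ← Finset.card_insert_of_notMem hi']
  refine card_le_overlap fun j hj => ?_
  rcases Finset.mem_insert.1 hj with rfl | hj
  · exact (hJ_range i hi).2
  · exact (hJ_range j hj).1

theorem two_mul_lt_ncard_edgeSet_sup_add_overlap (hm : 3 ≤ m) {V : Type*} [Finite V]
    {g h : Fin m ↪ V}
    (hgh : (SimpleGraph.cycleGraph m).map g ≠ (SimpleGraph.cycleGraph m).map h)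
    (ho : overlap g h ≠ 0) :
    2 * m < ((SimpleGraph.cycleGraph m).map g ⊔ (SimpleGraph.cycleGraph m).map h).edgeSet.ncard +
      overlap g h := by
  have hunion := Set.ncard_union_add_ncard_inter ((SimpleGraph.cycleGraph m).map g).edgeSet
    ((SimpleGraph.cycleGraph m).map h).edgeSet
  rw [ncard_edgeSet_map_cycleGraph hm, ncard_edgeSet_map_cycleGraph hm,
    ← SimpleGraph.edgeSet_sup] at hunion
  have hinter := ncard_edgeSet_inter_lt_overlap hm hgh ho
  lia

theorem ncard_setOf_cycleGraph_le {n : ℕ} (hm : 3 ≤ m) (g : Fin m ↪ Fin n) :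
    {h : Fin m ↪ Fin n | overlap g h ≠ 0 ∧
      ((SimpleGraph.cycleGraph m).map g ⊔ (SimpleGraph.cycleGraph m).map h).edgeSet.ncard +
        overlap g h ≤ 2 * (SimpleGraph.cycleGraph m).edgeSet.ncard}.ncard ≤ 2 * m := by
  have hdeg : ∀ i, ∃ j, (SimpleGraph.cycleGraph m).Adj i j := fun i =>
    ⟨i + 1, (cycleGraph_adj_iff (by lia)).2 (Or.inl rfl)⟩
  refine le_trans (Set.ncard_le_ncard fun h ⟨ho, hle⟩ => ?_)
    ((ncard_setOf_map_eq_le hdeg g).trans_eq (card_cycleGraph_iso hm))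
  rw [ncard_edgeSet_cycleGraph hm] at hle
  by_contra hgh
  exact hle.not_gt (two_mul_lt_ncard_edgeSet_sup_add_overlap hm hgh ho)

end CycleGraph

section CycleDensity

variable {k : ℕ} {p : Fin k → ℝ}

theorem sum_prod_path_mul {κ R : Type*} [Fintype κ] [DecidableEq κ] [CommSemiring R]
    (M : Matrix κ κ R) (m : ℕ) (f : κ → κ → R) :
    ∑ y : Fin (m + 1) → κ, (∏ i : Fin m, M (y i.castSucc) (y i.succ)) * f (y 0) (y (Fin.last m)) =
      ∑ s, ∑ t, (M ^ m) s t * f s t := by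
  induction m generalizing f with
  | zero =>
    rw [← (Equiv.funUnique (Fin 1) κ).symm.sum_comp]
    simp [Matrix.one_apply]
  | succ m ih =>
    rw [← (Fin.consEquiv fun _ : Fin (m + 2) => κ).sum_comp, Fintype.sum_prod_type]
    have hcons : ∀ (s : κ) (y : Fin (m + 1) → κ),
        (∏ i : Fin (m + 1), M (Fin.cons (α := fun _ => κ) s y i.castSucc) (y i)) *
          f s (y (Fin.last m)) =
        (∏ i : Fin m, M (y i.castSucc) (y i.succ)) * (M s (y 0) * f s (y (Fin.last m))) := by
      intro s y
      rw [Fin.prod_univ_succ]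
      simp only [Fin.castSucc_zero, Fin.cons_zero, ← Fin.succ_castSucc, Fin.cons_succ]
      ring
    simp only [Fin.consEquiv_apply, Fin.cons_zero, Fin.cons_succ, ← Fin.succ_last, hcons]
    refine Finset.sum_congr rfl fun s _ => ?_
    rw [ih fun u t => M s u * f s t, Finset.sum_comm]
    simp only [pow_succ', Matrix.mul_apply, Finset.sum_mul]
    exact Finset.sum_congr rfl fun t _ => Finset.sum_congr rfl fun u _ => by ring

theorem sum_prod_cycle {κ R : Type*} [Fintype κ] [DecidableEq κ] [CommSemiring R]
    (M : Matrix κ κ R) (m : ℕ) [NeZero m] :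
    ∑ y : Fin m → κ, ∏ i, M (y i) (y (i + 1)) = (M ^ m).trace := by
  obtain ⟨m, rfl⟩ := Nat.exists_eq_succ_of_ne_zero (NeZero.ne m)
  simp only [Nat.succ_eq_add_one, Fin.prod_univ_castSucc, Fin.last_add_one]
  simpa [pow_succ, Matrix.trace, Matrix.mul_apply] using sum_prod_path_mul M m fun s t => M t s

theorem homDensity_cycleGraph {m : ℕ} [NeZero m] (hm : 3 ≤ m) (w : Sym2 (Fin k) → ℝ) :
    homDensity p w (SimpleGraph.cycleGraph m) =
      ((Matrix.diagonal p * symMatrix w) ^ m).trace := by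
  classical
  rw [homDensity_def, ← sum_prod_cycle]
  refine Finset.sum_congr rfl fun y _ => ?_
  rw [cycleGraph_edgeFinset hm, Finset.prod_map, ← Finset.prod_mul_distrib]
  simp [symMatrix, Matrix.diagonal_mul]

theorem homDensity_top_two (w : Sym2 (Fin k) → ℝ) :
    homDensity p w (⊤ : SimpleGraph (Fin 2)) = ∑ i, ∑ j, p i * p j * w s(i, j) := by
  classical
  rw [homDensity_def, ← (finTwoArrowEquiv (Fin k)).symm.sum_comp, Fintype.sum_prod_type]
  have hE : (⊤ : SimpleGraph (Fin 2)).edgeFinset = {s(0, 1)} := by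
    ext e
    induction e with | _ i j =>
    fin_cases i <;> fin_cases j <;> simp
  simp [hE, finTwoArrowEquiv, Fin.prod_univ_two]

/-- The edge probabilities of the symmetric stochastic block model: `A` inside and `B` across
communities. -/
def ssbmWeight (k : ℕ) (A B : ℝ) : Sym2 (Fin k) → ℝ := fun e => if e.IsDiag then A else B

theorem symMatrix_ssbmWeight (A B : ℝ) :
    symMatrix (ssbmWeight k A B) = Matrix.of fun i j => if i = j then A else B := by
  ext i j
  simp [symMatrix, ssbmWeight]

theorem trace_pow_ssbm [NeZero k] (A B : ℝ) (m : ℕ) :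
    ((Matrix.diagonal (fun _ => 1 / (k : ℝ)) * symMatrix (ssbmWeight k A B)) ^ m).trace =
      ((A + (k - 1) * B) / k) ^ m + (k - 1) * ((A - B) / k) ^ m := by
  have hk : (k : ℝ) ≠ 0 := Nat.cast_ne_zero.2 (NeZero.ne k)
  let P : Matrix (Fin k) (Fin k) ℝ := Matrix.of fun _ _ => 1 / (k : ℝ)
  have hP : P * P = P := by
    ext i j
    simp [P, Matrix.mul_apply, hk]
  have hspectral : Matrix.diagonal (fun _ => 1 / (k : ℝ)) * symMatrix (ssbmWeight k A B) =
      ((A + (k - 1) * B) / k) • P + ((A - B) / k) • (1 - P) := by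
    ext i j
    simp only [symMatrix_ssbmWeight, Matrix.diagonal_mul, Matrix.of_apply, Matrix.add_apply,
      Matrix.smul_apply, Matrix.sub_apply, Matrix.one_apply, smul_eq_mul, P]
    split_ifs <;> field
  have hpow : ∀ x y : ℝ, (x • P + y • (1 - P)) ^ m = x ^ m • P + y ^ m • (1 - P) := by
    intro x y
    induction m with
    | zero => simp
    | succ m ih =>
      rw [pow_succ, ih]
      simp only [mul_add, add_mul, smul_mul_smul_comm, mul_sub, sub_mul, mul_one, one_mul, hP,
        sub_self, smul_zero, add_zero, zero_add, sub_zero, ← pow_succ]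
  have htrace : P.trace = 1 := by simp [P, Matrix.trace, hk]
  rw [hspectral, hpow, Matrix.trace_add, Matrix.trace_smul, Matrix.trace_smul, Matrix.trace_sub,
    htrace, Matrix.trace_one, Fintype.card_fin]
  simp only [smul_eq_mul, mul_one]
  ring

end CycleDensity

section SparseMoments

variable {n k : ℕ} {p : Fin k → ℝ} {w : Sym2 (Fin k) → ℝ} {a : ℝ}

theorem sbmExp_labelledCopyCount_cycleGraph_sub_sq_le (hp₀ : ∀ i, 0 ≤ p i) (hp : ∑ i, p i = 1)
    (hw₀ : ∀ e, 0 ≤ w e) (hw₁ : ∀ e, w e ≤ 1) (ha : 1 ≤ a) (hwa : ∀ e, w e ≤ a / n)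
    (hn : n ≠ 0) {m : ℕ} [NeZero m] (hm : 3 ≤ m) :
    sbmExp p (symMatrix w) (fun G : SimpleGraph (Fin n) =>
        ((G.labelledCopyCount (SimpleGraph.cycleGraph m) : ℝ) -
          n.descFactorial m * homDensity p w (SimpleGraph.cycleGraph m)) ^ 2) ≤
      2 * m * ((n : ℝ) ^ m * homDensity p w (SimpleGraph.cycleGraph m)) +
        a ^ (2 * m) * (m + 1) ^ m / n := by
  have h := sbmExp_labelledCopyCount_sub_sq_le hp₀ hp hw₀ hw₁ ha hwa (SimpleGraph.cycleGraph m)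
    (L := 2 * m) (ncard_setOf_cycleGraph_le hm)
  rw [ncard_edgeSet_cycleGraph hm] at h
  simp only [Fintype.card_fin] at h
  refine h.trans_eq ?_
  push_cast
  field

theorem labelledCopyCount_eq_natCard {ι V : Type*} [Fintype ι] [Fintype V] (G : SimpleGraph V)
    (H : SimpleGraph ι) : G.labelledCopyCount H = Nat.card (H.Copy G) := by
  classical
  rw [SimpleGraph.labelledCopyCount, Nat.card_eq_fintype_card]

theorem labelledCopyCount_top_two {V : Type*} [Fintype V] (G : SimpleGraph V) :
    G.labelledCopyCount (⊤ : SimpleGraph (Fin 2)) = 2 * G.edgeSet.ncard := by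
  classical
  let e : (⊤ : SimpleGraph (Fin 2)).Copy G ≃ G.Dart :=
    { toFun := fun f => ⟨(f 0, f 1), f.toHom.map_adj (by simp)⟩
      invFun := fun d => ⟨⟨![d.fst, d.snd], fun {i j} hij => by
        fin_cases i <;> fin_cases j <;> simp_all [d.adj, d.adj.symm]⟩, fun i j hij => by
        fin_cases i <;> fin_cases j <;> simp_all [d.adj.ne, d.adj.ne']⟩
      left_inv := fun f => DFunLike.ext _ _ (Fin.forall_fin_two.2 ⟨rfl, rfl⟩)
      right_inv := fun _ => rfl }
  rw [labelledCopyCount_eq_natCard, Nat.card_congr e, Nat.card_eq_fintype_card,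
    SimpleGraph.dart_card_eq_twice_card_edges, Set.ncard_eq_toFinset_card',
    ← SimpleGraph.edgeFinset]

theorem ncard_edgeSet_top_two : (⊤ : SimpleGraph (Fin 2)).edgeSet.ncard = 1 := by
  have htop : (⊤ : SimpleGraph (Fin 2)) = SimpleGraph.edge 0 1 := by
    ext i j
    fin_cases i <;> fin_cases j <;> simp [SimpleGraph.edge_adj]
  rw [htop, SimpleGraph.edgeSet_edge_of_ne (by decide), Set.ncard_singleton]

theorem map_top_two {V : Type*} (g : Fin 2 ↪ V) :
    (⊤ : SimpleGraph (Fin 2)).map g = SimpleGraph.edge (g 0) (g 1) := by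
  ext u v
  simp [SimpleGraph.edge_adj, Fin.exists_fin_two]
  grind

theorem two_lt_ncard_edgeSet_sup_add_overlap {V : Type*} (g h : Fin 2 ↪ V)
    (hgh : overlap g h ≠ 0) :
    2 < ((⊤ : SimpleGraph (Fin 2)).map g ⊔ (⊤ : SimpleGraph (Fin 2)).map h).edgeSet.ncard +
      overlap g h := by
  have hg : g 0 ≠ g 1 := g.injective.ne (by decide)
  have hh : h 0 ≠ h 1 := h.injective.ne (by decide)
  rw [map_top_two, map_top_two, SimpleGraph.edgeSet_sup, SimpleGraph.edgeSet_edge_of_ne hg,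
    SimpleGraph.edgeSet_edge_of_ne hh]
  by_cases heq : s(g 0, g 1) = s(h 0, h 1)
  · have hoverlap : (Finset.univ : Finset (Fin 2)).card ≤ overlap g h := by
      refine card_le_overlap fun i _ => ?_
      have hi : h i ∈ s(g 0, g 1) := by
        rw [heq]
        fin_cases i <;> simp
      rcases Sym2.mem_iff.1 hi with hi | hi <;> exact ⟨_, hi.symm⟩
    simp only [Finset.card_univ, Fintype.card_fin] at hoverlap
    rw [heq, Set.union_self, Set.ncard_singleton]
    lia
  · rw [Set.singleton_union, Set.ncard_pair heq]
    lia

theorem sbmExp_ncard_edgeSet_sub_sq_le (hp₀ : ∀ i, 0 ≤ p i) (hp : ∑ i, p i = 1)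
    (hw₀ : ∀ e, 0 ≤ w e) (hw₁ : ∀ e, w e ≤ 1) (ha : 1 ≤ a) (hwa : ∀ e, w e ≤ a / n)
    (hn : n ≠ 0) :
    sbmExp p (symMatrix w) (fun G : SimpleGraph (Fin n) => (2 * (G.edgeSet.ncard : ℝ) -
        n * (n - 1) * homDensity p w (⊤ : SimpleGraph (Fin 2))) ^ 2) ≤ 9 * a ^ 2 * n := by
  have h := sbmExp_labelledCopyCount_sub_sq_le hp₀ hp hw₀ hw₁ ha hwa
    (⊤ : SimpleGraph (Fin 2)) (L := 0) fun g => by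
      rw [Nat.le_zero, Set.ncard_eq_zero, Set.eq_empty_iff_forall_notMem]
      rintro h ⟨hoverlap, hle⟩
      rw [ncard_edgeSet_top_two] at hle
      exact hle.not_gt (two_lt_ncard_edgeSet_sup_add_overlap g h hoverlap)
  have hdesc : ((n.descFactorial 2 : ℕ) : ℝ) = n * (n - 1) := Nat.cast_descFactorial_two ℝ n
  rw [ncard_edgeSet_top_two] at h
  simp only [labelledCopyCount_top_two, Fintype.card_fin, hdesc] at h
  push_cast at h
  refine h.trans_eq ?_
  field

theorem sbmExp_dHat_sub_sq_le (hp₀ : ∀ i, 0 ≤ p i) (hp : ∑ i, p i = 1)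
    (hw₀ : ∀ e, 0 ≤ w e) (hw₁ : ∀ e, w e ≤ 1) (ha : 1 ≤ a) (hwa : ∀ e, w e ≤ a / n)
    (hn : n ≠ 0) :
    sbmExp p (symMatrix w) (fun G : SimpleGraph (Fin n) =>
      (dHat G - n * homDensity p w (⊤ : SimpleGraph (Fin 2))) ^ 2) ≤ 20 * a ^ 2 / n := by
  set q := homDensity p w (⊤ : SimpleGraph (Fin 2))
  have hn₁ : (1 : ℝ) ≤ n := by exact_mod_cast Nat.one_le_iff_ne_zero.2 hn
  have hq₀ : 0 ≤ n * q := mul_nonneg (by positivity) (homDensity_nonneg hp₀ hw₀ _)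
  have hqa : n * q ≤ a := by
    have hle : q ≤ (a / n) ^ 1 := by
      simpa only [ncard_edgeSet_top_two] using
        homDensity_le_pow hp₀ hp hw₀ hwa (⊤ : SimpleGraph (Fin 2))
    rwa [pow_one, le_div_iff₀' (by positivity)] at hle
  let X : SimpleGraph (Fin n) → ℝ := fun G => 2 * (G.edgeSet.ncard : ℝ) - n * (n - 1) * q
  have hpointwise : (fun G : SimpleGraph (Fin n) => (dHat G - n * q) ^ 2) ≤
      (2 / n ^ 2 : ℝ) • (fun G => X G ^ 2) + (2 * a ^ 2 / n ^ 2 : ℝ) • 1 := by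
    intro G
    have hX : dHat G - n * q = (X G - n * q) / n := by
      simp only [dHat, X]
      field
    have hsq : (n * q) ^ 2 ≤ a ^ 2 := by gcongr
    simp only [hX, Pi.add_apply, Pi.smul_apply, Pi.one_apply, smul_eq_mul, div_pow,
      div_mul_eq_mul_div, mul_one, ← add_div]
    gcongr
    nlinarith [sq_nonneg (X G + n * q)]
  calc _ ≤ 2 / (n : ℝ) ^ 2 * sbmExp p (symMatrix w) (fun G => X G ^ 2) +
        2 * a ^ 2 / n ^ 2 * 1 := by
        refine (sbmExp_mono (W := symMatrix w) hp₀ (fun _ _ => hw₀ _) (fun _ _ => hw₁ _)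
          hpointwise).trans_eq ?_
        rw [map_add, map_smul, map_smul, sbmExp_one hp, smul_eq_mul, smul_eq_mul]
    _ ≤ 2 / (n : ℝ) ^ 2 * (9 * a ^ 2 * n) + 2 * a ^ 2 / n ^ 2 * n := by
        gcongr
        exact sbmExp_ncard_edgeSet_sub_sq_le hp₀ hp hw₀ hw₁ ha hwa hn
    _ = 20 * a ^ 2 / n := by field

end SparseMoments

/-! ### Events of probability tending to one -/

section SymmetricModel

variable {n k : ℕ} {A B C : ℝ}

/-- The expectation of a function of the graph under `SSBM(n, k, A, B)`. -/
noncomputable def ssbmExp (n k : ℕ) (A B : ℝ) : (SimpleGraph (Fin n) → ℝ) →ₗ[ℝ] ℝ :=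
  sbmExp (fun _ => 1 / (k : ℝ)) (symMatrix (ssbmWeight k A B))

theorem ssbmWeight_nonneg (hA : 0 ≤ A) (hB : 0 ≤ B) (e : Sym2 (Fin k)) :
    0 ≤ ssbmWeight k A B e := by
  unfold ssbmWeight
  split_ifs <;> assumption

theorem ssbmWeight_le (hA : A ≤ C) (hB : B ≤ C) (e : Sym2 (Fin k)) : ssbmWeight k A B e ≤ C := by
  unfold ssbmWeight
  split_ifs <;> assumption

theorem ssbmProb_snd_eq_ssbmExp (S : Set (SimpleGraph (Fin n))) :
    ssbmProb n k A B {z | z.2 ∈ S} = ssbmExp n k A B (S.indicator 1) := by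
  rw [ssbmProb, sbmProb_snd_eq_sbmExp, ssbmExp, symMatrix_ssbmWeight]

theorem ssbmExp_mono (hA₀ : 0 ≤ A) (hA₁ : A ≤ 1) (hB₀ : 0 ≤ B) (hB₁ : B ≤ 1) :
    Monotone (ssbmExp n k A B) :=
  sbmExp_mono (fun _ => by positivity) (fun _ _ => ssbmWeight_nonneg hA₀ hB₀ _)
    fun _ _ => ssbmWeight_le hA₁ hB₁ _

theorem sum_uniform_eq_one (k : ℕ) [NeZero k] : ∑ _i : Fin k, 1 / (k : ℝ) = 1 := by
  simp [NeZero.ne k]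

theorem ssbmExp_one [NeZero k] : ssbmExp n k A B 1 = 1 :=
  sbmExp_one (sum_uniform_eq_one k) _

end SymmetricModel

section WHP

variable {a b : ℝ}

/-- The graph property `Q` holds with probability tending to one under `SSBM(n, 2, a/n, b/n)`. -/
def WHP (a b : ℝ) (Q : ∀ n : ℕ, SimpleGraph (Fin n) → Prop) : Prop :=
  Tendsto (fun n : ℕ => ssbmProb n 2 (a / n) (b / n) {z | ¬ Q n z.2}) atTop (𝓝 0)

theorem whp_iff_tendsto_ssbmExp {Q : ∀ n : ℕ, SimpleGraph (Fin n) → Prop} :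
    WHP a b Q ↔ Tendsto (fun n : ℕ =>
      ssbmExp n 2 (a / n) (b / n) ({G | ¬ Q n G}.indicator 1)) atTop (𝓝 0) := by
  simp only [← ssbmProb_snd_eq_ssbmExp, WHP, Set.mem_ofPred_eq]

theorem eventually_monotone_ssbmExp (k : ℕ) (ha : 0 ≤ a) (hb : 0 ≤ b) :
    ∀ᶠ n : ℕ in atTop, Monotone (ssbmExp n k (a / n) (b / n)) := by
  filter_upwards [eventually_ge_atTop ⌈a⌉₊, eventually_ge_atTop ⌈b⌉₊] with n hna hnb
  exact ssbmExp_mono (by positivity) (div_le_one_of_le₀ (Nat.ceil_le.1 hna) (by positivity))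
    (by positivity) (div_le_one_of_le₀ (Nat.ceil_le.1 hnb) (by positivity))

theorem whp_of_tendsto_ssbmExp (ha : 0 ≤ a) (hb : 0 ≤ b)
    {Q : ∀ n : ℕ, SimpleGraph (Fin n) → Prop} {F : ∀ n : ℕ, SimpleGraph (Fin n) → ℝ}
    (hF₀ : ∀ n, 0 ≤ F n) (hF : ∀ᶠ n : ℕ in atTop, ∀ G, ¬ Q n G → 1 ≤ F n G)
    (hlim : Tendsto (fun n : ℕ => ssbmExp n 2 (a / n) (b / n) (F n)) atTop (𝓝 0)) :
    WHP a b Q := by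
  rw [whp_iff_tendsto_ssbmExp]
  refine squeeze_zero' ?_ ?_ hlim
  · filter_upwards [eventually_monotone_ssbmExp 2 ha hb] with n hmono
    rw [← map_zero (ssbmExp n 2 (a / n) (b / n))]
    exact hmono (Set.indicator_nonneg fun _ _ => zero_le_one)
  · filter_upwards [eventually_monotone_ssbmExp 2 ha hb, hF] with n hmono hFn
    exact hmono (Set.indicator_le' hFn fun G _ => hF₀ n G)

theorem WHP.mono (ha : 0 ≤ a) (hb : 0 ≤ b) {Q Q' : ∀ n : ℕ, SimpleGraph (Fin n) → Prop}
    (h : WHP a b Q) (himp : ∀ᶠ n : ℕ in atTop, ∀ G, Q n G → Q' n G) : WHP a b Q' := by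
  refine whp_of_tendsto_ssbmExp ha hb (fun n => Set.indicator_nonneg fun _ _ => zero_le_one) ?_
    (whp_iff_tendsto_ssbmExp.1 h)
  filter_upwards [himp] with n himp G hG
  have hQ : G ∈ {G | ¬ Q n G} := fun hQ => hG (himp G hQ)
  rw [Set.indicator_of_mem hQ]

theorem WHP.and (ha : 0 ≤ a) (hb : 0 ≤ b) {Q Q' : ∀ n : ℕ, SimpleGraph (Fin n) → Prop}
    (h : WHP a b Q) (h' : WHP a b Q') : WHP a b fun n G => Q n G ∧ Q' n G := by
  have hind : ∀ {n : ℕ} (S : Set (SimpleGraph (Fin n))),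
      0 ≤ S.indicator (1 : SimpleGraph (Fin n) → ℝ) :=
    fun S => Set.indicator_nonneg fun _ _ => zero_le_one
  refine whp_of_tendsto_ssbmExp ha hb
    (F := fun n => {G | ¬ Q n G}.indicator 1 + {G | ¬ Q' n G}.indicator 1)
    (fun n => add_nonneg (hind _) (hind _)) (Eventually.of_forall fun n G hG => ?_) ?_
  · by_cases hQ : Q n G
    · have hQ' : G ∈ {G | ¬ Q' n G} := fun hQ' => hG ⟨hQ, hQ'⟩
      rw [Pi.add_apply, Set.indicator_of_mem hQ', Pi.one_apply]
      exact le_add_of_nonneg_left (hind _ G)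
    · have hQ : G ∈ {G | ¬ Q n G} := hQ
      rw [Pi.add_apply, Set.indicator_of_mem hQ, Pi.one_apply]
      exact le_add_of_nonneg_right (hind _ G)
  · simpa only [map_add, add_zero] using
      (whp_iff_tendsto_ssbmExp.1 h).add (whp_iff_tendsto_ssbmExp.1 h')

theorem WHP.tendsto_one {Q : ∀ n : ℕ, SimpleGraph (Fin n) → Prop} (h : WHP a b Q) :
    Tendsto (fun n : ℕ => ssbmProb n 2 (a / n) (b / n) {z | Q n z.2}) atTop (𝓝 1) := by
  have hcompl : ∀ n : ℕ, ssbmProb n 2 (a / n) (b / n) {z | Q n z.2} =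
      1 - ssbmExp n 2 (a / n) (b / n) ({G | ¬ Q n G}.indicator 1) := by
    intro n
    have hadd := congrArg (ssbmExp n 2 (a / n) (b / n)) (Set.indicator_self_add_compl {G | Q n G} 1)
    rw [map_add, ← ssbmProb_snd_eq_ssbmExp, ssbmExp_one] at hadd
    exact eq_sub_of_add_eq hadd
  simp only [hcompl]
  simpa using (whp_iff_tendsto_ssbmExp.1 h).const_sub 1

theorem whp_abs_sub_lt (ha : 0 ≤ a) (hb : 0 ≤ b) {X : ∀ n : ℕ, SimpleGraph (Fin n) → ℝ}
    {c t V : ℕ → ℝ} (ht : ∀ n, 0 < t n)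
    (hvar : ∀ᶠ n : ℕ in atTop,
      ssbmExp n 2 (a / n) (b / n) (fun G => (X n G - c n) ^ 2) ≤ V n)
    (hlim : Tendsto (fun n => V n / t n ^ 2) atTop (𝓝 0)) :
    WHP a b fun n G => |X n G - c n| < t n := by
  refine whp_of_tendsto_ssbmExp ha hb (F := fun n => (t n ^ 2)⁻¹ • fun G => (X n G - c n) ^ 2)
    (fun n G => ?_) (Eventually.of_forall fun n G hG => ?_) (squeeze_zero' ?_ ?_ hlim)
  · exact mul_nonneg (inv_nonneg.2 (sq_nonneg _)) (sq_nonneg _)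
  · rw [Pi.smul_apply, smul_eq_mul, inv_mul_eq_div, one_le_div (pow_pos (ht n) 2), ← sq_abs (_ - _)]
    exact pow_le_pow_left₀ (ht n).le (not_lt.1 hG) 2
  · filter_upwards [eventually_monotone_ssbmExp 2 ha hb] with n hmono
    rw [← map_zero (ssbmExp n 2 (a / n) (b / n))]
    exact hmono fun G => mul_nonneg (inv_nonneg.2 (sq_nonneg _)) (sq_nonneg _)
  · filter_upwards [hvar] with n hn
    rw [map_smul, smul_eq_mul, inv_mul_eq_div]
    exact div_le_div_of_nonneg_right hn (sq_nonneg _)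

end WHP

/-! ### The cycle length -/

theorem tendsto_cycleLength : Tendsto cycleLength atTop atTop := by
  unfold cycleLength
  refine tendsto_nat_floor_atTop.comp ?_
  exact (tendsto_rpow_atTop (by norm_num)).comp (Real.tendsto_log_atTop.comp
    tendsto_natCast_atTop_atTop)

theorem le_cycleLength_iff {n : ℕ} (hn : 1 ≤ n) (k : ℕ) :
    k ≤ cycleLength n ↔ Real.exp ((k : ℝ) ^ 4) ≤ n := by
  have hn' : (1 : ℝ) ≤ n := by exact_mod_cast hn
  have hlog : 0 ≤ Real.log n := Real.log_nonneg hn'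
  rw [cycleLength, Nat.le_floor_iff (by positivity), ← Real.le_log_iff_exp_le (by linarith)]
  have h1 : Real.log n = (Real.log n ^ (1 / 4 : ℝ)) ^ 4 := by
    rw [← Real.rpow_natCast, ← Real.rpow_mul hlog]
    norm_num
  have h0 : 0 ≤ Real.log n ^ (1 / 4 : ℝ) := by positivity
  conv_rhs => rw [h1]
  rw [pow_le_pow_iff_left₀ (by positivity) h0 (by norm_num)]

theorem exp_cycleLength_le {n : ℕ} (hn : 1 ≤ n) :
    Real.exp ((cycleLength n : ℝ) ^ 4) ≤ n := (le_cycleLength_iff hn _).1 le_rfl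

theorem eventually_mul_pow_le_exp (K : ℝ) (c : ℕ) :
    ∀ᶠ m : ℕ in atTop, K * ((m : ℝ) + 1) ^ c ≤ Real.exp m := by
  have h2 : Tendsto (fun x : ℝ => K * (x ^ c * Real.exp (-x))) atTop (𝓝 (K * 0)) :=
    (Real.tendsto_pow_mul_exp_neg_atTop_nhds_zero c).const_mul K
  rw [mul_zero] at h2
  have h3 : Tendsto (fun m : ℕ => (m : ℝ) + 1) atTop atTop :=
    tendsto_atTop_add_const_right _ _ tendsto_natCast_atTop_atTop
  have h4 := (h2.comp h3).eventually (gt_mem_nhds (Real.exp_pos (-1)))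
  filter_upwards [h4] with m hm
  simp only [Function.comp] at hm
  have h5 : K * ((m : ℝ) + 1) ^ c =
      K * (((m : ℝ) + 1) ^ c * Real.exp (-((m : ℝ) + 1))) * Real.exp ((m : ℝ) + 1) := by
    rw [mul_assoc, mul_assoc, ← Real.exp_add]
    simp
  rw [h5]
  calc _ ≤ Real.exp (-1) * Real.exp ((m : ℝ) + 1) := by gcongr
    _ = Real.exp m := by rw [← Real.exp_add]; ring_nf

theorem tendsto_pow_cycleLength_div (K : ℝ) (hK : 0 ≤ K) (c : ℕ) :
    Tendsto (fun n : ℕ => (K * (cycleLength n + 1) ^ c) ^ cycleLength n / n) atTop (𝓝 0) := by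
  have h1 := eventually_mul_pow_le_exp K c
  have h2 : Tendsto (fun n : ℕ => Real.exp (-(cycleLength n : ℝ))) atTop (𝓝 0) :=
    Real.tendsto_exp_neg_atTop_nhds_zero.comp
      (tendsto_natCast_atTop_atTop.comp tendsto_cycleLength)
  refine squeeze_zero' (Eventually.of_forall fun n => by positivity) ?_ h2
  filter_upwards [tendsto_cycleLength.eventually h1, eventually_ge_atTop 1,
    tendsto_cycleLength.eventually (eventually_ge_atTop 2)] with n hn hn1 hm
  set m := cycleLength n
  have hexp := exp_cycleLength_le hn1
  have hm2 : (2 : ℝ) ≤ m := by exact_mod_cast hm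
  calc (K * ((m : ℝ) + 1) ^ c) ^ m / n ≤ Real.exp m ^ m / Real.exp ((m : ℝ) ^ 4) := by
        gcongr
    _ = Real.exp ((m : ℝ) * m - (m : ℝ) ^ 4) := by rw [← Real.exp_nat_mul, ← Real.exp_sub]
    _ ≤ Real.exp (-(m : ℝ)) := by
        apply Real.exp_le_exp.2
        nlinarith [mul_nonneg (sq_nonneg (m : ℝ)) (show (0 : ℝ) ≤ (m : ℝ) ^ 2 - 4 by nlinarith)]

/-! ### Consistency -/

section Consistency

variable {a b : ℝ} {n m : ℕ}

theorem ssbmExp_dHat_sub_sq_le (hb : 0 ≤ b) (hba : b ≤ a) (ha : 1 ≤ a) (han : a ≤ n) :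
    ssbmExp n 2 (a / n) (b / n) (fun G => (dHat G - (a + b) / 2) ^ 2) ≤ 20 * a ^ 2 / n := by
  have hn : (n : ℝ) ≠ 0 := (zero_lt_one.trans_le (ha.trans han)).ne'
  have hba' : b / n ≤ a / n := by gcongr
  have hmean : n * homDensity (fun _ => 1 / ((2 : ℕ) : ℝ)) (ssbmWeight 2 (a / n) (b / n))
      (⊤ : SimpleGraph (Fin 2)) = (a + b) / 2 := by
    simp only [homDensity_top_two, Fin.sum_univ_two, ssbmWeight, Sym2.mk_isDiag_iff]
    norm_num
    field
  rw [← hmean]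
  exact sbmExp_dHat_sub_sq_le (fun _ => by positivity) (sum_uniform_eq_one 2)
    (ssbmWeight_nonneg (by positivity) (by positivity))
    (fun e => (ssbmWeight_le le_rfl hba' e).trans (div_le_one_of_le₀ han (by positivity)))
    ha (ssbmWeight_le le_rfl hba') (by exact_mod_cast hn)

theorem ssbmExp_cycleCount_sub_sq_le (hb : 0 ≤ b) (hba : b ≤ a) (ha : 1 ≤ a) (han : a ≤ n)
    (hm : 3 ≤ m) :
    ssbmExp n 2 (a / n) (b / n) (fun G => (2 * (m : ℝ) * (cycleCount G m : ℝ) -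
        n.descFactorial m / (n : ℝ) ^ m * (((a + b) / 2) ^ m + ((a - b) / 2) ^ m)) ^ 2) ≤
      2 * m * (((a + b) / 2) ^ m + ((a - b) / 2) ^ m) + a ^ (2 * m) * (m + 1) ^ m / n := by
  have : NeZero m := ⟨by omega⟩
  have hn : (n : ℝ) ≠ 0 := (zero_lt_one.trans_le (ha.trans han)).ne'
  have hba' : b / n ≤ a / n := by gcongr
  have hmean : (n : ℝ) ^ m * homDensity (fun _ => 1 / ((2 : ℕ) : ℝ))
      (ssbmWeight 2 (a / n) (b / n)) (SimpleGraph.cycleGraph m) =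
      ((a + b) / 2) ^ m + ((a - b) / 2) ^ m := by
    rw [homDensity_cycleGraph hm, trace_pow_ssbm, mul_add, mul_left_comm, ← mul_pow, ← mul_pow]
    norm_num
    congr 2 <;> field
  have hcount (G : SimpleGraph (Fin n)) : 2 * (m : ℝ) * (cycleCount G m : ℝ) =
      G.labelledCopyCount (SimpleGraph.cycleGraph m) := by
    exact_mod_cast two_mul_mul_copyCount_cycleGraph hm G
  have h := sbmExp_labelledCopyCount_cycleGraph_sub_sq_le (fun _ => by positivity)
    (sum_uniform_eq_one 2) (ssbmWeight_nonneg (by positivity) (by positivity))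
    (fun e => (ssbmWeight_le le_rfl hba' e).trans (div_le_one_of_le₀ han (by positivity)))
    ha (ssbmWeight_le le_rfl hba') (by exact_mod_cast hn) hm
  rw [← hmean, ← mul_assoc, div_mul_cancel₀ _ (pow_ne_zero m hn)]
  simp only [hcount]
  exact h

theorem params_bounds (hb : 0 ≤ b) (hba : b ≤ a) (hab : (a - b) ^ 2 > 2 * (a + b)) :
    1 < (a - b) / 2 ∧ (a + b) / 2 < ((a - b) / 2) ^ 2 := by
  have hf : 1 < (a - b) / 2 := by
    by_contra! h
    nlinarith
  exact ⟨hf, by nlinarith⟩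

/-- A precision to which the average degree determines its `m`-th power up to `1 / 8`. -/
noncomputable def degreeTolerance (d : ℝ) (m : ℕ) : ℝ := 1 / (8 * (m + 1) * (2 * d) ^ m)

theorem degreeTolerance_pos {d : ℝ} (hd : 0 < d) (m : ℕ) : 0 < degreeTolerance d m := by
  unfold degreeTolerance
  positivity

theorem degreeTolerance_le {d : ℝ} (hd : 1 ≤ d) (m : ℕ) : degreeTolerance d m ≤ 1 / (m + 1) := by
  unfold degreeTolerance
  have hpow : 1 ≤ (2 * d) ^ m := one_le_pow₀ (by linarith)
  exact one_div_le_one_div_of_le (by positivity) (by nlinarith)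

theorem abs_pow_sub_pow_le_of_degreeTolerance {x d : ℝ} (hd : 1 ≤ d)
    (hx : |x - d| ≤ degreeTolerance d m) : |x ^ m - d ^ m| ≤ 1 / 8 := by
  have htol : degreeTolerance d m ≤ 1 :=
    (degreeTolerance_le hd m).trans (div_le_one_of_le₀ (by linarith [m.cast_nonneg (α := ℝ)])
      (by positivity))
  have hmax : max |x| |d| ≤ 2 * d := by
    have habs := abs_sub_abs_le_abs_sub x d
    rw [abs_of_pos (by linarith : (0 : ℝ) < d)] at habs ⊢
    exact max_le (by linarith) (by linarith)
  have hpos := degreeTolerance_pos (zero_lt_one.trans_le hd) m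
  calc |x ^ m - d ^ m| ≤ |x - d| * m * max |x| |d| ^ (m - 1) := abs_pow_sub_pow_le x d m
    _ ≤ degreeTolerance d m * m * (2 * d) ^ (m - 1) := by gcongr
    _ ≤ degreeTolerance d m * (m + 1) * (2 * d) ^ m := by
        gcongr
        · linarith
        · linarith
        · omega
    _ = 1 / 8 := by
        unfold degreeTolerance
        field_simp

theorem abs_descFactorial_div_mul_sub_le {x : ℝ} (hx : 0 ≤ x) (hmn : m ≤ n) (hn : 0 < n) :
    |n.descFactorial m / (n : ℝ) ^ m * x - x| ≤ m * m / n * x := by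
  have hle : (n.descFactorial m : ℝ) / (n : ℝ) ^ m ≤ 1 :=
    div_le_one_of_le₀ (by exact_mod_cast Nat.descFactorial_le_pow n m) (by positivity)
  have hmn₁ : (m : ℝ) / n ≤ 1 := div_le_one_of_le₀ (by exact_mod_cast hmn) (by positivity)
  have hge : 1 - (m : ℝ) * m / n ≤ n.descFactorial m / (n : ℝ) ^ m :=
    calc 1 - (m : ℝ) * m / n = 1 + m * (-(m / n)) := by ring
      _ ≤ (1 + -((m : ℝ) / n)) ^ m :=
          one_add_mul_le_pow (by linarith) m
      _ = ((n - m : ℕ) : ℝ) ^ m / n ^ m := by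
          rw [← div_pow, Nat.cast_sub hmn]
          congr 1
          field_simp
          ring
      _ ≤ n.descFactorial m / (n : ℝ) ^ m := by
          gcongr
          exact_mod_cast (Nat.pow_le_pow_left (by omega) m).trans
            (Nat.pow_sub_le_descFactorial n m)
  rw [← sub_one_mul, abs_mul, abs_of_nonneg hx, abs_of_nonpos (by linarith)]
  gcongr
  linarith

theorem whp_abs_dHat_sub_lt_degreeTolerance (hb : 0 ≤ b) (hba : b ≤ a) (ha : 1 ≤ a) :
    WHP a b fun n G => |dHat G - (a + b) / 2| < degreeTolerance ((a + b) / 2) (cycleLength n) := by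
  set d := (a + b) / 2
  have hd : 0 < d := by positivity
  refine whp_abs_sub_lt (by positivity) hb (fun n => degreeTolerance_pos hd _)
    (V := fun n => 20 * a ^ 2 / n) ?_ ?_
  · filter_upwards [eventually_ge_atTop ⌈a⌉₊] with n hn
    exact ssbmExp_dHat_sub_sq_le hb hba ha (Nat.ceil_le.1 hn)
  have hlim := (tendsto_pow_cycleLength_div ((2 * d) ^ 2) (by positivity) 2).const_mul
    (20 * a ^ 2 * 64)
  rw [mul_zero] at hlim
  refine squeeze_zero' (Eventually.of_forall fun n => by positivity) ?_ hlim
  filter_upwards [tendsto_cycleLength.eventually (eventually_ge_atTop 1)] with n hm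
  set m := cycleLength n
  calc 20 * a ^ 2 / n / degreeTolerance d m ^ 2
    _ = 20 * a ^ 2 * 64 * (((2 * d) ^ 2) ^ m * ((m : ℝ) + 1) ^ 2 / n) := by
        unfold degreeTolerance
        rw [← pow_mul, mul_comm 2 m, pow_mul]
        field
    _ ≤ 20 * a ^ 2 * 64 * (((2 * d) ^ 2 * ((m : ℝ) + 1) ^ 2) ^ m / n) := by
        rw [mul_pow ((2 * d) ^ 2), ← pow_mul ((m : ℝ) + 1)]
        gcongr
        · linarith [m.cast_nonneg (α := ℝ)]
        · omega

theorem whp_abs_cycleCount_sub_lt (hb : 0 ≤ b) (hba : b ≤ a) (hab : (a - b) ^ 2 > 2 * (a + b)) :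
    WHP a b fun n G => |2 * (cycleLength n : ℝ) * (cycleCount G (cycleLength n) : ℝ) -
      n.descFactorial (cycleLength n) / (n : ℝ) ^ cycleLength n *
        (((a + b) / 2) ^ cycleLength n + ((a - b) / 2) ^ cycleLength n)| <
        ((a - b) / 2) ^ cycleLength n / 8 := by
  obtain ⟨hf, hdf⟩ := params_bounds hb hba hab
  have ha : 1 ≤ a := by linarith
  have hfd : (a - b) / 2 ≤ (a + b) / 2 := by linarith
  set d := (a + b) / 2
  set f := (a - b) / 2
  refine whp_abs_sub_lt (by positivity) hb (fun n => by positivity)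
    (V := fun n => 2 * cycleLength n * (d ^ cycleLength n + f ^ cycleLength n) +
      a ^ (2 * cycleLength n) * (cycleLength n + 1) ^ cycleLength n / n) ?_ ?_
  · filter_upwards [eventually_ge_atTop ⌈a⌉₊,
      tendsto_cycleLength.eventually (eventually_ge_atTop 3)] with n hn hm
    exact ssbmExp_cycleCount_sub_sq_le hb hba ha (Nat.ceil_le.1 hn) hm
  have hlim₁ : Tendsto (fun n : ℕ => 256 * ((cycleLength n : ℝ) *
      (d / f ^ 2) ^ cycleLength n)) atTop (𝓝 (256 * 0)) :=
    ((tendsto_self_mul_const_pow_of_lt_one (by positivity)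
      ((div_lt_one (by positivity)).2 hdf)).comp tendsto_cycleLength).const_mul 256
  have hlim := hlim₁.add ((tendsto_pow_cycleLength_div (a ^ 2) (by positivity) 1).const_mul 64)
  simp only [mul_zero, add_zero] at hlim
  refine squeeze_zero' (Eventually.of_forall fun n => by positivity) ?_ hlim
  refine Eventually.of_forall fun n => ?_
  set m := cycleLength n
  calc (2 * m * (d ^ m + f ^ m) + a ^ (2 * m) * (m + 1) ^ m / n) / (f ^ m / 8) ^ 2
    _ = 64 / (f ^ 2) ^ m * (2 * m * (d ^ m + f ^ m)) +
        64 / (f ^ 2) ^ m * (a ^ (2 * m) * (m + 1) ^ m / n) := by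
        rw [← pow_mul, mul_comm 2 m, pow_mul]
        field
    _ ≤ 64 / (f ^ 2) ^ m * (2 * m * (d ^ m + d ^ m)) +
        64 / 1 * (a ^ (2 * m) * (m + 1) ^ m / n) := by
        gcongr
        exact one_le_pow₀ (one_le_pow₀ hf.le)
    _ = 256 * ((m : ℝ) * (d / f ^ 2) ^ m) + 64 * ((a ^ 2 * ((m : ℝ) + 1) ^ 1) ^ m / n) := by
        rw [div_pow, mul_pow (a ^ 2), pow_one, ← pow_mul]
        ring_nf

theorem eventually_cycleLength_sq_mul_pow_lt {d : ℝ} (hd : 0 ≤ d) :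
    ∀ᶠ n : ℕ in atTop, 16 * ((cycleLength n : ℝ) * cycleLength n) * d ^ cycleLength n < n := by
  have hsmall := (tendsto_pow_cycleLength_div (16 * d) (by positivity) 2).eventually
    (gt_mem_nhds zero_lt_one)
  filter_upwards [hsmall, eventually_gt_atTop 0,
    tendsto_cycleLength.eventually (eventually_ge_atTop 1)] with n hn hn₀ hm
  rw [div_lt_one (by positivity)] at hn
  refine lt_of_le_of_lt ?_ hn
  set m := cycleLength n
  have h16 : (16 : ℝ) ≤ 16 ^ m := le_self_pow₀ (by norm_num) (by omega)
  have hsq : ((m : ℝ) + 1) ^ 2 ≤ (((m : ℝ) + 1) ^ 2) ^ m :=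
    le_self_pow₀ (by nlinarith [m.cast_nonneg (α := ℝ)]) (by omega)
  calc 16 * ((m : ℝ) * m) * d ^ m = 16 * d ^ m * ((m : ℝ) * m) := by ring
    _ ≤ 16 ^ m * d ^ m * (((m : ℝ) + 1) ^ 2) ^ m := by
        gcongr
        nlinarith [m.cast_nonneg (α := ℝ)]
    _ = (16 * d * ((m : ℝ) + 1) ^ 2) ^ m := by rw [mul_pow, mul_pow]

theorem whp_radicand (hb : 0 ≤ b) (hba : b ≤ a) (hab : (a - b) ^ 2 > 2 * (a + b)) :
    WHP a b fun n G => 1 / 2 * ((a - b) / 2) ^ cycleLength n ≤ radicand G ∧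
      radicand G ≤ 2 * ((a - b) / 2) ^ cycleLength n := by
  obtain ⟨hf, -⟩ := params_bounds hb hba hab
  have hfd : (a - b) / 2 ≤ (a + b) / 2 := by linarith
  have ha : 1 ≤ a := by linarith
  refine ((whp_abs_dHat_sub_lt_degreeTolerance hb hba ha).and (by positivity) hb
    (whp_abs_cycleCount_sub_lt hb hba hab)).mono (by positivity) hb ?_
  set d := (a + b) / 2
  set f := (a - b) / 2
  have hd : 1 ≤ d := hf.le.trans hfd
  filter_upwards [eventually_cycleLength_sq_mul_pow_lt (zero_le_one.trans hd),
    eventually_gt_atTop 0] with n hn hn₀ G ⟨hdeg, hcycle⟩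
  unfold radicand
  set m := cycleLength n
  have hfm : 1 ≤ f ^ m := one_le_pow₀ hf.le
  have hdm : 1 ≤ d ^ m := one_le_pow₀ hd
  have hmn : m ≤ n := by
    have hmm : (m : ℝ) ≤ m * m := by exact_mod_cast Nat.le_mul_self m
    exact_mod_cast (show (m : ℝ) ≤ n by nlinarith)
  have hdesc : |n.descFactorial m / (n : ℝ) ^ m * (d ^ m + f ^ m) - (d ^ m + f ^ m)| ≤
      f ^ m / 8 := by
    refine (abs_descFactorial_div_mul_sub_le (by positivity) hmn hn₀).trans ?_
    rw [div_mul_eq_mul_div, div_le_iff₀ (by positivity)]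
    calc (m : ℝ) * m * (d ^ m + f ^ m) ≤ m * m * (d ^ m + d ^ m) := by gcongr
      _ ≤ 1 / 8 * n := by linarith
      _ ≤ f ^ m / 8 * n := by gcongr
  have hpow := abs_le.1 (abs_pow_sub_pow_le_of_degreeTolerance hd hdeg.le)
  have hcycle := abs_lt.1 hcycle
  have hdesc := abs_le.1 hdesc
  constructor <;> linarith

theorem tendsto_rpow_one_div_cycleLength_mul {c : ℝ} (hc : 0 < c) (f : ℝ) :
    Tendsto (fun n : ℕ => c ^ (1 / (cycleLength n : ℝ)) * f) atTop (𝓝 f) := by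
  have hinv : Tendsto (fun n : ℕ => 1 / (cycleLength n : ℝ)) atTop (𝓝 0) :=
    tendsto_one_div_atTop_nhds_zero_nat.comp tendsto_cycleLength
  simpa using ((Real.continuousAt_const_rpow hc.ne').tendsto.comp hinv).mul_const f

theorem whp_abs_fHat_sub_lt (hb : 0 ≤ b) (hba : b ≤ a) (hab : (a - b) ^ 2 > 2 * (a + b)) {ε : ℝ}
    (hε : 0 < ε) : WHP a b fun _ G => |fHat G - (a - b) / 2| < ε := by
  refine (whp_radicand hb hba hab).mono (hb.trans hba) hb ?_
  obtain ⟨hf, -⟩ := params_bounds hb hba hab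
  set f := (a - b) / 2
  filter_upwards [(tendsto_rpow_one_div_cycleLength_mul one_half_pos f).eventually
      (lt_mem_nhds (sub_lt_self f hε)),
    (tendsto_rpow_one_div_cycleLength_mul two_pos f).eventually
      (gt_mem_nhds (lt_add_of_pos_right f hε)),
    tendsto_cycleLength.eventually (eventually_ge_atTop 1)] with n hlower hupper hm G hG
  have hroot {c : ℝ} (hc : 0 < c) : (c * f ^ cycleLength n) ^ (1 / (cycleLength n : ℝ)) =
      c ^ (1 / (cycleLength n : ℝ)) * f := by
    rw [Real.mul_rpow hc.le (by positivity), one_div,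
      Real.pow_rpow_inv_natCast (by positivity) (by omega)]
  rw [← hroot one_half_pos] at hlower
  rw [← hroot two_pos] at hupper
  have hge := Real.rpow_le_rpow (by positivity) hG.1
    (show 0 ≤ 1 / (cycleLength n : ℝ) by positivity)
  have hle := Real.rpow_le_rpow (le_trans (by positivity) hG.1) hG.2
    (show 0 ≤ 1 / (cycleLength n : ℝ) by positivity)
  rw [fHat, abs_lt]
  constructor <;> linarith

theorem whp_abs_dHat_sub_lt (hb : 0 ≤ b) (hba : b ≤ a) (hab : (a - b) ^ 2 > 2 * (a + b)) {ε : ℝ}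
    (hε : 0 < ε) : WHP a b fun _ G => |dHat G - (a + b) / 2| < ε := by
  obtain ⟨hf, -⟩ := params_bounds hb hba hab
  refine (whp_abs_dHat_sub_lt_degreeTolerance hb hba (by linarith)).mono (hb.trans hba) hb ?_
  have hinv := tendsto_one_div_add_atTop_nhds_zero_nat (𝕜 := ℝ).comp tendsto_cycleLength
  filter_upwards [hinv.eventually (gt_mem_nhds hε)] with n hn G hG
  exact hG.trans ((degreeTolerance_le (by linarith) _).trans_lt hn)

theorem isConsistent_of_whp {est : ∀ n : ℕ, SimpleGraph (Fin n) → ℝ} {θ : ℝ}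
    (h : ∀ ε : ℝ, 0 < ε → WHP a b fun n G => |est n G - θ| < ε) : IsConsistent a b est θ := by
  simpa only [IsConsistent, WHP, not_lt] using h

theorem isConsistent_dHat_add_fHat (hb : 0 ≤ b) (hba : b ≤ a)
    (hab : (a - b) ^ 2 > 2 * (a + b)) : IsConsistent a b (fun _ G => dHat G + fHat G) a := by
  refine isConsistent_of_whp fun ε hε => ?_
  refine ((whp_abs_dHat_sub_lt hb hba hab (half_pos hε)).and (hb.trans hba) hb
    (whp_abs_fHat_sub_lt hb hba hab (half_pos hε))).mono (hb.trans hba) hb ?_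
  refine Eventually.of_forall fun n G ⟨hd, hf⟩ => ?_
  rw [abs_lt] at *
  constructor <;> linarith

theorem isConsistent_dHat_sub_fHat (hb : 0 ≤ b) (hba : b ≤ a)
    (hab : (a - b) ^ 2 > 2 * (a + b)) : IsConsistent a b (fun _ G => dHat G - fHat G) b := by
  refine isConsistent_of_whp fun ε hε => ?_
  refine ((whp_abs_dHat_sub_lt hb hba hab (half_pos hε)).and (hb.trans hba) hb
    (whp_abs_fHat_sub_lt hb hba hab (half_pos hε))).mono (hb.trans hba) hb ?_
  refine Eventually.of_forall fun n G ⟨hd, hf⟩ => ?_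
  rw [abs_lt] at *
  constructor <;> linarith

end Consistency

/-! ### Powers of `e` are not too close to integers -/

section ExponentialGap

open Polynomial intervalIntegral

/-- Niven's polynomial. Its integral against `exp (-x)` over `[0, M]` is small and positive, and
`exp M` times that integral is a combination of `exp M` and `1` with integer coefficients divisible
by `p!`. -/
noncomputable def nivenPoly (M p : ℕ) : ℤ[X] := X ^ p * (C (M : ℤ) - X) ^ p

theorem aeval_nivenPoly (M p : ℕ) (x : ℝ) : aeval x (nivenPoly M p) = x ^ p * (M - x) ^ p := by
  simp [nivenPoly]

theorem eval_map_sumIDeriv_nivenPoly (M p : ℕ) (x : ℝ) :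
    ((sumIDeriv (nivenPoly M p)).map (algebraMap ℤ ℝ)).eval x = x ^ p * (M - x) ^ p +
      (derivative ((sumIDeriv (nivenPoly M p)).map (algebraMap ℤ ℝ))).eval x := by
  conv_lhs => rw [← sumIDeriv_map, sumIDeriv_eq_self_add, sumIDeriv_map]
  rw [eval_add, eval_map_algebraMap, aeval_nivenPoly]

theorem exp_mul_integral_nivenPoly (M p : ℕ) :
    Real.exp M * ∫ x in (0 : ℝ)..M, Real.exp (-x) * (x ^ p * (M - x) ^ p) =
      Real.exp M * (sumIDeriv (nivenPoly M p)).eval 0 -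
        (sumIDeriv (nivenPoly M p)).eval (M : ℤ) := by
  set F := (sumIDeriv (nivenPoly M p)).map (algebraMap ℤ ℝ)
  have hderiv (x : ℝ) : HasDerivAt (fun x => -(Real.exp (-x) * F.eval x))
      (Real.exp (-x) * (x ^ p * (M - x) ^ p)) x := by
    have hexp : HasDerivAt (fun x : ℝ => Real.exp (-x)) (-Real.exp (-x)) x := by
      simpa using (hasDerivAt_neg x).exp
    refine (hexp.fun_mul (F.hasDerivAt x)).fun_neg.congr_deriv ?_
    rw [eval_map_sumIDeriv_nivenPoly]
    ring
  have heval (z : ℤ) : F.eval (z : ℝ) = ((sumIDeriv (nivenPoly M p)).eval z : ℤ) :=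
    eval_intCast_map (algebraMap ℤ ℝ) _ z
  have heval₀ : F.eval 0 = ((sumIDeriv (nivenPoly M p)).eval 0 : ℤ) := by
    simpa only [Int.cast_zero] using heval 0
  have hevalM : F.eval (M : ℝ) = ((sumIDeriv (nivenPoly M p)).eval (M : ℤ) : ℤ) := by
    simpa only [Int.cast_natCast] using heval M
  rw [integral_eq_sub_of_hasDerivAt (fun x _ => hderiv x)
    (Continuous.intervalIntegrable (by fun_prop) _ _), heval₀, hevalM, neg_zero, Real.exp_zero,
    one_mul, sub_neg_eq_add, mul_add, mul_neg, ← mul_assoc, ← Real.exp_add, add_neg_cancel,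
    Real.exp_zero]
  ring

theorem factorial_dvd_eval_sumIDeriv {f : ℤ[X]} {p : ℕ} {z : ℤ} (h : (X - C z) ^ p ∣ f) :
    (p.factorial : ℤ) ∣ (sumIDeriv f).eval z := by
  obtain ⟨g, -, hg⟩ := aeval_sumIDeriv (A := ℤ) f p
  have hz := hg z (by simpa using h)
  rw [coe_aeval_eq_eval, nsmul_eq_mul] at hz
  exact ⟨_, hz⟩

theorem X_pow_dvd_nivenPoly (M p : ℕ) : (X - C 0) ^ p ∣ nivenPoly M p := by
  rw [C_0, sub_zero]
  exact dvd_mul_right _ _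

theorem X_sub_C_pow_dvd_nivenPoly (M p : ℕ) : (X - C (M : ℤ)) ^ p ∣ nivenPoly M p :=
  (pow_dvd_pow_of_dvd (dvd_sub_comm.1 dvd_rfl) p).mul_left _

theorem abs_coeff_nivenPoly_le {M : ℕ} (hM : 1 ≤ M) (p j : ℕ) :
    |(nivenPoly M p).coeff j| ≤ (2 * M : ℤ) ^ p := by
  rw [nivenPoly, coeff_X_pow_mul']
  split_ifs
  · have hneg : (C (M : ℤ) - X) ^ p = (C ((-1) ^ p) : ℤ[X]) * (X + C (-(M : ℤ))) ^ p := by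
      rw [C_pow, ← mul_pow, C_neg, C_neg, C_1]
      ring
    rw [hneg, coeff_C_mul, coeff_X_add_C_pow]
    simp only [abs_mul, abs_pow, abs_neg, abs_one, one_pow, one_mul, Nat.abs_cast]
    rw [mul_comm, mul_pow]
    gcongr
    · exact_mod_cast Nat.choose_le_two_pow p _
    · exact_mod_cast hM
    · omega
  · simp

theorem natDegree_nivenPoly_le (M p : ℕ) : (nivenPoly M p).natDegree ≤ 2 * p := by
  have hX : (X ^ p : ℤ[X]).natDegree ≤ p := by simp
  have hsub : ((C (M : ℤ) - X) ^ p).natDegree ≤ p * 1 :=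
    natDegree_pow_le_of_le p ((natDegree_sub_le _ _).trans (by simp))
  exact natDegree_mul_le.trans (by omega)

theorem abs_eval_zero_sumIDeriv_nivenPoly_le {M : ℕ} (hM : 1 ≤ M) (p : ℕ) :
    |(sumIDeriv (nivenPoly M p)).eval 0| ≤ ((2 * p + 1).factorial : ℤ) * (2 * M) ^ p := by
  rw [sumIDeriv_apply_of_le (natDegree_nivenPoly_le M p), eval_finsetSum]
  have hterm : ∀ j ∈ Finset.range (2 * p + 1), |(derivative^[j] (nivenPoly M p)).eval 0| ≤
      ((2 * p).factorial : ℤ) * (2 * M) ^ p := by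
    intro j hj
    rw [← coeff_zero_eq_eval_zero, coeff_iterate_derivative, zero_add, Nat.descFactorial_self,
      nsmul_eq_mul, abs_mul, Nat.abs_cast]
    have hfac : j.factorial ≤ (2 * p).factorial :=
      Nat.factorial_le (Nat.lt_succ_iff.1 (Finset.mem_range.1 hj))
    have hcoeff := abs_coeff_nivenPoly_le hM p j
    gcongr
  refine ((Finset.abs_sum_le_sum_abs _ _).trans (Finset.sum_le_sum hterm)).trans_eq ?_
  rw [Finset.sum_const, Finset.card_range, nsmul_eq_mul, Nat.factorial_succ]
  push_cast
  ring

theorem integral_nivenPoly_le (M p : ℕ) :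
    ∫ x in (0 : ℝ)..M, Real.exp (-x) * (x ^ p * (M - x) ^ p) ≤ M * (M : ℝ) ^ (2 * p) := by
  have hle : ∀ x ∈ Set.Icc (0 : ℝ) M,
      Real.exp (-x) * (x ^ p * (M - x) ^ p) ≤ (M : ℝ) ^ (2 * p) := by
    intro x hx
    have hx₀ : 0 ≤ x := hx.1
    have hxM : 0 ≤ M - x := sub_nonneg.2 hx.2
    calc Real.exp (-x) * (x ^ p * (M - x) ^ p) ≤ 1 * ((M : ℝ) ^ p * (M : ℝ) ^ p) := by
          gcongr
          · simpa using hx₀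
          · exact hx.2
          · linarith
      _ = (M : ℝ) ^ (2 * p) := by rw [two_mul, pow_add, one_mul]
  simpa using integral_mono_on (μ := MeasureTheory.volume) (a := (0 : ℝ)) (b := M) (by positivity)
    (Continuous.intervalIntegrable (by fun_prop) _ _)
    (Continuous.intervalIntegrable (continuous_const (y := (M : ℝ) ^ (2 * p))) _ _) hle

theorem le_exp_mul_integral_nivenPoly {M : ℕ} (hM : 1 ≤ M) (p : ℕ) :
    (1 / 16 : ℝ) ^ p / 2 ≤
      Real.exp M * ∫ x in (0 : ℝ)..M, Real.exp (-x) * (x ^ p * (M - x) ^ p) := by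
  have hM' : (1 : ℝ) ≤ M := by exact_mod_cast hM
  have hcont : Continuous fun x : ℝ => Real.exp (-x) * (x ^ p * (M - x) ^ p) := by fun_prop
  have hsub : ∫ x in (1 / 4 : ℝ)..(3 / 4), Real.exp (-x) * (x ^ p * (M - x) ^ p) ≤
      ∫ x in (0 : ℝ)..M, Real.exp (-x) * (x ^ p * (M - x) ^ p) := by
    refine integral_mono_interval (by norm_num) (by norm_num) (by linarith) ?_
      (hcont.intervalIntegrable _ _)
    refine MeasureTheory.ae_restrict_of_forall_mem measurableSet_Ioc fun x hx => ?_
    have hx₀ : 0 < x := hx.1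
    have hxM : 0 ≤ (M : ℝ) - x := sub_nonneg.2 hx.2
    simp only [Pi.zero_apply]
    positivity
  have hge : ∀ x ∈ Set.Icc (1 / 4 : ℝ) (3 / 4), Real.exp (-M) * (1 / 16 : ℝ) ^ p ≤
      Real.exp (-x) * (x ^ p * (M - x) ^ p) := by
    intro x hx
    rw [← mul_pow]
    gcongr
    · linarith [hx.2]
    · nlinarith [hx.1, hx.2]
  have hmono := integral_mono_on (μ := MeasureTheory.volume) (a := (1 / 4 : ℝ)) (b := 3 / 4)
    (by norm_num) (Continuous.intervalIntegrable
      (continuous_const (y := Real.exp (-M) * (1 / 16 : ℝ) ^ p)) _ _)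
    (hcont.intervalIntegrable _ _) hge
  rw [integral_const, smul_eq_mul] at hmono
  calc (1 / 16 : ℝ) ^ p / 2
      = Real.exp M * ((3 / 4 - 1 / 4) * (Real.exp (-M) * (1 / 16 : ℝ) ^ p)) := by
        rw [Real.exp_neg]
        field_simp
        norm_num
    _ ≤ _ := by
        gcongr
        exact hmono.trans hsub

theorem abs_le_abs_of_eq_add_intCast {x y : ℝ} {z : ℤ} (hx : |x| ≤ 1 / 2) (h : x = y + z) :
    |x| ≤ |y| := by
  rcases eq_or_ne z 0 with rfl | hz
  · rw [h, Int.cast_zero, add_zero]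
  · have hz₁ : (1 : ℝ) ≤ |(z : ℝ)| := by exact_mod_cast Int.one_le_abs hz
    have hsub : |(z : ℝ)| ≤ |x| + |y| := by
      rw [← sub_eq_iff_eq_add'.2 h]
      exact abs_sub x y
    linarith

theorem div_le_exp_sub_natCast {M n p : ℕ} (hM : 1 ≤ M) (hn : (n : ℝ) < Real.exp M)
    (hp : Real.exp M * (M * (M : ℝ) ^ (2 * p)) / p.factorial ≤ 1 / 2) :
    (1 / 16 : ℝ) ^ p / 2 / ((2 * p + 1).factorial * (2 * M) ^ p) ≤ Real.exp M - n := by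
  obtain ⟨u, hu⟩ := factorial_dvd_eval_sumIDeriv (X_pow_dvd_nivenPoly M p)
  obtain ⟨v, hv⟩ := factorial_dvd_eval_sumIDeriv (X_sub_C_pow_dvd_nivenPoly M p)
  have hintegral := exp_mul_integral_nivenPoly M p
  have hlower := le_exp_mul_integral_nivenPoly hM p
  have hupper : Real.exp M * (∫ x in (0 : ℝ)..M, Real.exp (-x) * (x ^ p * (M - x) ^ p)) /
      p.factorial ≤ 1 / 2 := by
    refine le_trans ?_ hp
    gcongr
    exact integral_nivenPoly_le M p
  set E := Real.exp M * ∫ x in (0 : ℝ)..M, Real.exp (-x) * (x ^ p * (M - x) ^ p)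
  have hE : 0 < E := lt_of_lt_of_le (by positivity) hlower
  have hfac : (0 : ℝ) < p.factorial := by exact_mod_cast p.factorial_pos
  have hcoeff : p.factorial * |(u : ℝ)| ≤ (2 * p + 1).factorial * (2 * M) ^ p := by
    have h := abs_eval_zero_sumIDeriv_nivenPoly_le hM p
    rw [hu, abs_mul, Nat.abs_cast] at h
    exact_mod_cast h
  have hgap : 0 < Real.exp M - n := sub_pos.2 hn
  have hsplit : E / p.factorial = (Real.exp M - n) * u + ((n * u - v : ℤ) : ℝ) := by
    rw [hintegral, hu, hv]
    push_cast
    field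
  have hmain := abs_le_abs_of_eq_add_intCast (by rwa [abs_of_pos (by positivity)]) hsplit
  rw [abs_of_pos (by positivity), div_le_iff₀ hfac, abs_mul, abs_of_pos hgap] at hmain
  rw [div_le_iff₀ (by positivity)]
  calc (1 / 16 : ℝ) ^ p / 2 ≤ E := hlower
    _ ≤ (Real.exp M - n) * (p.factorial * |(u : ℝ)|) := by linarith
    _ ≤ _ := by gcongr

theorem pow_div_factorial_nine_mul_sq_le (M : ℕ) :
    (M : ℝ) ^ (2 * (9 * M ^ 2)) / (9 * M ^ 2).factorial ≤ Real.exp (-(9 * M ^ 2 : ℕ)) := by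
  set p := 9 * M ^ 2 with hp
  have hpR : (p : ℝ) = 9 * (M : ℝ) ^ 2 := by
    rw [hp]
    push_cast
    rfl
  have hexp_two : Real.exp 2 ≤ 9 := by
    have hsq : Real.exp 2 = Real.exp 1 ^ 2 := by rw [← Real.exp_nat_mul]; norm_num
    nlinarith [Real.exp_one_lt_d9, Real.exp_pos 1]
  calc (M : ℝ) ^ (2 * p) / p.factorial = (p : ℝ) ^ p / p.factorial / 9 ^ p := by
        rw [hpR, mul_pow, pow_mul]
        field
    _ ≤ Real.exp p / Real.exp 2 ^ p := by
        gcongr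
        exact Real.pow_div_factorial_le_exp _ (by positivity) p
    _ = Real.exp (-p) := by
        rw [← Real.exp_nat_mul, ← Real.exp_sub]
        ring_nf

theorem exp_mul_pow_div_factorial_le_half {M : ℕ} (hM : 1 ≤ M) :
    Real.exp M * (M * (M : ℝ) ^ (2 * (9 * M ^ 2))) / (9 * M ^ 2).factorial ≤ 1 / 2 := by
  have hM' : (1 : ℝ) ≤ M := by exact_mod_cast hM
  have hfac := pow_div_factorial_nine_mul_sq_le M
  calc Real.exp M * (M * (M : ℝ) ^ (2 * (9 * M ^ 2))) / (9 * M ^ 2).factorial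
      = Real.exp M * M * ((M : ℝ) ^ (2 * (9 * M ^ 2)) / (9 * M ^ 2).factorial) := by ring
    _ ≤ Real.exp M * Real.exp M * Real.exp (-(9 * M ^ 2 : ℕ)) := by
        gcongr
        linarith [Real.add_one_le_exp (M : ℝ)]
    _ = Real.exp (2 * M - 9 * M ^ 2) := by
        rw [← Real.exp_add, ← Real.exp_add]
        push_cast
        ring_nf
    _ ≤ Real.exp (-1) := Real.exp_le_exp.2 (by nlinarith)
    _ ≤ 1 / 2 := by
        rw [Real.exp_neg, inv_eq_one_div]
        exact one_div_le_one_div_of_le (by norm_num) (by linarith [Real.add_one_le_exp 1])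

theorem pow_le_exp_mul {x : ℝ} (hx : 0 ≤ x) (p : ℕ) : x ^ p ≤ Real.exp (p * x) := by
  rw [Real.exp_nat_mul]
  gcongr
  linarith [Real.add_one_le_exp x]

theorem pow_mul_factorial_mul_pow_le_exp (M p : ℕ) :
    (16 : ℝ) ^ p * 2 * ((2 * p + 1).factorial * (2 * M) ^ p) ≤
      Real.exp (p * 16 + 2 + ((2 * p + 1 : ℕ) * (2 * p + 1 : ℕ) + p * (2 * M))) := by
  rw [Real.exp_add, Real.exp_add, Real.exp_add]
  have hfac : ((2 * p + 1).factorial : ℝ) ≤ ((2 * p + 1 : ℕ) : ℝ) ^ (2 * p + 1) := by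
    exact_mod_cast Nat.factorial_le_pow _
  gcongr
  · exact pow_le_exp_mul (by norm_num) p
  · linarith [Real.add_one_le_exp 2]
  · exact hfac.trans (pow_le_exp_mul (by positivity) _)
  · exact pow_le_exp_mul (by positivity) p

theorem exp_neg_mul_pow_four_le_exp_sub_natCast {M n : ℕ} (hM : 1 ≤ M)
    (hn : (n : ℝ) < Real.exp M) :
    Real.exp (-(525 * (M : ℝ) ^ 4)) ≤ Real.exp M - n := by
  have hM' : (1 : ℝ) ≤ M := by exact_mod_cast hM
  refine le_trans ?_ (div_le_exp_sub_natCast hM hn (exp_mul_pow_div_factorial_le_half hM))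
  rw [one_div_pow, div_div, div_div, one_div, Real.exp_neg]
  gcongr
  refine (le_of_eq (by ring)).trans ((pow_mul_factorial_mul_pow_le_exp M (9 * M ^ 2)).trans ?_)
  rw [Real.exp_le_exp]
  push_cast
  have hpow₄ : (1 : ℝ) ≤ (M : ℝ) ^ 4 := one_le_pow₀ hM'
  have hpow₂ : (M : ℝ) ^ 2 ≤ (M : ℝ) ^ 4 := pow_le_pow_right₀ hM' (by norm_num)
  have hpow₃ : (M : ℝ) ^ 3 ≤ (M : ℝ) ^ 4 := pow_le_pow_right₀ hM' (by norm_num)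
  nlinarith

end ExponentialGap

/-! ### Deciding `e ^ M ≤ n` by a partial sum of the exponential series -/

/-- The numerator of the partial sum `∑ i ≤ T, M ^ i / i!` over the denominator `T!`. -/
def taylorNum (M : ℕ) : ℕ → ℕ
  | 0 => 1
  | T + 1 => taylorNum M T * (T + 1) + M ^ (T + 1)

theorem cast_taylorNum (M T : ℕ) :
    (taylorNum M T : ℝ) = T.factorial * ∑ i ∈ Finset.range (T + 1), (M : ℝ) ^ i / i.factorial := by
  induction T with
  | zero => simp [taylorNum]
  | succ T ih =>
    rw [taylorNum, Finset.sum_range_succ, Nat.factorial_succ]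
    push_cast
    rw [ih]
    field_simp

theorem exp_sub_sum_range_eq_tsum (x : ℝ) (T : ℕ) :
    Real.exp x - ∑ i ∈ Finset.range T, x ^ i / i.factorial =
      ∑' i : ℕ, x ^ (i + T) / (i + T).factorial := by
  rw [sub_eq_iff_eq_add', (Real.summable_pow_div_factorial x).sum_add_tsum_nat_add T,
    Real.exp_eq_exp_ℝ, NormedSpace.exp_eq_tsum_div]

theorem exp_sub_sum_range_le {x c : ℝ} (hx : 0 ≤ x) (hc : 1 ≤ c) (T : ℕ) :
    Real.exp x - ∑ i ∈ Finset.range T, x ^ i / i.factorial ≤ Real.exp (c * x) / c ^ T := by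
  have hsum (x : ℝ) : Summable fun i : ℕ => x ^ (i + T) / (i + T).factorial :=
    (summable_nat_add_iff T).2 (Real.summable_pow_div_factorial x)
  rw [exp_sub_sum_range_eq_tsum, le_div_iff₀' (by positivity), ← tsum_mul_left]
  calc ∑' i : ℕ, c ^ T * (x ^ (i + T) / (i + T).factorial)
      ≤ ∑' i : ℕ, (c * x) ^ (i + T) / (i + T).factorial := by
        refine ((hsum x).mul_left _).tsum_le_tsum (fun i => ?_) (hsum (c * x))
        rw [mul_pow, ← mul_div_assoc]
        gcongr
        omega
    _ ≤ Real.exp (c * x) := by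
        rw [← exp_sub_sum_range_eq_tsum]
        exact sub_le_self _ (Finset.sum_nonneg fun i _ => by positivity)

theorem taylorNum_le_of_exp_le {M n : ℕ} (h : Real.exp M ≤ n) (T : ℕ) :
    taylorNum M T ≤ n * T.factorial := by
  have hsum := (Real.sum_le_exp_of_nonneg (x := M) (by positivity) (T + 1)).trans h
  have hcast : (taylorNum M T : ℝ) ≤ n * T.factorial := by
    rw [cast_taylorNum, mul_comm]
    gcongr
  exact_mod_cast hcast

theorem lt_taylorNum_of_lt_exp {M n T : ℕ} (hM : 1 ≤ M) (hn : (n : ℝ) < Real.exp M)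
    (hT : 528 * M ^ 4 ≤ T) : n * T.factorial < taylorNum M T := by
  have hgap := exp_neg_mul_pow_four_le_exp_sub_natCast hM hn
  have htail := exp_sub_sum_range_le M.cast_nonneg (Real.one_le_exp zero_le_one) (T + 1)
  have hlt : Real.exp (Real.exp 1 * M) / Real.exp 1 ^ (T + 1) <
      Real.exp (-(525 * (M : ℝ) ^ 4)) := by
    rw [← Real.exp_nat_mul, ← Real.exp_sub, Real.exp_lt_exp]
    have hexp : Real.exp 1 * M ≤ 3 * M := by
      gcongr
      linarith [Real.exp_one_lt_d9]
    have hM₄ : (M : ℝ) ≤ (M : ℝ) ^ 4 := by exact_mod_cast Nat.le_self_pow (by norm_num) M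
    have hT' : 528 * (M : ℝ) ^ 4 ≤ T := by exact_mod_cast hT
    push_cast
    linarith
  have hcast : ((n * T.factorial : ℕ) : ℝ) < taylorNum M T := by
    rw [cast_taylorNum, Nat.cast_mul, mul_comm]
    exact mul_lt_mul_of_pos_left (by linarith) (by exact_mod_cast T.factorial_pos)
  exact_mod_cast hcast

theorem taylorNum_le_of_le_cycleLength {n j : ℕ} (hn : 1 ≤ n) (hj : j ≤ cycleLength n) :
    taylorNum (j ^ 4) n ≤ n * n.factorial :=
  taylorNum_le_of_exp_le (by exact_mod_cast (le_cycleLength_iff hn j).1 hj) n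

theorem eventually_lt_taylorNum : ∀ᶠ n : ℕ in atTop,
    n * n.factorial < taylorNum ((cycleLength n + 1) ^ 4) n := by
  filter_upwards [tendsto_cycleLength.eventually (eventually_mul_pow_le_exp 528 16),
    eventually_ge_atTop 1, tendsto_cycleLength.eventually (eventually_ge_atTop 1)] with n hexp hn hm
  refine lt_taylorNum_of_lt_exp (Nat.one_le_pow _ _ (by omega)) ?_ ?_
  · have h := (le_cycleLength_iff hn (cycleLength n + 1)).not.1 (by omega)
    exact_mod_cast not_le.1 h
  · have hm' : (1 : ℝ) ≤ cycleLength n := by exact_mod_cast hm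
    have h := hexp.trans ((Real.exp_le_exp.2 (le_self_pow₀ hm' (by norm_num))).trans
      (exp_cycleLength_le hn))
    rw [← pow_mul]
    exact_mod_cast h

/-! ### A program logic for the random access machine -/

namespace RAM

@[simp] theorem State.reg_setReg (s : State) (i v j : ℕ) :
    (s.setReg i v).reg j = if j = i then v else s.reg j := by
  simp [State.setReg, Function.update_apply]

@[simp] theorem State.mem_setReg (s : State) (i v : ℕ) : (s.setReg i v).mem = s.mem := rfl

@[simp] theorem State.reg_setMem (s : State) (i v : ℕ) : (s.setMem i v).reg = s.reg := rfl

@[simp] theorem State.mem_setMem (s : State) (i v j : ℕ) :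
    (s.setMem i v).mem j = if j = i then v else s.mem j := by
  simp [State.setMem, Function.update_apply]

/-- The registers that a program may overwrite. -/
def Prog.writes : Prog → List ℕ
  | .skip => []
  | .const i _ => [i]
  | .op _ i _ _ => [i]
  | .load i _ => [i]
  | .store _ _ => []
  | .seq P Q => P.writes ++ Q.writes
  | .ifLt _ _ P Q => P.writes ++ Q.writes
  | .whileLt _ _ P => P.writes

/-- The program has no `store` instruction, so that it leaves the array alone. -/
def Prog.storeFree : Prog → Bool
  | .skip => true
  | .const _ _ => true
  | .op _ _ _ _ => true
  | .load _ _ => true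
  | .store _ _ => false
  | .seq P Q => P.storeFree && Q.storeFree
  | .ifLt _ _ P Q => P.storeFree && Q.storeFree
  | .whileLt _ _ P => P.storeFree

theorem Exec.reg_eq {P : Prog} {s s' : State} {t : ℕ} (h : Exec P s s' t) {r : ℕ}
    (hr : r ∉ P.writes) : s'.reg r = s.reg r := by
  induction h with
  | skip | store | whileFalse => rfl
  | const | op | load =>
    simp only [Prog.writes, List.mem_singleton] at hr
    simp [hr]
  | seq _ _ ih₁ ih₂ =>
    simp only [Prog.writes, List.mem_append, not_or] at hr
    rw [ih₂ hr.2, ih₁ hr.1]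
  | ifTrue _ _ ih =>
    simp only [Prog.writes, List.mem_append, not_or] at hr
    exact ih hr.1
  | ifFalse _ _ ih =>
    simp only [Prog.writes, List.mem_append, not_or] at hr
    exact ih hr.2
  | whileTrue _ _ _ ih₁ ih₂ => rw [ih₂ hr, ih₁ hr]

theorem Exec.mem_eq {P : Prog} {s s' : State} {t : ℕ} (h : Exec P s s' t)
    (hP : P.storeFree = true) : s'.mem = s.mem := by
  induction h with
  | skip | whileFalse | const | op | load => rfl
  | store => simp [Prog.storeFree] at hP
  | seq _ _ ih₁ ih₂ =>
    simp only [Prog.storeFree, Bool.and_eq_true] at hP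
    rw [ih₂ hP.2, ih₁ hP.1]
  | ifTrue _ _ ih =>
    simp only [Prog.storeFree, Bool.and_eq_true] at hP
    exact ih hP.1
  | ifFalse _ _ ih =>
    simp only [Prog.storeFree, Bool.and_eq_true] at hP
    exact ih hP.2
  | whileTrue _ _ _ ih₁ ih₂ => rw [ih₂ hP, ih₁ hP]

/-- All numbers in the state have at most `B` bits. -/
def Bdd (B : ℕ) (s : State) : Prop := (∀ i, s.reg i < 2 ^ B) ∧ ∀ i, s.mem i < 2 ^ B

/-- A total correctness precondition for the cost model: started in the state `s`, if its numbers
have at most `B` bits, the program halts in a state and after a number of steps that are related by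
`Q`. The numbers on the way have at most `B` bits, and a step is charged `3 * B + 1`, since it
handles at most three numbers. -/
def wp (B : ℕ) (P : Prog) (s : State) (Q : State → ℕ → Prop) : Prop :=
  Bdd B s → ∃ s' t k, Exec P s s' t ∧ Bdd B s' ∧ t ≤ k * (3 * B + 1) ∧ Q s' k

theorem wp_mono {B : ℕ} {P : Prog} {s : State} {Q Q' : State → ℕ → Prop} (h : wp B P s Q)
    (hQ : ∀ s' k, Q s' k → Q' s' k) : wp B P s Q' := by
  intro hs
  obtain ⟨s', t, k, hexec, hbdd, ht, hpost⟩ := h hs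
  exact ⟨s', t, k, hexec, hbdd, ht, hQ _ _ hpost⟩

theorem wp_frame {B : ℕ} {P : Prog} {s : State} {Q Q' : State → ℕ → Prop} (h : wp B P s Q)
    (hQ : ∀ s' k, Q s' k → (∀ r, r ∉ P.writes → s'.reg r = s.reg r) →
      (P.storeFree = true → s'.mem = s.mem) → Q' s' k) : wp B P s Q' := by
  intro hs
  obtain ⟨s', t, k, hexec, hbdd, ht, hpost⟩ := h hs
  exact ⟨s', t, k, hexec, hbdd, ht, hQ _ _ hpost (fun _ hr => hexec.reg_eq hr) hexec.mem_eq⟩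

theorem Bdd.size_reg_le {B : ℕ} {s : State} (hs : Bdd B s) (i : ℕ) : Nat.size (s.reg i) ≤ B :=
  Nat.size_le.2 (hs.1 i)

theorem Bdd.size_mem_le {B : ℕ} {s : State} (hs : Bdd B s) (i : ℕ) : Nat.size (s.mem i) ≤ B :=
  Nat.size_le.2 (hs.2 i)

theorem Bdd.setReg {B : ℕ} {s : State} (hs : Bdd B s) {i v : ℕ} (hv : v < 2 ^ B) :
    Bdd B (s.setReg i v) := by
  refine ⟨fun j => ?_, hs.2⟩
  rw [State.reg_setReg]
  split_ifs
  · exact hv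
  · exact hs.1 j

theorem Bdd.setMem {B : ℕ} {s : State} (hs : Bdd B s) {i v : ℕ} (hv : v < 2 ^ B) :
    Bdd B (s.setMem i v) := by
  refine ⟨hs.1, fun j => ?_⟩
  rw [State.mem_setMem]
  split_ifs
  · exact hv
  · exact hs.2 j

/-- The condition under which the result of an operation on numbers of at most `B` bits has at most
`B` bits. -/
def Op.Fits (B : ℕ) : Op → ℕ → ℕ → Prop
  | .add, x, y => x + y < 2 ^ B
  | .mul, x, y => x * y < 2 ^ B
  | .sub, _, _ => True
  | .div, _, _ => True

theorem Op.eval_lt {B : ℕ} {o : Op} {x y : ℕ} (hx : x < 2 ^ B) (h : o.Fits B x y) :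
    o.eval x y < 2 ^ B := by
  cases o with
  | add => exact h
  | mul => exact h
  | sub => exact (Nat.sub_le _ _).trans_lt hx
  | div => exact (Nat.div_le_self _ _).trans_lt hx

/-- The verification condition of a program, a sufficient condition for `wp` by recursion on the
program down to its loops. -/
def vc (B : ℕ) : Prog → State → (State → ℕ → Prop) → Prop
  | .skip, s, Q => Q s 1
  | .const i c, s, Q => c < 2 ^ B ∧ Q (s.setReg i c) 1
  | .op o i j l, s, Q =>
    o.Fits B (s.reg j) (s.reg l) ∧ Q (s.setReg i (o.eval (s.reg j) (s.reg l))) 1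
  | .load i j, s, Q => Q (s.setReg i (s.mem (s.reg j))) 1
  | .store i j, s, Q => Q (s.setMem (s.reg i) (s.reg j)) 1
  | .seq P R, s, Q => vc B P s fun s₁ k₁ => vc B R s₁ fun s₂ k₂ => Q s₂ (k₁ + k₂)
  | .ifLt i j P R, s, Q =>
    if s.reg i < s.reg j then vc B P s fun s' k => Q s' (1 + k)
    else vc B R s fun s' k => Q s' (1 + k)
  | .whileLt i j P, s, Q => wp B (.whileLt i j P) s Q

theorem wp_seq {B : ℕ} {P R : Prog} {s : State} {Q : State → ℕ → Prop}
    (h : wp B P s fun s₁ k₁ => wp B R s₁ fun s₂ k₂ => Q s₂ (k₁ + k₂)) : wp B (.seq P R) s Q := by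
  intro hs
  obtain ⟨s₁, t₁, k₁, hexec₁, hbdd₁, ht₁, h₁⟩ := h hs
  obtain ⟨s₂, t₂, k₂, hexec₂, hbdd₂, ht₂, h₂⟩ := h₁ hbdd₁
  exact ⟨s₂, _, _, .seq hexec₁ hexec₂, hbdd₂, by rw [add_mul]; omega, h₂⟩

theorem wp_whileLt_of_lt {B i j : ℕ} {P : Prog} {s : State} {Q : State → ℕ → Prop}
    (hlt : s.reg i < s.reg j)
    (h : wp B P s fun s₁ k₁ => wp B (.whileLt i j P) s₁ fun s₂ k₂ => Q s₂ (1 + k₁ + k₂)) :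
    wp B (.whileLt i j P) s Q := by
  intro hs
  obtain ⟨s₁, t₁, k₁, hexec₁, hbdd₁, ht₁, h₁⟩ := h hs
  obtain ⟨s₂, t₂, k₂, hexec₂, hbdd₂, ht₂, h₂⟩ := h₁ hbdd₁
  have hi := hs.size_reg_le i
  have hj := hs.size_reg_le j
  exact ⟨s₂, _, _, .whileTrue hlt hexec₁ hexec₂, hbdd₂, by rw [add_mul, add_mul]; omega, h₂⟩

theorem wp_whileLt_of_not_lt {B i j : ℕ} {P : Prog} {s : State} {Q : State → ℕ → Prop}
    (hlt : ¬ s.reg i < s.reg j) (h : Q s 1) : wp B (.whileLt i j P) s Q := by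
  intro hs
  have hi := hs.size_reg_le i
  have hj := hs.size_reg_le j
  exact ⟨s, _, 1, .whileFalse hlt, hs, by omega, h⟩

theorem wp_of_vc {B : ℕ} {P : Prog} {s : State} {Q : State → ℕ → Prop} (h : vc B P s Q) :
    wp B P s Q := by
  induction P generalizing s Q with
  | skip => exact fun hs => ⟨s, _, 1, .skip s, hs, by omega, h⟩
  | const i c =>
    intro hs
    have hc := Nat.size_le.2 h.1
    exact ⟨_, _, 1, .const s i c, hs.setReg h.1, by omega, h.2⟩
  | op o i j l =>
    intro hs
    have heval := Op.eval_lt (hs.1 j) h.1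
    have hsize := Nat.size_le.2 heval
    have hj := hs.size_reg_le j
    have hl := hs.size_reg_le l
    exact ⟨_, _, 1, .op s o i j l, hs.setReg heval, by omega, h.2⟩
  | load i j =>
    intro hs
    have hj := hs.size_reg_le j
    have hmem := hs.size_mem_le (s.reg j)
    exact ⟨_, _, 1, .load s i j, hs.setReg (hs.2 _), by omega, h⟩
  | store i j =>
    intro hs
    have hi := hs.size_reg_le i
    have hj := hs.size_reg_le j
    exact ⟨_, _, 1, .store s i j, hs.setMem (hs.1 _), by omega, h⟩
  | seq P R ihP ihR => exact wp_seq (wp_mono (ihP h) fun s' k h' => ihR h')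
  | ifLt i j P R ihP ihR =>
    intro hs
    have hi := hs.size_reg_le i
    have hj := hs.size_reg_le j
    simp only [vc] at h
    split_ifs at h with hlt
    · obtain ⟨s', t, k, hexec, hbdd, ht, hpost⟩ := ihP h hs
      exact ⟨s', _, 1 + k, .ifTrue hlt hexec, hbdd, by rw [add_mul]; omega, hpost⟩
    · obtain ⟨s', t, k, hexec, hbdd, ht, hpost⟩ := ihR h hs
      exact ⟨s', _, 1 + k, .ifFalse hlt hexec, hbdd, by rw [add_mul]; omega, hpost⟩
  | whileLt i j P _ => exact h

infixr:60 ";;" => Prog.seq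

/-- The loop that runs `P` with register `i` counting up to the content of register `j`. It relies
on the convention, observed by all programs below, that register `4` holds `1`. -/
abbrev Prog.countTo (i j : ℕ) (P : Prog) : Prog := .whileLt i j (P ;; .op .add i i 4)

/-- The states that agree with `s₀` in everything that a loop with body `P` and counter `i` leaves
alone. -/
structure LoopFrame (P : Prog) (i : ℕ) (s₀ s : State) : Prop where
  reg_eq_of_notMem : ∀ r, r ∉ P.writes → r ≠ i → s.reg r = s₀.reg r
  mem_eq_of_storeFree : P.storeFree = true → s.mem = s₀.mem

namespace LoopFrame

variable {P : Prog} {i : ℕ} {s₀ s s' : State}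

theorem refl (P : Prog) (i : ℕ) (s₀ : State) : LoopFrame P i s₀ s₀ :=
  ⟨fun _ _ _ => rfl, fun _ => rfl⟩

theorem reg_eq (h : LoopFrame P i s₀ s) (r : ℕ) (hr : r ∉ P.writes := by decide)
    (hri : r ≠ i := by decide) : s.reg r = s₀.reg r :=
  h.reg_eq_of_notMem r hr hri

theorem mem_eq (h : LoopFrame P i s₀ s) (hP : P.storeFree = true := by decide) : s.mem = s₀.mem :=
  h.mem_eq_of_storeFree hP

theorem setReg (h : LoopFrame P i s₀ s) (hreg : ∀ r, r ∉ P.writes → s'.reg r = s.reg r)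
    (hmem : P.storeFree = true → s'.mem = s.mem) (x : ℕ) : LoopFrame P i s₀ (s'.setReg i x) :=
  ⟨fun r hr hri => by rw [State.reg_setReg, if_neg hri, hreg r hr, h.reg_eq r hr hri],
    fun hP => by rw [State.mem_setReg, hmem hP, h.mem_eq hP]⟩

end LoopFrame

theorem wp_countTo {B i j c : ℕ} {P : Prog} {s₀ : State} (Inv : ℕ → State → Prop)
    (h4 : s₀.reg 4 = 1) (hzero : s₀.reg i = 0) (h₀ : Inv 0 s₀)
    (step : ∀ x < s₀.reg j, ∀ s, LoopFrame P i s₀ s → s.reg i = x → Inv x s →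
      wp B P s fun s' k => k ≤ c ∧ Inv (x + 1) (s'.setReg i (x + 1)))
    (hi : i ∉ P.writes := by decide) (hj : j ∉ P.writes := by decide)
    (hw4 : 4 ∉ P.writes := by decide) (hji : j ≠ i := by decide) (h4i : 4 ≠ i := by decide) :
    wp B (.countTo i j P) s₀ fun s' k =>
      Inv (s₀.reg j) s' ∧ LoopFrame P i s₀ s' ∧ k ≤ s₀.reg j * (c + 2) + 1 := by
  suffices H : ∀ d x s, x + d = s₀.reg j → LoopFrame P i s₀ s → s.reg i = x → Inv x s →
      wp B (.countTo i j P) s fun s' k =>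
        Inv (s₀.reg j) s' ∧ LoopFrame P i s₀ s' ∧ k ≤ d * (c + 2) + 1 from
    H _ 0 s₀ (zero_add _) (.refl P i s₀) hzero h₀
  intro d
  induction d with
  | zero =>
    intro x s hx hframe hsi hinv
    have hsj := hframe.reg_eq j hj hji
    refine wp_whileLt_of_not_lt (by omega) ⟨?_, hframe, by omega⟩
    rwa [← hx, add_zero]
  | succ d ih =>
    intro x s hx hframe hsi hinv hs
    have hsj := hframe.reg_eq j hj hji
    refine wp_whileLt_of_lt (by omega) (wp_seq ?_) hs
    refine wp_frame (step x (by omega) s hframe hsi hinv) ?_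
    rintro s₁ k₁ ⟨hk₁, hinv₁⟩ hreg hmem
    have hcounter : s₁.reg i + s₁.reg 4 = x + 1 := by
      rw [hreg i hi, hreg 4 hw4, hframe.reg_eq 4 hw4 h4i, h4, hsi]
    have hfits : x + 1 < 2 ^ B := lt_of_le_of_lt (by omega) (hs.1 j)
    refine wp_of_vc ⟨by rwa [Op.Fits, hcounter], ?_⟩
    rw [Op.eval, hcounter]
    refine wp_mono (ih (x + 1) _ (by omega) (hframe.setReg hreg hmem _) (by simp) hinv₁) ?_
    rintro s₂ k₂ ⟨hinv₂, hframe₂, hk₂⟩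
    exact ⟨hinv₂, hframe₂, by rw [add_mul]; omega⟩

end RAM

/-! ### The program for the cycle length

The parts of the program share the registers `0` (the number `n` of vertices), `1` (the precision
`k`), `4` (the constant `1`), `5` (the constant `0`), `6` (the length `m`), `20` (`n ^ 2`), `21`
(twice the number of edges), `28` (the number of labelled cycles) and `40` (the constant `2`).
-/

namespace RAM

/-- One step of the summation of the exponential series at the content of register `10`: register
`11` holds the numerator of the partial sum, register `12` the power, register `13` the factorial
and register `14` the index. -/
def taylorBody : Prog :=
  .op .add 15 14 4 ;; .op .mul 11 11 15 ;; .op .mul 12 12 10 ;; .op .add 11 11 12 ;;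
  .op .mul 13 13 15

theorem taylorNum_le (M T : ℕ) : taylorNum M T ≤ (M + T + 1) ^ T := by
  induction T with
  | zero => simp [taylorNum]
  | succ T ih =>
    have hmono : (M + T + 1) ^ T ≤ (M + (T + 1) + 1) ^ T := Nat.pow_le_pow_left (by omega) T
    have hpow : M ^ T ≤ (M + (T + 1) + 1) ^ T := Nat.pow_le_pow_left (by omega) T
    rw [taylorNum, pow_succ, pow_succ]
    calc taylorNum M T * (T + 1) + M ^ T * M
        ≤ (M + (T + 1) + 1) ^ T * (T + 1) + (M + (T + 1) + 1) ^ T * M := by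
          gcongr
          exact ih.trans hmono
      _ ≤ (M + (T + 1) + 1) ^ T * (M + (T + 1) + 1) := by
          rw [← mul_add]
          exact Nat.mul_le_mul_left _ (by omega)

theorem wp_taylor {B n M : ℕ} {s : State} (h0 : s.reg 0 = n) (h4 : s.reg 4 = 1)
    (h10 : s.reg 10 = M) (h11 : s.reg 11 = 1) (h12 : s.reg 12 = 1) (h13 : s.reg 13 = 1)
    (h14 : s.reg 14 = 0) (hB : (M + n + 1) ^ n < 2 ^ B) :
    wp B (.countTo 14 0 taylorBody) s fun s' k =>
      (s'.reg 11 = taylorNum M n ∧ s'.reg 13 = n.factorial) ∧ k ≤ n * 7 + 1 := by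
  refine wp_mono (wp_countTo (c := 5) (fun x s => s.reg 11 = taylorNum M x ∧ s.reg 12 = M ^ x ∧
    s.reg 13 = x.factorial) h4 h14 ⟨h11, by simpa using h12, by simpa using h13⟩ ?_) ?_
  · intro x hx s' hframe hsi ⟨i11, i12, i13⟩
    rw [h0] at hx
    have i4 : s'.reg 4 = 1 := by rw [hframe.reg_eq 4, h4]
    have i10 : s'.reg 10 = M := by rw [hframe.reg_eq 10, h10]
    have hbase : (M + (x + 1) + 1) ^ (x + 1) ≤ (M + n + 1) ^ n :=
      (Nat.pow_le_pow_left (by omega) _).trans (Nat.pow_le_pow_right (by omega) hx)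
    have hnum : taylorNum M (x + 1) < 2 ^ B := ((taylorNum_le M (x + 1)).trans hbase).trans_lt hB
    have hpow : M ^ (x + 1) < 2 ^ B :=
      ((Nat.pow_le_pow_left (by omega) _).trans hbase).trans_lt hB
    have hfact : (x + 1).factorial < 2 ^ B :=
      ((Nat.factorial_le_pow _).trans ((Nat.pow_le_pow_left (by omega) _).trans hbase)).trans_lt hB
    have hindex : x + 1 < 2 ^ B := (Nat.self_le_factorial _).trans_lt hfact
    rw [taylorNum, pow_succ] at hnum
    rw [pow_succ] at hpow
    rw [Nat.factorial_succ] at hfact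
    have hprod : taylorNum M x * (x + 1) < 2 ^ B := by omega
    apply wp_of_vc
    simp [taylorBody, vc, Op.Fits, Op.eval, i4, i10, hsi, i11, i12, i13, hnum, hpow, hfact, hindex,
      hprod, pow_succ, taylorNum, Nat.factorial_succ, mul_comm x.factorial]
  · rintro s' k ⟨⟨h11', -, h13'⟩, -, hk⟩
    rw [h0] at h11' h13' hk
    exact ⟨⟨h11', h13'⟩, hk⟩

/-- Replace the number `m` in register `6` by `m + 1` if the partial sum of the exponential series
at `(m + 1) ^ 4` is at most `n`. -/
def searchBody : Prog :=
  .op .add 9 6 4 ;; .op .mul 10 9 9 ;; .op .mul 10 10 10 ;; .const 11 1 ;; .const 12 1 ;;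
  .const 13 1 ;; .const 14 0 ;; .countTo 14 0 taylorBody ;;
  .op .mul 16 0 13 ;; .ifLt 16 11 .skip (.op .add 6 9 5)

/-- Compute the cycle length in register `6`. -/
def searchProg : Prog :=
  .const 6 0 ;; .const 17 0 ;; .countTo 17 0 searchBody

/-- The content of register `6` after `y` steps of the search. -/
def searchLen (n : ℕ) : ℕ → ℕ
  | 0 => 0
  | y + 1 => if n * n.factorial < taylorNum ((searchLen n y + 1) ^ 4) n then searchLen n y
    else searchLen n y + 1

theorem searchLen_le (n y : ℕ) : searchLen n y ≤ y := by
  induction y with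
  | zero => simp [searchLen]
  | succ y ih => rw [searchLen]; split_ifs <;> omega

theorem searchLen_eq_min {n L : ℕ} (hle : ∀ j ≤ L, taylorNum (j ^ 4) n ≤ n * n.factorial)
    (hlt : n * n.factorial < taylorNum ((L + 1) ^ 4) n) (y : ℕ) : searchLen n y = min y L := by
  induction y with
  | zero => simp [searchLen]
  | succ y ih =>
    rw [searchLen, ih]
    rcases lt_or_ge y L with hy | hy
    · rw [min_eq_left hy.le, min_eq_left (by omega : y + 1 ≤ L), if_neg]
      exact not_lt.2 (hle _ (by omega))
    · rw [min_eq_right hy, min_eq_right (by omega : L ≤ y + 1), if_pos hlt]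

theorem eventually_searchLen_eq : ∀ᶠ n : ℕ in atTop, searchLen n n = cycleLength n := by
  filter_upwards [eventually_lt_taylorNum, eventually_ge_atTop 1] with n hlt hn
  rw [searchLen_eq_min (fun j hj => taylorNum_le_of_le_cycleLength hn hj) hlt, min_eq_right]
  have hpow : (cycleLength n : ℝ) ≤ (cycleLength n : ℝ) ^ 4 := by
    exact_mod_cast Nat.le_self_pow (by norm_num) (cycleLength n)
  have hcast : (cycleLength n : ℝ) ≤ n := by
    linarith [Real.add_one_le_exp ((cycleLength n : ℝ) ^ 4), exp_cycleLength_le hn]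
  exact_mod_cast hcast

theorem wp_searchBody {B n m : ℕ} {s : State} (h0 : s.reg 0 = n) (h4 : s.reg 4 = 1)
    (h5 : s.reg 5 = 0) (h6 : s.reg 6 = m) (hm : m < n)
    (hB : ((n + 1) ^ 4 + n + 1) ^ (n + 1) < 2 ^ B) :
    wp B searchBody s fun s' k => k ≤ n * 7 + 11 ∧
      s'.reg 6 = if n * n.factorial < taylorNum ((m + 1) ^ 4) n then m else m + 1 := by
  have hone : 1 < 2 ^ B := (Nat.one_le_pow _ _ (by omega)).trans_lt hB
  have hfourth : (m + 1) ^ 4 ≤ (n + 1) ^ 4 := Nat.pow_le_pow_left (by omega) 4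
  have hbase : (n + 1) ^ 4 + n + 1 < 2 ^ B := (Nat.le_self_pow (by omega) _).trans_lt hB
  have hsq_sq : (m + 1) * (m + 1) * ((m + 1) * (m + 1)) = (m + 1) ^ 4 := by ring
  have hsq : (m + 1) * (m + 1) ≤ (m + 1) ^ 4 := by
    rw [← hsq_sq]
    exact Nat.le_mul_of_pos_right _ (by positivity)
  have hfact : n * n.factorial < 2 ^ B := by
    refine lt_of_le_of_lt ?_ hB
    rw [pow_succ, mul_comm]
    gcongr
    · exact (Nat.factorial_le_pow n).trans (Nat.pow_le_pow_left (by omega) n)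
    · omega
  apply wp_of_vc
  simp only [searchBody, vc, Op.Fits, Op.eval, State.reg_setReg, h4, h6, hone,
    zero_lt_one.trans hone, true_and, Nat.reduceEqDiff, if_true, if_false, hsq_sq]
  refine ⟨by omega, by omega, by omega, ?_⟩
  refine wp_frame (wp_taylor (n := n) (M := (m + 1) ^ 4) (by simpa using h0) (by simpa using h4)
    (by simp) (by simp) (by simp) (by simp) (by simp) ?_) ?_
  · exact ((Nat.pow_le_pow_left (by omega) _).trans
      (Nat.pow_le_pow_right (by omega) (by omega))).trans_lt hB
  · rintro s' k ⟨⟨h11, h13⟩, hk⟩ hreg -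
    have h0' : s'.reg 0 = n := by rw [hreg 0 (by decide)]; simp [h0]
    have h5' : s'.reg 5 = 0 := by rw [hreg 5 (by decide)]; simp [h5]
    have h6' : s'.reg 6 = m := by rw [hreg 6 (by decide)]; simp [h6]
    have h9' : s'.reg 9 = m + 1 := by rw [hreg 9 (by decide)]; simp
    refine ⟨by rwa [h0', h13], ?_⟩
    simp only [h0', h11, h13]
    split_ifs
    · exact ⟨by omega, h6'⟩
    · simp only [h9', h5']
      exact ⟨by omega, by omega, by simp⟩

theorem wp_search {B n : ℕ} {s : State} (h0 : s.reg 0 = n) (h4 : s.reg 4 = 1) (h5 : s.reg 5 = 0)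
    (hB : ((n + 1) ^ 4 + n + 1) ^ (n + 1) < 2 ^ B) :
    wp B searchProg s fun s' k => s'.reg 6 = searchLen n n ∧ k ≤ n * (n * 7 + 13) + 3 := by
  have hpos : 0 < 2 ^ B := by positivity
  apply wp_of_vc
  simp only [searchProg, vc, hpos, true_and]
  refine wp_mono (wp_countTo (c := n * 7 + 11) (fun y s => s.reg 6 = searchLen n y)
    (by simp [h4]) (by simp) (by simp [searchLen]) ?_) ?_
  · intro y hy s' hframe _ i6
    refine wp_mono (wp_searchBody (by rw [hframe.reg_eq 0]; simp [h0])
      (by rw [hframe.reg_eq 4]; simp [h4]) (by rw [hframe.reg_eq 5]; simp [h5]) i6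
      ((searchLen_le n y).trans_lt (by simpa [h0] using hy)) hB) ?_
    rintro s'' k ⟨hk, h6⟩
    exact ⟨hk, by simpa [searchLen] using h6⟩
  · rintro s' k ⟨h6, -, hk⟩
    simp only [State.reg_setReg, OfNat.zero_ne_ofNat, if_false, h0] at h6 hk
    exact ⟨h6, by simp only [add_assoc, Nat.reduceAdd] at hk; omega⟩

end RAM

/-! ### The programs for the edges, the powers and the root -/

namespace RAM

/-- Add up the first `n ^ 2` array cells in register `21`. -/
def edgeProg : Prog :=
  .op .mul 20 0 0 ;; .const 21 0 ;; .const 22 0 ;; .countTo 22 20 (.load 23 22 ;; .op .add 21 21 23)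

theorem wp_edge {B n : ℕ} {s : State} (h0 : s.reg 0 = n) (h4 : s.reg 4 = 1)
    (hmem : ∀ i, s.mem i ≤ 1) (hB : n * n < 2 ^ B) :
    wp B edgeProg s fun s' k => (s'.reg 20 = n * n ∧
      s'.reg 21 = ∑ i ∈ Finset.range (n * n), s.mem i) ∧ k ≤ n * n * 4 + 4 := by
  have hpos : 0 < 2 ^ B := by positivity
  apply wp_of_vc
  simp only [edgeProg, vc, Op.Fits, Op.eval, h0, hB, hpos, true_and]
  refine wp_mono (wp_countTo (c := 2) (fun x s' => s'.reg 21 = ∑ i ∈ Finset.range x, s.mem i)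
    (by simp [h4]) (by simp) (by simp) ?_) ?_
  · intro x hx s' hframe hsi h21
    have hmem' : s'.mem = s.mem := hframe.mem_eq
    have hsum : ∑ i ∈ Finset.range x, s.mem i + s.mem x < 2 ^ B := by
      rw [← Finset.sum_range_succ]
      refine lt_of_le_of_lt ((Finset.sum_le_sum fun i _ => hmem i).trans ?_) hB
      simpa using hx
    apply wp_of_vc
    simp [vc, Op.Fits, Op.eval, hsi, h21, hmem', hsum, Finset.sum_range_succ]
  · rintro s' k ⟨h21, hframe, hk⟩
    have h20 : s'.reg 20 = n * n := by rw [hframe.reg_eq 20]; simp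
    simp only [State.reg_setReg, Nat.reduceEqDiff, if_true, if_false] at h21 hk
    exact ⟨⟨h20, h21⟩, by omega⟩

theorem wp_mulLoop {B i j r q : ℕ} {s : State} (h4 : s.reg 4 = 1) (hi : s.reg i = 0)
    (hB : s.reg r * s.reg q ^ s.reg j < 2 ^ B) (hri : r ≠ i := by decide)
    (hji : j ≠ i := by decide) (hqi : q ≠ i := by decide) (h4i : 4 ≠ i := by decide)
    (hjr : j ≠ r := by decide) (hqr : q ≠ r := by decide) (h4r : 4 ≠ r := by decide) :
    wp B (.countTo i j (.op .mul r r q)) s fun s' k =>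
      s'.reg r = s.reg r * s.reg q ^ s.reg j ∧ (∀ l, l ≠ r → l ≠ i → s'.reg l = s.reg l) ∧
        k ≤ s.reg j * 3 + 1 := by
  intro hs
  have hfits : ∀ x ≤ s.reg j, s.reg r * s.reg q ^ x < 2 ^ B := by
    intro x hx
    rcases Nat.eq_zero_or_pos (s.reg q) with hq | hq
    · refine lt_of_le_of_lt ?_ (hs.1 r)
      rw [hq]
      exact mul_le_of_le_one_right (Nat.zero_le _) (zero_pow_le_one x)
    · exact (Nat.mul_le_mul_left _ (Nat.pow_le_pow_right hq hx)).trans_lt hB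
  refine wp_mono (wp_countTo (c := 1) (fun x s' => s'.reg r = s.reg r * s.reg q ^ x) h4 hi
    (by simp) ?_ (by simpa [Prog.writes] using hri.symm) (by simpa [Prog.writes] using hjr)
    (by simpa [Prog.writes] using h4r) hji h4i) ?_ hs
  · intro x hx s' hframe _ hr
    have hq : s'.reg q = s.reg q := hframe.reg_eq q (by simpa [Prog.writes] using hqr) hqi
    have hnext := hfits (x + 1) hx
    rw [pow_succ] at hnext
    apply wp_of_vc
    simp [vc, Op.Fits, Op.eval, hr, hq, hnext, hri, pow_succ, mul_assoc]
  · rintro s' k ⟨hr, hframe, hk⟩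
    exact ⟨hr, fun l hl hli => hframe.reg_eq l (by simpa [Prog.writes] using hl) hli, by omega⟩

/-- Compute `2 ^ k`, `n ^ m`, the `m`-th power of register `21`, and `2 ^ (k m)`. -/
def powProg : Prog :=
  .const 41 1 ;; .const 42 0 ;; .countTo 42 1 (.op .mul 41 41 40) ;;
  .const 43 1 ;; .const 42 0 ;; .countTo 42 6 (.op .mul 43 43 0) ;;
  .const 44 1 ;; .const 42 0 ;; .countTo 42 6 (.op .mul 44 44 21) ;;
  .const 45 1 ;; .const 42 0 ;; .countTo 42 6 (.op .mul 45 45 41)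

theorem wp_pow {B n m k E : ℕ} {s : State} (h0 : s.reg 0 = n) (h1 : s.reg 1 = k)
    (h4 : s.reg 4 = 1) (h6 : s.reg 6 = m) (h21 : s.reg 21 = E) (h40 : s.reg 40 = 2)
    (hk : 2 ^ k < 2 ^ B) (hn : n ^ m < 2 ^ B) (hE : E ^ m < 2 ^ B) (hkm : (2 ^ k) ^ m < 2 ^ B) :
    wp B powProg s fun s' t => (s'.reg 41 = 2 ^ k ∧ s'.reg 43 = n ^ m ∧
      s'.reg 44 = E ^ m ∧ s'.reg 45 = (2 ^ k) ^ m) ∧ t ≤ k * 3 + m * 9 + 12 := by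
  intro hs
  have htwo : 2 < 2 ^ B := h40 ▸ hs.1 40
  have hone : 1 < 2 ^ B := by omega
  refine wp_of_vc ?_ hs
  simp only [powProg, vc, Nat.two_pow_pos, hone, true_and]
  refine wp_mono (wp_mulLoop (by simp [h4]) (by simp) (by simpa [h1, h40])) ?_
  rintro s₁ k₁ ⟨g41, hreg₁, hk₁⟩
  simp only [State.reg_setReg, Nat.reduceEqDiff, if_true, if_false, h1, h40, one_mul,
    OfNat.one_ne_ofNat] at g41 hreg₁ hk₁
  refine wp_mono (wp_mulLoop (by simp [hreg₁, h4]) (by simp) (by simpa [hreg₁, h0, h6])) ?_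
  rintro s₂ k₂ ⟨g43, hreg₂, hk₂⟩
  refine wp_mono (wp_mulLoop (by simp [hreg₂, hreg₁, h4]) (by simp)
    (by simpa [hreg₂, hreg₁, h21, h6])) ?_
  rintro s₃ k₃ ⟨g44, hreg₃, hk₃⟩
  refine wp_mono (wp_mulLoop (by simp [hreg₃, hreg₂, hreg₁, h4]) (by simp)
    (by simpa [hreg₃, hreg₂, hreg₁, g41, h6])) ?_
  rintro s₄ k₄ ⟨g45, hreg₄, hk₄⟩
  have h6₁ : s₁.reg 6 = m := by simp [hreg₁, h6]
  have h6₂ : s₂.reg 6 = m := by simp [hreg₂, h6₁]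
  have h6₃ : s₃.reg 6 = m := by simp [hreg₃, h6₂]
  have h0₁ : s₁.reg 0 = n := by simp [hreg₁, h0]
  have h21₂ : s₂.reg 21 = E := by simp [hreg₂, hreg₁, h21]
  have h41₃ : s₃.reg 41 = 2 ^ k := by simp [hreg₃, hreg₂, g41]
  simp only [State.reg_setReg, Nat.reduceEqDiff, if_true, if_false, one_mul, OfNat.zero_ne_ofNat,
    h6₁, h6₂, h6₃, h0₁, h21₂, h41₃] at g43 g44 g45 hk₂ hk₃ hk₄
  exact ⟨⟨by simp [hreg₄, h41₃], by simp [hreg₄, hreg₃, g43], by simp [hreg₄, g44], g45⟩,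
    by omega⟩

/-- One step of the bisection, which maintains in the registers `49` and `50` bounds for a root of
the number in register `48`. -/
def bisectBody : Prog :=
  .op .add 53 49 4 ;; .ifLt 53 50
    (.op .add 54 49 50 ;; .op .div 54 54 40 ;; .op .add 55 43 5 ;; .const 56 0 ;;
      .countTo 56 6 (.op .mul 55 55 54) ;;
      .ifLt 48 55 (.op .add 50 54 5) (.op .add 49 54 5))
    .skip

/-- From the number of labelled cycles in register `28` and the powers, approximate the root and
move the results to their registers. -/
def rootProg : Prog :=
  .op .mul 47 28 43 ;; .op .sub 47 47 44 ;; .op .mul 48 47 45 ;; .const 49 0 ;;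
  .op .mul 50 47 41 ;; .op .add 50 50 4 ;; .op .add 51 20 20 ;; .op .add 51 51 1 ;;
  .const 52 0 ;; .countTo 52 51 bisectBody ;;
  .op .add 2 49 5 ;; .op .add 3 41 5 ;; .op .add 1 0 5 ;; .op .add 0 21 5

/-- The invariant of the bisection: `lo` and `hi` enclose the `m`-th root of `X / D` after `x` steps
of a bisection that started with `0` and `H + 1`. -/
structure Encloses (D X m H x lo hi : ℕ) : Prop where
  lt : lo < hi
  le : hi ≤ H + 1
  width : (hi - lo - 1) * 2 ^ x ≤ H
  bounds : 1 ≤ m → 1 ≤ D → D * lo ^ m ≤ X ∧ X < D * hi ^ m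

namespace Encloses

variable {D X m H x lo hi : ℕ}

theorem initial (D A K m : ℕ) :
    Encloses D (A * K ^ m) m (A * K) 0 0 (A * K + 1) where
  lt := by simp
  le := le_rfl
  width := by simp
  bounds hm hD := by
    refine ⟨by simp [show m ≠ 0 by omega], lt_of_lt_of_le ?_ (Nat.le_mul_of_pos_left _ hD)⟩
    calc A * K ^ m ≤ A ^ m * K ^ m := Nat.mul_le_mul_right _ (Nat.le_self_pow (by omega) _)
      _ = (A * K) ^ m := by rw [mul_pow]
      _ < (A * K + 1) ^ m := Nat.pow_lt_pow_left (by omega) (by omega)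

theorem mid (h : Encloses D X m H x lo hi) (hlt : lo + 1 < hi) :
    if X < D * ((lo + hi) / 2) ^ m then Encloses D X m H (x + 1) lo ((lo + hi) / 2)
    else Encloses D X m H (x + 1) ((lo + hi) / 2) hi := by
  have hle := h.le
  have hwidth : ∀ w, 2 * w ≤ hi - lo - 1 → w * 2 ^ (x + 1) ≤ H := by
    intro w hw
    calc w * 2 ^ (x + 1) = 2 * w * 2 ^ x := by rw [pow_succ]; ring
      _ ≤ (hi - lo - 1) * 2 ^ x := Nat.mul_le_mul_right _ hw
      _ ≤ H := h.width
  split_ifs with hX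
  · exact ⟨by omega, by omega, hwidth _ (by omega), fun hm hD => ⟨(h.bounds hm hD).1, hX⟩⟩
  · exact ⟨by omega, by omega, hwidth _ (by omega),
      fun hm hD => ⟨not_lt.1 hX, (h.bounds hm hD).2⟩⟩

theorem succ_of_not_lt (h : Encloses D X m H x lo hi) (hlt : ¬ lo + 1 < hi) :
    Encloses D X m H (x + 1) lo hi :=
  ⟨h.lt, h.le, by simp [show hi - lo - 1 = 0 by omega], h.bounds⟩

theorem eq_add_one (h : Encloses D X m H x lo hi) (hH : H < 2 ^ x) : hi = lo + 1 := by
  have hlt := h.lt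
  by_contra hne
  have hwidth := (Nat.mul_le_mul_right (2 ^ x) (by omega : 1 ≤ hi - lo - 1)).trans h.width
  omega

end Encloses

theorem wp_bisect {B D X m H x lo hi : ℕ} {s : State} (h4 : s.reg 4 = 1) (h5 : s.reg 5 = 0)
    (h6 : s.reg 6 = m) (h40 : s.reg 40 = 2) (h43 : s.reg 43 = D) (h48 : s.reg 48 = X)
    (h49 : s.reg 49 = lo) (h50 : s.reg 50 = hi) (henc : Encloses D X m H x lo hi)
    (hB : 2 * (H + 1) < 2 ^ B) (hpow : D * (H + 1) ^ m < 2 ^ B) :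
    wp B bisectBody s fun s' k => k ≤ m * 3 + 9 ∧
      Encloses D X m H (x + 1) (s'.reg 49) (s'.reg 50) := by
  intro hs
  have hD : D < 2 ^ B := h43 ▸ hs.1 43
  have hlt := henc.lt
  have hle := henc.le
  refine wp_of_vc ?_ hs
  simp only [bisectBody, vc, Op.Fits, Op.eval, State.reg_setReg, Nat.reduceEqDiff, if_true,
    if_false, h49, h50, h4, h40, h43, h5, add_zero, hD, Nat.two_pow_pos, true_and]
  refine ⟨by omega, ?_⟩
  split_ifs with hgap
  · have hmid : (lo + hi) / 2 ≤ H + 1 := by omega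
    refine ⟨by omega, ?_⟩
    refine wp_mono (wp_mulLoop (by simp [h4]) (by simp) ?_) ?_
    · simpa [h6] using (Nat.mul_le_mul_left D (Nat.pow_le_pow_left hmid m)).trans_lt hpow
    rintro s' k ⟨h55, hreg, hk⟩
    have henc' := henc.mid hgap
    simp only [State.reg_setReg, Nat.reduceEqDiff, if_true, if_false, h6] at h55 hk
    simp only [h55, hreg, State.reg_setReg, Nat.reduceEqDiff, ne_eq, not_false_eq_true, if_true,
      if_false, h48, h49, h50, h5, add_zero]
    split_ifs with hX
    · exact ⟨by omega, by omega, by simpa [hX] using henc'⟩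
    · exact ⟨by omega, by omega, by simpa [hX] using henc'⟩
  · exact ⟨by omega, by simpa [h49, h50] using henc.succ_of_not_lt hgap⟩

theorem wp_root {B W k m c D F K : ℕ} {s : State} (h1 : s.reg 1 = k) (h4 : s.reg 4 = 1)
    (h5 : s.reg 5 = 0) (h6 : s.reg 6 = m) (h20 : s.reg 20 = W) (h28 : s.reg 28 = c)
    (h40 : s.reg 40 = 2) (h41 : s.reg 41 = K) (h43 : s.reg 43 = D) (h44 : s.reg 44 = F)
    (h45 : s.reg 45 = K ^ m) (hsteps : W + W + k < 2 ^ B) (hcD : c * D < 2 ^ B)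
    (hX : (c * D - F) * K ^ m < 2 ^ B) (hH : 2 * ((c * D - F) * K + 1) < 2 ^ B)
    (hpow : D * ((c * D - F) * K + 1) ^ m < 2 ^ B) :
    wp B rootProg s fun s' t =>
      (s'.reg 0 = s.reg 21 ∧ s'.reg 1 = s.reg 0 ∧ s'.reg 3 = K ∧
        (1 ≤ m → 1 ≤ D → (c * D - F) * K < 2 ^ (W + W + k) →
          D * s'.reg 2 ^ m ≤ (c * D - F) * K ^ m ∧
          (c * D - F) * K ^ m < D * (s'.reg 2 + 1) ^ m)) ∧
      t ≤ (W + W + k) * (m * 3 + 11) + 20 := by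
  intro hs
  have hE := hs.1 21
  have hn := hs.1 0
  have hKB : K < 2 ^ B := h41 ▸ hs.1 41
  set A := c * D - F with hA
  refine wp_of_vc ?_ hs
  simp only [rootProg, vc, Op.Fits, Op.eval, State.reg_setReg, Nat.reduceEqDiff, if_true,
    if_false, OfNat.one_ne_ofNat, h1, h4, h20, h28, h41, h43, h44, h45, Nat.two_pow_pos, true_and,
    ← hA]
  refine ⟨hcD, hX, by omega, by omega, by omega, hsteps, ?_⟩
  refine wp_mono (wp_countTo (c := m * 3 + 9) (fun x s' =>
    Encloses D (A * K ^ m) m (A * K) x (s'.reg 49) (s'.reg 50)) (by simp [h4]) (by simp)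
    (by simpa using Encloses.initial D A K m) ?_) ?_
  · intro x _ s' hframe _ henc
    refine wp_mono (wp_bisect (s := s') (by rw [hframe.reg_eq 4]; simp [h4])
      (by rw [hframe.reg_eq 5]; simp [h5]) (by rw [hframe.reg_eq 6]; simp [h6])
      (by rw [hframe.reg_eq 40]; simp [h40]) (by rw [hframe.reg_eq 43]; simp [h43])
      (by rw [hframe.reg_eq 48]; simp) rfl rfl henc hH hpow) ?_
    rintro s'' t ⟨ht, henc'⟩
    exact ⟨ht, by simpa using henc'⟩
  · rintro s' t ⟨henc, hframe, ht⟩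
    simp only [State.reg_setReg, Nat.reduceEqDiff, if_true, if_false, Nat.reduceAdd,
      add_assoc (m * 3)] at henc ht
    have h0' : s'.reg 0 = s.reg 0 := by rw [hframe.reg_eq 0]; simp
    have h5' : s'.reg 5 = 0 := by rw [hframe.reg_eq 5]; simp [h5]
    have h21' : s'.reg 21 = s.reg 21 := by rw [hframe.reg_eq 21]; simp
    have h41' : s'.reg 41 = K := by rw [hframe.reg_eq 41]; simp [h41]
    have hlo := henc.lt
    have hhi := henc.le
    simp only [h0', h5', h21', h41', add_zero]
    refine ⟨by omega, hKB, hn, hE, ⟨trivial, trivial, trivial, fun hm hD hw => ?_⟩, by omega⟩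
    have hbounds := henc.bounds hm hD
    rwa [henc.eq_add_one hw] at hbounds

end RAM

/-! ### The depth first search for cycles -/

/-- The list of the `f u` with `u < v` and `p u`, for decreasing `u`. -/
def listBelow {α : Type*} (p : ℕ → Prop) [DecidablePred p] (f : ℕ → α) (v : ℕ) : List α :=
  (((List.range v).filter (p ·)).map f).reverse

section listBelow

variable {α : Type*} (p : ℕ → Prop) [DecidablePred p] (f : ℕ → α)

theorem listBelow_zero : listBelow p f 0 = [] := rfl

theorem listBelow_succ (v : ℕ) :
    listBelow p f (v + 1) = if p v then f v :: listBelow p f v else listBelow p f v := by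
  unfold listBelow
  split_ifs with hv <;> simp [List.range_succ, hv]

theorem length_listBelow_le (v : ℕ) : (listBelow p f v).length ≤ v := by
  simpa [listBelow] using List.length_filter_le (p ·) (List.range v)

theorem mem_listBelow {v : ℕ} {x : α} : x ∈ listBelow p f v ↔ ∃ u < v, p u ∧ f u = x := by
  simp [listBelow, and_assoc]

theorem sum_map_listBelow (g : α → ℕ) (v : ℕ) :
    ((listBelow p f v).map g).sum = ∑ u ∈ Finset.range v, if p u then g (f u) else 0 := by
  induction v with
  | zero => rfl
  | succ v ih =>
    rw [listBelow_succ, Finset.sum_range_succ, ← ih]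
    split_ifs
    · rw [List.map_cons, List.sum_cons, add_comm]
    · rw [add_zero]

end listBelow

theorem mul_add_lt_mul_self {n u v : ℕ} (hu : u < n) (hv : v < n) : u * n + v < n * n :=
  calc u * n + v < u * n + n := by omega
    _ = (u + 1) * n := by ring
    _ ≤ n * n := Nat.mul_le_mul_right _ hu

namespace RAM

/-- A self-avoiding walk, given by its ends, the set of its vertices as a bit mask, and the number
of its vertices. -/
structure Node where
  first : ℕ
  last : ℕ
  mask : ℕ
  len : ℕ

namespace Node

/-- The walk that consists of the vertex `u`. -/
def single (u : ℕ) : Node := ⟨u, u, 2 ^ u, 1⟩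

/-- The walk `w` can be continued to the vertex `v`. -/
abbrev CanVisit (adj : ℕ → ℕ → ℕ) (w : Node) (v : ℕ) : Prop :=
  w.mask.testBit v = false ∧ 0 < adj w.last v

/-- The continuation of the walk `w` to the vertex `v`. -/
def snoc (w : Node) (v : ℕ) : Node := ⟨w.first, v, w.mask + 2 ^ v, w.len + 1⟩

/-- The bounds on a walk in a graph on `n` vertices that the search relies on. -/
structure Valid (n : ℕ) (w : Node) : Prop where
  first : w.first < n
  last : w.last < n
  mask : w.mask ≤ w.len * 2 ^ n

theorem valid_single {n u : ℕ} (hu : u < n) : (single u).Valid n :=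
  ⟨hu, hu, by simpa [single] using Nat.pow_le_pow_right two_pos hu.le⟩

theorem Valid.snoc {n v : ℕ} {w : Node} (hw : w.Valid n) (hv : v < n) : (w.snoc v).Valid n := by
  refine ⟨hw.first, hv, ?_⟩
  simp only [Node.snoc, add_mul, one_mul]
  exact add_le_add hw.mask (Nat.pow_le_pow_right two_pos hv.le)

/-- The sum of the weights `h` of the two ends over all continuations of `w` by `r` vertices. -/
def walkSum (n : ℕ) (adj h : ℕ → ℕ → ℕ) : ℕ → Node → ℕ
  | 0, w => h w.first w.last
  | r + 1, w => ∑ v ∈ Finset.range n, if w.CanVisit adj v then walkSum n adj h r (w.snoc v) else 0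

/-- The number of continuations of `w` by at most `r` vertices. -/
def walkSize (n : ℕ) (adj : ℕ → ℕ → ℕ) (r : ℕ) (w : Node) : ℕ :=
  ∑ j ∈ Finset.range (r + 1), walkSum n adj (fun _ _ => 1) j w

theorem walkSize_zero (n : ℕ) (adj : ℕ → ℕ → ℕ) (w : Node) : walkSize n adj 0 w = 1 := by
  simp [walkSize, walkSum]

theorem walkSize_succ (n : ℕ) (adj : ℕ → ℕ → ℕ) (r : ℕ) (w : Node) :
    walkSize n adj (r + 1) w = 1 + ∑ v ∈ Finset.range n,
      if w.CanVisit adj v then walkSize n adj r (w.snoc v) else 0 := by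
  rw [walkSize, Finset.sum_range_succ', add_comm]
  congr 1
  simp only [walkSum]
  rw [Finset.sum_comm]
  refine Finset.sum_congr rfl fun v _ => ?_
  split_ifs
  · rfl
  · exact Finset.sum_const_zero

theorem walkSize_pos (n : ℕ) (adj : ℕ → ℕ → ℕ) (r : ℕ) (w : Node) : 0 < walkSize n adj r w := by
  cases r with
  | zero => rw [walkSize_zero]; exact one_pos
  | succ r => rw [walkSize_succ]; omega

end Node

/-- The array holds the given stack, top first, from the address `base` on. -/
def StackAt (mem : ℕ → ℕ) (base : ℕ) : List Node → Prop
  | [] => True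
  | w :: st => mem (base + 4 * st.length) = w.first ∧ mem (base + 4 * st.length + 1) = w.last ∧
      mem (base + 4 * st.length + 2) = w.mask ∧ mem (base + 4 * st.length + 3) = w.len ∧
      StackAt mem base st

theorem StackAt.congr {mem mem' : ℕ → ℕ} {base : ℕ} {st : List Node} (hst : StackAt mem base st)
    (h : ∀ i < base + 4 * st.length, mem' i = mem i) : StackAt mem' base st := by
  induction st with
  | nil => trivial
  | cons w st ih =>
    simp only [List.length_cons] at h
    obtain ⟨hfirst, hlast, hmask, hlen, hst⟩ := hst
    refine ⟨?_, ?_, ?_, ?_, ih hst fun i hi => h i (by omega)⟩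
    · rw [h _ (by omega), hfirst]
    · rw [h _ (by omega), hlast]
    · rw [h _ (by omega), hmask]
    · rw [h _ (by omega), hlen]

/-- The array of `s` holds a stack from the address `base` on, with register `24` as the stack
pointer, and agrees with `mem₀` below that address. -/
structure HoldsStack (base : ℕ) (mem₀ : ℕ → ℕ) (st : List Node) (s : State) : Prop where
  pointer : s.reg 24 = base + 4 * st.length
  stack : StackAt s.mem base st
  mem_eq : ∀ i < base, s.mem i = mem₀ i

theorem HoldsStack.congr {base : ℕ} {mem₀ : ℕ → ℕ} {st : List Node} {s s' : State}
    (h : HoldsStack base mem₀ st s) (hreg : s'.reg 24 = s.reg 24) (hmem : s'.mem = s.mem) :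
    HoldsStack base mem₀ st s' :=
  ⟨hreg ▸ h.pointer, hmem ▸ h.stack, hmem ▸ h.mem_eq⟩

/-- Push the walk whose four components are in the given registers. -/
def push (a b c d : ℕ) : Prog :=
  .store 24 a ;; .op .add 24 24 4 ;; .store 24 b ;; .op .add 24 24 4 ;;
  .store 24 c ;; .op .add 24 24 4 ;; .store 24 d ;; .op .add 24 24 4

theorem vc_push {B base a b c d : ℕ} {mem₀ : ℕ → ℕ} {s : State} {st : List Node}
    {Q : State → ℕ → Prop} (w : Node) (h : HoldsStack base mem₀ st s) (h4 : s.reg 4 = 1)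
    (ha : s.reg a = w.first) (hb : s.reg b = w.last) (hc : s.reg c = w.mask) (hd : s.reg d = w.len)
    (hB : base + 4 * (st.length + 1) < 2 ^ B)
    (hQ : ∀ s', HoldsStack base mem₀ (w :: st) s' → (∀ r ≠ 24, s'.reg r = s.reg r) → Q s' 8)
    (hb' : b ≠ 24 := by decide) (hc' : c ≠ 24 := by decide) (hd' : d ≠ 24 := by decide) :
    vc B (push a b c d) s Q := by
  obtain ⟨h24, hst, hmem⟩ := h
  simp only [push, vc, Op.Fits, Op.eval, State.reg_setReg, State.reg_setMem, Nat.reduceEqDiff,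
    if_true, if_false, hb', hc', hd', h24, h4, ha, hb, hc, hd]
  refine ⟨by omega, by omega, by omega, by omega, hQ _ ⟨?_, ?_, ?_⟩ ?_⟩
  · simp only [State.reg_setReg, if_true, List.length_cons]
    omega
  · simp only [StackAt, State.mem_setReg, State.mem_setMem]
    refine ⟨?_, ?_, ?_, by simp, hst.congr fun i hi => ?_⟩
    · split_ifs <;> first | rfl | omega
    · split_ifs <;> first | rfl | omega
    · split_ifs <;> first | rfl | omega
    · simp only [State.mem_setReg, State.mem_setMem]
      split_ifs <;> first | rfl | omega
  · intro i hi
    rw [← hmem i hi]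
    simp only [State.mem_setReg, State.mem_setMem]
    split_ifs <;> first | rfl | omega
  · intro r hr
    simp [hr]

/-- Push all walks that consist of one vertex. -/
def rootsProg : Prog :=
  .op .add 24 20 5 ;; .const 25 1 ;; .const 26 0 ;;
  .countTo 26 0 (push 26 26 25 4 ;; .op .add 25 25 25)

theorem wp_roots {B n : ℕ} {s : State} (h0 : s.reg 0 = n) (h4 : s.reg 4 = 1) (h5 : s.reg 5 = 0)
    (h20 : s.reg 20 = n * n) (hB : n * n + 4 * (n + 1) < 2 ^ B) (hB' : 2 ^ n < 2 ^ B) :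
    wp B rootsProg s fun s' k =>
      HoldsStack (n * n) s.mem (listBelow (fun _ => True) .single n) s' ∧ k ≤ n * 11 + 4 := by
  apply wp_of_vc
  simp only [rootsProg, vc, Op.Fits, Op.eval, h20, h5, add_zero, Nat.two_pow_pos, true_and]
  refine ⟨by omega, by omega, ?_⟩
  refine wp_mono (wp_countTo (c := 9) (fun v s' =>
    HoldsStack (n * n) s.mem (listBelow (fun _ => True) .single v) s' ∧ s'.reg 25 = 2 ^ v)
    (by simp [h4]) (by simp) ⟨⟨by simp [listBelow_zero], trivial, by simp⟩, by simp⟩ ?_) ?_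
  · rintro v hv s' hframe hsi ⟨hstack, h25⟩
    replace hv : v < n := by simpa [h0] using hv
    have h4' : s'.reg 4 = 1 := by rw [hframe.reg_eq 4]; simp [h4]
    have hdouble : 2 ^ v + 2 ^ v = 2 ^ (v + 1) := by rw [pow_succ]; ring
    have hfits : 2 ^ (v + 1) < 2 ^ B := (Nat.pow_le_pow_right two_pos hv).trans_lt hB'
    have hlen := length_listBelow_le (fun _ => True) Node.single v
    apply wp_of_vc
    simp only [vc]
    refine vc_push (.single v) hstack h4' hsi hsi h25 h4' (by omega) fun s'' hstack' hreg => ?_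
    rw [Op.Fits, Op.eval, hreg 25 (by decide), h25, hdouble]
    refine ⟨hfits, by omega, ?_, by simp⟩
    rw [listBelow_succ, if_pos trivial]
    exact hstack'.congr (by simp) rfl
  · rintro s' k ⟨⟨hstack, -⟩, -, hk⟩
    simp only [State.reg_setReg, OfNat.zero_ne_ofNat, if_false, h0] at hstack hk
    exact ⟨hstack, by omega⟩

/-- Push the continuation of the current walk to the vertex in register `36`, if it is one. -/
def expandBody : Prog :=
  .op .add 37 34 36 ;; .load 37 37 ;; .op .div 38 31 35 ;; .op .div 39 38 40 ;;
  .op .add 39 39 39 ;;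
  .ifLt 39 38 .skip (.ifLt 5 37 (.op .add 57 31 35 ;; push 33 36 57 30) .skip) ;;
  .op .add 35 35 35

theorem wp_expandBody {B n m v : ℕ} {s : State} {mem₀ : ℕ → ℕ} {st : List Node} {w : Node}
    {adj : ℕ → ℕ → ℕ} (h4 : s.reg 4 = 1) (h5 : s.reg 5 = 0) (h40 : s.reg 40 = 2)
    (h30 : s.reg 30 = w.len + 1) (h31 : s.reg 31 = w.mask) (h33 : s.reg 33 = w.first)
    (h34 : s.reg 34 = w.last * n) (h35 : s.reg 35 = 2 ^ v) (h36 : s.reg 36 = v)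
    (hst : HoldsStack (n * n) mem₀ st s) (hw : w.Valid n) (hlen : w.len < m) (hv : v < n)
    (hadj : mem₀ (w.last * n + v) = adj w.last v)
    (hB : n * n + 4 * (st.length + 1) < 2 ^ B) (hB' : (m + 1) * 2 ^ n < 2 ^ B) :
    wp B expandBody s fun s' k => k ≤ 20 ∧
      HoldsStack (n * n) mem₀ (if w.CanVisit adj v then w.snoc v :: st else st) s' ∧
      s'.reg 35 = 2 ^ (v + 1) := by
  have hidx := mul_add_lt_mul_self hw.last hv
  have hcell : s.mem (w.last * n + v) = adj w.last v := by rw [hst.mem_eq _ hidx, hadj]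
  have hpow : 2 ^ (v + 1) ≤ 2 ^ n := Nat.pow_le_pow_right two_pos hv
  have hdouble : 2 ^ v + 2 ^ v = 2 ^ (v + 1) := by rw [pow_succ]; ring
  have hlen' : (w.snoc v).len ≤ m + 1 := by simp only [Node.snoc]; omega
  have hfits : 2 ^ (v + 1) < 2 ^ B := by
    have : 2 ^ n ≤ (m + 1) * 2 ^ n := Nat.le_mul_of_pos_left _ (by omega)
    omega
  have hmask : w.mask + 2 ^ v < 2 ^ B :=
    ((hw.snoc hv).mask.trans (Nat.mul_le_mul_right _ hlen')).trans_lt hB'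
  have hdiv : w.mask / 2 ^ v ≤ w.mask := Nat.div_le_self _ _
  -- `39` is `38` with its last bit cleared
  have hbit : w.mask / 2 ^ v / 2 + w.mask / 2 ^ v / 2 < w.mask / 2 ^ v ↔
      w.mask.testBit v = true := by
    rw [Nat.testBit_eq_decide_div_mod_eq, decide_eq_true_eq]
    omega
  apply wp_of_vc
  simp only [expandBody, vc, Op.Fits, Op.eval, State.reg_setReg, State.mem_setReg,
    Nat.reduceEqDiff, if_true, if_false, true_and, h34, h36, h31, h35, h40, h5, hcell, hbit]
  refine ⟨by omega, by omega, ?_⟩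
  by_cases hvisited : w.mask.testBit v = true
  · rw [if_pos hvisited, if_neg (by simp [hvisited])]
    simp only [hdouble, hfits, true_and]
    exact ⟨by omega, hst.congr (by simp) rfl, by simp⟩
  rw [if_neg hvisited]
  by_cases hnb : 0 < adj w.last v
  · rw [if_pos hnb, if_pos ⟨by simpa using hvisited, hnb⟩]
    refine ⟨hmask, vc_push (w.snoc v) (hst.congr (by simp) rfl) (by simpa using h4)
      (by simpa [Node.snoc] using h33) (by simpa [Node.snoc] using h36) (by simp [Node.snoc])
      (by simpa [Node.snoc] using h30) hB fun s' hst' hreg => ?_⟩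
    have h35' : s'.reg 35 = 2 ^ v := by rw [hreg 35 (by decide)]; simpa using h35
    simp only [h35', hdouble, hfits, true_and]
    exact ⟨by omega, hst'.congr (by simp) rfl, by simp⟩
  · rw [if_neg hnb, if_neg fun hcan => hnb hcan.2]
    simp only [hdouble, hfits, true_and]
    exact ⟨by omega, hst.congr (by simp) rfl, by simp⟩

theorem wp_expand {B n m : ℕ} {s : State} {mem₀ : ℕ → ℕ} {st : List Node} {w : Node}
    {adj : ℕ → ℕ → ℕ} (h0 : s.reg 0 = n) (h4 : s.reg 4 = 1) (h5 : s.reg 5 = 0)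
    (h40 : s.reg 40 = 2) (h30 : s.reg 30 = w.len + 1) (h31 : s.reg 31 = w.mask)
    (h33 : s.reg 33 = w.first) (h34 : s.reg 34 = w.last * n) (h35 : s.reg 35 = 1)
    (h36 : s.reg 36 = 0) (hst : HoldsStack (n * n) mem₀ st s) (hw : w.Valid n) (hlen : w.len < m)
    (hadj : ∀ v < n, mem₀ (w.last * n + v) = adj w.last v)
    (hB : n * n + 4 * (st.length + n) < 2 ^ B) (hB' : (m + 1) * 2 ^ n < 2 ^ B) :
    wp B (.countTo 36 0 expandBody) s fun s' k =>
      HoldsStack (n * n) mem₀ (listBelow (w.CanVisit adj) w.snoc n ++ st) s' ∧ k ≤ n * 22 + 1 := by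
  refine wp_mono (wp_countTo (c := 20) (fun v s' =>
    HoldsStack (n * n) mem₀ (listBelow (w.CanVisit adj) w.snoc v ++ st) s' ∧ s'.reg 35 = 2 ^ v)
    h4 h36 ⟨by simpa [listBelow_zero] using hst, by simp [h35]⟩ ?_) ?_
  · rintro v hv s' hframe hsi ⟨hst', h35'⟩
    replace hv : v < n := by simpa [h0] using hv
    have hlen' := length_listBelow_le (w.CanVisit adj) w.snoc v
    refine wp_mono (wp_expandBody (s := s') (by rw [hframe.reg_eq 4, h4])
      (by rw [hframe.reg_eq 5, h5]) (by rw [hframe.reg_eq 40, h40]) (by rw [hframe.reg_eq 30, h30])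
      (by rw [hframe.reg_eq 31, h31]) (by rw [hframe.reg_eq 33, h33])
      (by rw [hframe.reg_eq 34, h34]) h35' hsi hst' hw hlen hv (hadj v hv)
      (by rw [List.length_append]; omega) hB') ?_
    rintro s'' k ⟨hk, hst'', h35''⟩
    refine ⟨hk, ?_, by simp [h35'']⟩
    rw [listBelow_succ]
    split_ifs at hst'' ⊢ <;> exact hst''.congr (by simp) rfl
  · rintro s' k ⟨⟨hst', -⟩, -, hk⟩
    rw [h0] at hst' hk
    exact ⟨hst', by omega⟩

/-- Replace the walk on top of the stack by its continuations or, when it has full length, add to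
register `28` whether it closes up to a cycle. -/
def dfsBody : Prog :=
  .ifLt 20 24
    (.op .sub 24 24 4 ;; .load 30 24 ;; .op .sub 24 24 4 ;; .load 31 24 ;;
      .op .sub 24 24 4 ;; .load 32 24 ;; .op .sub 24 24 4 ;; .load 33 24 ;; .op .mul 34 32 0 ;;
      .ifLt 30 6
        (.const 35 1 ;; .op .add 30 30 4 ;; .const 36 0 ;; .countTo 36 0 expandBody)
        (.op .add 34 34 33 ;; .load 37 34 ;; .op .add 28 28 37))
    .skip

/-- Count the closed walks that the search finds within `n * n` rounds. -/
def dfsProg : Prog :=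
  rootsProg ;; .const 28 0 ;; .const 29 0 ;; .countTo 29 20 dfsBody

/-- The invariant of the search after `x` rounds, with the stack `st`. -/
structure Search (n m : ℕ) (adj : ℕ → ℕ → ℕ) (total size : ℕ) (mem₀ : ℕ → ℕ) (x : ℕ) (s : State)
    (st : List Node) : Prop where
  holds : HoldsStack (n * n) mem₀ st s
  valid : ∀ w ∈ st, w.Valid n
  length : st.length ≤ n + x * n
  count : s.reg 28 ≤ x
  total : s.reg 28 +
    (st.map fun w => w.walkSum n adj (fun u v => adj v u) (m - w.len)).sum = total
  size : st = [] ∨ x + (st.map fun w => w.walkSize n adj (m - w.len)).sum = size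

section Search

variable {n m x total size : ℕ} {adj : ℕ → ℕ → ℕ} {mem₀ : ℕ → ℕ} {s s' : State} {st : List Node}
  {w : Node}

theorem Search.congr (h : Search n m adj total size mem₀ x s st) (h24 : s'.reg 24 = s.reg 24)
    (h28 : s'.reg 28 = s.reg 28) (hmem : s'.mem = s.mem) :
    Search n m adj total size mem₀ x s' st :=
  ⟨h.holds.congr h24 hmem, h.valid, h.length, h28 ▸ h.count, h28 ▸ h.total, h.size⟩

theorem Search.finished (h : Search n m adj total size mem₀ x s []) :
    Search n m adj total size mem₀ (x + 1) s [] :=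
  ⟨h.holds, h.valid, by simp, h.count.trans x.le_succ, h.total, .inl rfl⟩

theorem Search.expand (h : Search n m adj total size mem₀ x s (w :: st)) (hlen : w.len < m)
    (hst : HoldsStack (n * n) mem₀ (listBelow (w.CanVisit adj) w.snoc n ++ st) s')
    (h28 : s'.reg 28 = s.reg 28) :
    Search n m adj total size mem₀ (x + 1) s'
      (listBelow (w.CanVisit adj) w.snoc n ++ st) := by
  obtain ⟨r, hr, hr'⟩ : ∃ r, m - w.len = r + 1 ∧ m - (w.len + 1) = r :=
    ⟨m - w.len - 1, by omega, by omega⟩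
  have hlength := h.length
  have htotal := h.total
  have hsize := h.size.resolve_left (by simp)
  simp only [List.map_cons, List.sum_cons, List.length_cons, hr] at hlength htotal hsize
  refine ⟨hst, fun w' hw' => ?_, ?_, ?_, ?_, .inr ?_⟩
  · rcases List.mem_append.1 hw' with hw' | hw'
    · obtain ⟨v, hv, -, rfl⟩ := (mem_listBelow _ _).1 hw'
      exact (h.valid w (by simp)).snoc hv
    · exact h.valid w' (by simp [hw'])
  · have := length_listBelow_le (w.CanVisit adj) w.snoc n
    rw [List.length_append, add_mul]
    omega
  · exact h28 ▸ h.count.trans x.le_succ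
  · rw [← htotal, h28, List.map_append, List.sum_append, sum_map_listBelow, Node.walkSum]
    simp only [Node.snoc, hr']
  · rw [← hsize, List.map_append, List.sum_append, sum_map_listBelow, Node.walkSize_succ]
    simp only [Node.snoc, hr']
    ring

theorem Search.close (h : Search n m adj total size mem₀ x s (w :: st)) (hlen : m ≤ w.len)
    (hle : adj w.last w.first ≤ 1) (h24 : s'.reg 24 = s.reg 24 - 4)
    (h28 : s'.reg 28 = s.reg 28 + adj w.last w.first) (hmem : s'.mem = s.mem) :
    Search n m adj total size mem₀ (x + 1) s' st := by
  have hpointer := h.holds.pointer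
  have hlength := h.length
  have hcount := h.count
  have htotal := h.total
  have hsize := h.size.resolve_left (by simp)
  simp only [List.map_cons, List.sum_cons, List.length_cons, Nat.sub_eq_zero_of_le hlen,
    Node.walkSum, Node.walkSize_zero] at hpointer hlength htotal hsize
  refine ⟨⟨by omega, hmem ▸ h.holds.stack.2.2.2.2, hmem ▸ h.holds.mem_eq⟩,
    fun w' hw' => h.valid w' (by simp [hw']), ?_, by omega, by omega, .inr (by omega)⟩
  rw [add_mul]
  omega

end Search

section dfs

variable {B n m : ℕ} {adj : ℕ → ℕ → ℕ} {s : State}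

theorem wp_dfsBody {x total size : ℕ} {mem₀ : ℕ → ℕ} {st : List Node} (h0 : s.reg 0 = n)
    (h4 : s.reg 4 = 1) (h5 : s.reg 5 = 0) (h6 : s.reg 6 = m) (h20 : s.reg 20 = n * n)
    (h40 : s.reg 40 = 2) (hx : x < n * n)
    (hadj : ∀ u < n, ∀ v < n, mem₀ (u * n + v) = adj u v) (hone : ∀ u v, adj u v ≤ 1)
    (hB : n * n + 4 * (n + n * n * n) < 2 ^ B) (hB' : (m + 1) * 2 ^ n < 2 ^ B)
    (hsearch : Search n m adj total size mem₀ x s st) :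
    wp B dfsBody s fun s' k => k ≤ n * 22 + 20 ∧
      ∃ st', Search n m adj total size mem₀ (x + 1) s' st' := by
  have hpointer := hsearch.holds.pointer
  have hlength := hsearch.length
  have hmul : (x + 1) * n ≤ n * n * n := Nat.mul_le_mul_right _ hx
  rw [add_mul, one_mul] at hmul
  apply wp_of_vc
  cases st with
  | nil =>
    simp only [dfsBody, vc, h20, hpointer, List.length_nil, mul_zero, add_zero, lt_irrefl,
      if_false]
    exact ⟨by omega, [], hsearch.finished⟩
  | cons w st =>
    obtain ⟨hfirst, hlast, hmask, hlen, hst⟩ := hsearch.holds.stack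
    have hw := hsearch.valid w (by simp)
    have hidx := mul_add_lt_mul_self hw.last hw.first
    have hcell : s.mem (w.last * n + w.first) = adj w.last w.first := by
      rw [hsearch.holds.mem_eq _ hidx, hadj _ hw.last _ hw.first]
    have hle := hone w.last w.first
    have hcount := hsearch.count
    have hm : m + 1 ≤ (m + 1) * 2 ^ n := Nat.le_mul_of_pos_right _ (by positivity)
    simp only [List.length_cons] at hpointer hlength
    have hpointer' : s.reg 24 = n * n + 4 * st.length + 4 := by omega
    have hlt : n * n < n * n + 4 * st.length + 4 := by omega
    simp only [dfsBody, vc, Op.Fits, Op.eval, State.reg_setReg, State.mem_setReg, Nat.reduceEqDiff,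
      if_true, if_false, true_and, h20, hpointer', h4, h0, h6, hlt, Nat.add_one_sub_one,
      hfirst, hlast, hmask, hlen, hcell, OfNat.zero_ne_ofNat]
    refine ⟨by omega, ?_⟩
    split_ifs with hshort
    · refine ⟨by omega, by omega, by omega, wp_frame (wp_expand (w := w) (adj := adj) (st := st)
        (mem₀ := mem₀) (by simpa using h0) (by simpa using h4) (by simpa using h5)
        (by simpa using h40) (by simp) (by simp) (by simp) (by simp) (by simp) (by simp)
        ⟨by simp, hst, hsearch.holds.mem_eq⟩ hw hshort (hadj _ hw.last) (by omega) hB') ?_⟩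
      rintro s' k ⟨hst', hk⟩ hreg -
      exact ⟨by omega, _, hsearch.expand hshort hst' (by rw [hreg 28 (by decide)]; simp)⟩
    · exact ⟨by omega, by omega, by omega, st, hsearch.close (not_lt.1 hshort) hle
        (by simp; omega) (by simp) rfl⟩

/-- The search may be cut off after `n * n` rounds; its result is meant only if it then finished. -/
theorem wp_dfs (h0 : s.reg 0 = n) (h4 : s.reg 4 = 1) (h5 : s.reg 5 = 0) (h6 : s.reg 6 = m)
    (h20 : s.reg 20 = n * n) (h40 : s.reg 40 = 2)
    (hadj : ∀ u < n, ∀ v < n, s.mem (u * n + v) = adj u v) (hone : ∀ u v, adj u v ≤ 1)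
    (hB : n * n + 4 * (n + n * n * n) + 4 < 2 ^ B) (hB' : (m + 1) * 2 ^ n < 2 ^ B) :
    wp B dfsProg s fun s' k => (s'.reg 28 ≤ n * n ∧
      (∑ v ∈ Finset.range n, (Node.single v).walkSize n adj (m - 1) ≤ n * n →
        s'.reg 28 = ∑ v ∈ Finset.range n,
          (Node.single v).walkSum n adj (fun u v => adj v u) (m - 1))) ∧
      k ≤ n * n * (n * 22 + 22) + n * 11 + 8 := by
  have hm2 : 2 ^ n ≤ (m + 1) * 2 ^ n := Nat.le_mul_of_pos_left _ (by omega)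
  refine wp_seq (wp_frame (wp_roots h0 h4 h5 h20 (by omega) (by omega)) ?_)
  rintro s₁ k₁ ⟨hst, hk₁⟩ hreg -
  apply wp_of_vc
  simp only [vc, Nat.two_pow_pos, true_and]
  refine wp_mono (wp_countTo (c := n * 22 + 20) (fun x s' => ∃ st, Search n m adj
    (∑ v ∈ Finset.range n, (Node.single v).walkSum n adj (fun u v => adj v u) (m - 1))
    (∑ v ∈ Finset.range n, (Node.single v).walkSize n adj (m - 1)) s.mem x s' st)
    (by simpa [hreg 4 (by decide)] using h4) (by simp)
    ⟨_, hst.congr (by simp) rfl, fun w hw => ?_, ?_, by simp, ?_, .inr ?_⟩ ?_) ?_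
  · obtain ⟨v, hv, -, rfl⟩ := (mem_listBelow _ _).1 hw
    exact Node.valid_single hv
  · simpa using length_listBelow_le (fun _ => True) Node.single n
  · simp [sum_map_listBelow, Node.single]
  · simp [sum_map_listBelow, Node.single]
  · rintro x hx s' hframe - ⟨st, hsearch⟩
    have hreg' (r : ℕ) (hr : r ∉ dfsProg.writes) : s'.reg r = s.reg r := by
      simp only [dfsProg, Prog.countTo, Prog.writes, List.mem_append, List.mem_singleton,
        not_or] at hr
      rw [hframe.reg_eq r hr.2.2.2.1 hr.2.2.1, State.reg_setReg, if_neg hr.2.2.1,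
        State.reg_setReg, if_neg hr.2.1, hreg r hr.1]
    refine wp_mono (wp_dfsBody (by rw [hreg' 0 (by decide), h0]) (by rw [hreg' 4 (by decide), h4])
      (by rw [hreg' 5 (by decide), h5]) (by rw [hreg' 6 (by decide), h6])
      (by rw [hreg' 20 (by decide), h20]) (by rw [hreg' 40 (by decide), h40])
      (by simpa [hreg 20 (by decide), h20] using hx) hadj hone (by omega) hB' hsearch) ?_
    rintro s'' k ⟨hk, st', hsearch'⟩
    exact ⟨hk, st', hsearch'.congr (by simp) (by simp) rfl⟩
  · rintro s' k ⟨⟨st, hsearch⟩, -, hk⟩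
    simp only [State.reg_setReg, Nat.reduceEqDiff, if_false, hreg 20 (by decide), h20,
      add_assoc, Nat.reduceAdd] at hsearch hk
    refine ⟨⟨hsearch.count, fun hle => ?_⟩, by omega⟩
    have htotal := hsearch.total
    cases st with
    | nil => simpa using htotal
    | cons w st =>
      have hsize := hsearch.size.resolve_left (by simp)
      have hpos := w.walkSize_pos n adj (m - w.len)
      simp only [List.map_cons, List.sum_cons] at hsize
      omega

end dfs

end RAM

/-! ### The walks that the search enumerates -/

theorem testBit_add_two_pow {x i : ℕ} (h : x.testBit i = false) (j : ℕ) :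
    (x + 2 ^ i).testBit j = (x.testBit j || decide (j = i)) := by
  induction i generalizing x j with
  | zero =>
    simp only [Nat.testBit_zero, decide_eq_false_iff_not] at h
    cases j with
    | zero =>
      simp only [pow_zero, Nat.testBit_zero, decide_true, Bool.or_true, decide_eq_true_eq]
      omega
    | succ j =>
      have hhalf : (x + 1) / 2 = x / 2 := by omega
      simp [Nat.testBit_succ, hhalf]
  | succ i ih =>
    rw [Nat.testBit_succ] at h
    cases j with
    | zero =>
      have hmod : (x + 2 ^ (i + 1)) % 2 = x % 2 := by rw [pow_succ]; omega
      simp [Nat.testBit_zero, hmod]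
    | succ j =>
      have hhalf : (x + 2 ^ (i + 1)) / 2 = x / 2 + 2 ^ i := by rw [pow_succ]; omega
      simp [Nat.testBit_succ, hhalf, ih h]

section Walks

variable {n : ℕ} (G : SimpleGraph (Fin n))

open Classical in
/-- The adjacency matrix of `G`, extended by zero to all pairs of natural numbers. -/
noncomputable def adjNat (u v : ℕ) : ℕ :=
  if ∃ u' v' : Fin n, u' = u ∧ v' = v ∧ G.Adj u' v' then 1 else 0

open Classical in
theorem adjNat_coe (u v : Fin n) : adjNat G u v = if G.Adj u v then 1 else 0 := by
  simp [adjNat, Fin.val_inj]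

theorem adjNat_pos (u v : Fin n) : 0 < adjNat G u v ↔ G.Adj u v := by
  classical
  rw [adjNat_coe]
  split_ifs with h <;> simp [h]

theorem adjNat_le_one (u v : ℕ) : adjNat G u v ≤ 1 := by
  unfold adjNat
  split_ifs <;> simp

/-- The sequence `g` of vertices is a path whose vertices, except for the first one, are not bits
of `μ`. -/
def IsPathAvoiding {r : ℕ} (μ : ℕ) (g : Fin (r + 1) → Fin n) : Prop :=
  (∀ i : Fin r, G.Adj (g i.castSucc) (g i.succ)) ∧ Function.Injective g ∧
    ∀ i : Fin r, μ.testBit (g i.succ) = false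

theorem isPathAvoiding_cons {r μ : ℕ} {l v : Fin n} (hl : μ.testBit l = true)
    (g : Fin r → Fin n) :
    IsPathAvoiding G μ (Fin.cons l (Fin.cons v g : Fin (r + 1) → Fin n) : Fin (r + 2) → Fin n) ↔
      (μ.testBit v = false ∧ G.Adj l v) ∧
        IsPathAvoiding G (μ + 2 ^ (v : ℕ)) (Fin.cons v g : Fin (r + 1) → Fin n) := by
  unfold IsPathAvoiding
  rw [Fin.forall_fin_succ, Fin.forall_fin_succ (P := fun i => μ.testBit _ = false)]
  simp only [Fin.cons_injective_iff, Fin.cons_succ, Fin.castSucc_zero, Fin.cons_zero,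
    ← Fin.succ_castSucc, Set.mem_range, not_exists]
  constructor
  · rintro ⟨⟨hlv, hadj⟩, ⟨-, hvg, hg⟩, hv, havoid⟩
    refine ⟨⟨hv, hlv⟩, hadj, ⟨hvg, hg⟩, fun i => ?_⟩
    rw [testBit_add_two_pow hv, havoid i]
    simpa [Fin.ext_iff] using hvg i
  · rintro ⟨⟨hv, hlv⟩, hadj, ⟨hvg, hg⟩, havoid⟩
    have havoid' (i) : μ.testBit (g i) = false := by
      have := havoid i
      rw [testBit_add_two_pow hv, Bool.or_eq_false_iff] at this
      exact this.1
    refine ⟨⟨hlv, hadj⟩, ⟨Fin.cases ?_ fun j => ?_, hvg, hg⟩, hv, havoid'⟩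
    · rw [Fin.cons_zero]
      exact hlv.ne'
    · rw [Fin.cons_succ]
      intro h
      simpa [h, hl] using havoid' j

theorem isPathAvoiding_two_pow {r : ℕ} (g : Fin (r + 1) → Fin n) :
    IsPathAvoiding G (2 ^ (g 0 : ℕ)) g ↔
      Function.Injective g ∧ ∀ i : Fin r, G.Adj (g i.castSucc) (g i.succ) := by
  refine ⟨fun h => ⟨h.2.1, h.1⟩, fun h => ⟨h.2, h.1, fun i => ?_⟩⟩
  refine Nat.testBit_two_pow_of_ne fun he => ?_
  exact Fin.succ_ne_zero i (h.1 (Fin.ext he)).symm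

open Classical in
theorem walkSum_eq_sum_isPathAvoiding (h : ℕ → ℕ → ℕ) (r : ℕ) {w : RAM.Node} {l : Fin n}
    (hlast : w.last = l) (hl : w.mask.testBit l = true) :
    w.walkSum n (adjNat G) h r = ∑ g : Fin r → Fin n,
      if IsPathAvoiding G w.mask (Fin.cons l g : Fin (r + 1) → Fin n) then
        h w.first ((Fin.cons l g : Fin (r + 1) → Fin n) (Fin.last r)) else 0 := by
  induction r generalizing w l with
  | zero =>
    rw [Fintype.sum_unique, if_pos, RAM.Node.walkSum, hlast]
    · rfl
    · exact ⟨fun i => i.elim0, fun i j _ => Fin.ext (by omega), fun i => i.elim0⟩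
  | succ r ih =>
    rw [RAM.Node.walkSum, Finset.sum_range,
      ← (Fin.consEquiv fun _ : Fin (r + 1) => Fin n).sum_comp, Fintype.sum_prod_type]
    refine Finset.sum_congr rfl fun v _ => ?_
    have hcons (g : Fin r → Fin n) : (Fin.consEquiv fun _ : Fin (r + 1) => Fin n) (v, g) =
      (Fin.cons v g : Fin (r + 1) → Fin n) := rfl
    simp only [hcons, isPathAvoiding_cons G hl, RAM.Node.CanVisit, hlast, adjNat_pos]
    split_ifs with hv
    · rw [ih (w := w.snoc v) rfl (by simp [RAM.Node.snoc, testBit_add_two_pow hv.1])]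
      refine Finset.sum_congr rfl fun g _ => ?_
      simp only [RAM.Node.snoc, hv, true_and, and_true, ← Fin.succ_last, Fin.cons_succ]
      congr
    · simp only [hv, false_and, if_false, Finset.sum_const_zero]

open Classical in
theorem sum_walkSum_single (h : ℕ → ℕ → ℕ) (r : ℕ) :
    ∑ v ∈ Finset.range n, (RAM.Node.single v).walkSum n (adjNat G) h r =
      ∑ g : Fin (r + 1) ↪ Fin n, if ∀ i : Fin r, G.Adj (g i.castSucc) (g i.succ) then
        h (g 0) (g (Fin.last r)) else 0 := by
  have hsingle (v : Fin n) : (RAM.Node.single v).walkSum n (adjNat G) h r =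
      ∑ g : Fin r → Fin n,
        if IsPathAvoiding G (2 ^ (v : ℕ)) (Fin.cons v g : Fin (r + 1) → Fin n) then
          h v ((Fin.cons v g : Fin (r + 1) → Fin n) (Fin.last r)) else 0 :=
    walkSum_eq_sum_isPathAvoiding G h r rfl Nat.testBit_two_pow_self
  simp only [Finset.sum_range, hsingle]
  rw [← Fintype.sum_prod_type', ← (Fin.consEquiv fun _ : Fin (r + 1) => Fin n).symm.sum_comp]
  simp only [Fin.consEquiv_symm_apply, Fin.cons_self_tail, isPathAvoiding_two_pow, ite_and]
  rw [← (Equiv.subtypeInjectiveEquivEmbedding (Fin (r + 1)) (Fin n)).sum_comp, ← Finset.sum_filter,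
    Finset.sum_subtype _ (p := Function.Injective) (by simp)]
  rfl

theorem map_pathGraph_le_iff {r : ℕ} {V : Type*} {g : Fin (r + 1) ↪ V} {G : SimpleGraph V} :
    (SimpleGraph.pathGraph (r + 1)).map g ≤ G ↔
      ∀ i : Fin r, G.Adj (g i.castSucc) (g i.succ) := by
  rw [SimpleGraph.map_le_iff_le_comap]
  refine ⟨fun h i => h (SimpleGraph.pathGraph_adj.2 (.inl rfl)), fun h i j hij => ?_⟩
  have hstep {i j : Fin (r + 1)} (hij : i.val + 1 = j.val) : G.Adj (g i) (g j) := by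
    have hj : (⟨i, by omega⟩ : Fin r).succ = j := Fin.ext hij
    exact hj ▸ h ⟨i, by omega⟩
  rcases SimpleGraph.pathGraph_adj.1 hij with hij | hij
  · exact hstep hij
  · exact (hstep hij).symm

theorem sum_walkSum_single_one (r : ℕ) :
    ∑ v ∈ Finset.range n, (RAM.Node.single v).walkSum n (adjNat G) (fun _ _ => 1) r =
      G.labelledCopyCount (SimpleGraph.pathGraph (r + 1)) := by
  classical
  simp only [sum_walkSum_single, labelledCopyCount_eq_sum_embedding, map_pathGraph_le_iff]

theorem sum_walkSize_single (r : ℕ) :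
    ∑ v ∈ Finset.range n, (RAM.Node.single v).walkSize n (adjNat G) r =
      ∑ j ∈ Finset.range (r + 1), G.labelledCopyCount (SimpleGraph.pathGraph (j + 1)) := by
  simp only [RAM.Node.walkSize, ← sum_walkSum_single_one]
  exact Finset.sum_comm

theorem sum_walkSum_single_adjNat {m : ℕ} (hm : 2 ≤ m) :
    ∑ v ∈ Finset.range n,
      (RAM.Node.single v).walkSum n (adjNat G) (fun u v => adjNat G v u) (m - 1) =
      G.labelledCopyCount (SimpleGraph.cycleGraph m) := by
  classical
  obtain ⟨r, rfl⟩ : ∃ r, m = r + 1 := ⟨m - 1, by omega⟩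
  have : NeZero (r + 1) := ⟨by omega⟩
  simp only [Nat.add_sub_cancel, sum_walkSum_single, labelledCopyCount_eq_sum_embedding,
    map_cycleGraph_le_iff hm, adjNat_coe, ← ite_and]
  refine Finset.sum_congr rfl fun g _ => ?_
  congr 1
  rw [Fin.forall_fin_succ']
  simp [Fin.coeSucc_eq_succ]

end Walks

section WalkSize

variable {a b : ℝ}

theorem le_ncard_edgeSet_pathGraph (r : ℕ) :
    r ≤ (SimpleGraph.pathGraph (r + 1)).edgeSet.ncard := by
  have h := (SimpleGraph.pathGraph_connected r).card_vert_le_card_edgeSet_add_one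
  rw [Nat.card_fin, Nat.card_coe_set_eq] at h
  omega

theorem ssbmExp_labelledCopyCount_pathGraph_le {n : ℕ} (hn : 0 < n) (hb : 0 ≤ b) (hba : b ≤ a)
    (han : a ≤ n) (r : ℕ) :
    ssbmExp n 2 (a / n) (b / n) (fun G => (G.labelledCopyCount (SimpleGraph.pathGraph (r + 1)) : ℝ))
      ≤ n * a ^ r := by
  have hn' : (0 : ℝ) < n := by exact_mod_cast hn
  have ha : 0 ≤ a := hb.trans hba
  have hba' : b / n ≤ a / n := by gcongr
  have hn₀ : ∀ _i : Fin 2, (0 : ℝ) ≤ 1 / (2 : ℕ) := fun _ => by positivity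
  have hw₀ := ssbmWeight_nonneg (k := 2) (A := a / n) (B := b / n) (by positivity) (by positivity)
  have hdens := (homDensity_le_pow hn₀ (sum_uniform_eq_one 2) hw₀ (ssbmWeight_le le_rfl hba')
    (SimpleGraph.pathGraph (r + 1))).trans
    (pow_le_pow_of_le_one (by positivity) (div_le_one_of_le₀ han hn'.le)
      (le_ncard_edgeSet_pathGraph r))
  rw [ssbmExp, sbmExp_labelledCopyCount (sum_uniform_eq_one 2)
    (SimpleGraph.pathGraph (r + 1)), Fintype.card_fin]
  calc _ ≤ (n : ℝ) ^ (r + 1) * (a / n) ^ r := 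
        mul_le_mul (by exact_mod_cast Nat.descFactorial_le_pow n (r + 1)) hdens
          (homDensity_nonneg hn₀ hw₀ _) (by positivity)
    _ = n * a ^ r := by rw [div_pow]; field

theorem mul_pow_le_mul_add_one_pow (m : ℕ) (ha : 0 ≤ a) : m * a ^ m ≤ (a * (m + 1)) ^ m := by
  rcases m.eq_zero_or_pos with rfl | hm
  · simp
  · rw [mul_pow, mul_comm]
    gcongr
    exact_mod_cast (Nat.le_succ m).trans (Nat.le_self_pow hm.ne' _)

theorem whp_sum_walkSize_le (hb : 0 ≤ b) (hba : b ≤ a) (ha : 1 ≤ a) :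
    WHP a b fun n G => 3 ≤ cycleLength n →
      ∑ v ∈ Finset.range n, (RAM.Node.single v).walkSize n (adjNat G) (cycleLength n - 1) ≤
        n * n := by
  have ha₀ : 0 ≤ a := hb.trans hba
  refine whp_of_tendsto_ssbmExp ha₀ hb (F := fun n => ((n : ℝ) ^ 2)⁻¹ •
    ∑ j ∈ Finset.range (cycleLength n),
      fun G => (G.labelledCopyCount (SimpleGraph.pathGraph (j + 1)) : ℝ))
    (fun n G => ?_) ?_ ?_
  · simp only [Pi.zero_apply, Pi.smul_apply, Finset.sum_apply, smul_eq_mul]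
    positivity
  · filter_upwards [eventually_gt_atTop 0] with n _ G hG
    obtain ⟨_, hsize⟩ := Classical.not_imp.1 hG
    rw [sum_walkSize_single, Nat.sub_add_cancel (by omega), not_le, ← sq] at hsize
    simp only [Pi.smul_apply, Finset.sum_apply, smul_eq_mul]
    rw [le_inv_mul_iff₀ (by positivity), mul_one]
    exact_mod_cast hsize.le
  · refine squeeze_zero' ?_ ?_ (tendsto_pow_cycleLength_div a ha₀ 1)
    · filter_upwards [eventually_monotone_ssbmExp 2 ha₀ hb] with n hmono
      rw [← map_zero (ssbmExp n 2 (a / n) (b / n))]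
      refine hmono fun G => ?_
      simp only [Pi.zero_apply, Pi.smul_apply, Finset.sum_apply, smul_eq_mul]
      positivity
    · filter_upwards [eventually_gt_atTop 0, eventually_ge_atTop ⌈a⌉₊] with n hn han
      rw [map_smul, map_sum, smul_eq_mul]
      calc _ ≤ ((n : ℝ) ^ 2)⁻¹ * ∑ _j ∈ Finset.range (cycleLength n), n * a ^ cycleLength n := by
            gcongr with j hj
            refine (ssbmExp_labelledCopyCount_pathGraph_le hn hb hba (Nat.ceil_le.1 han) j).trans ?_
            gcongr
            exact (Finset.mem_range.1 hj).le
        _ = cycleLength n * a ^ cycleLength n / n := by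
            rw [Finset.sum_const, Finset.card_range, nsmul_eq_mul]
            field
        _ ≤ _ := by
            rw [pow_one]
            gcongr
            exact mul_pow_le_mul_add_one_pow _ ha₀

end WalkSize

/-! ### The whole program -/

namespace RAM

section Input

variable {n : ℕ} (G : SimpleGraph (Fin n)) (k : ℕ)

theorem input_mem_le_one (i : ℕ) : (input G k).mem i ≤ 1 := by
  classical
  simp only [input]
  split_ifs <;> simp

theorem input_mem_coe (u v : Fin n) : (input G k).mem (u * n + v) = adjNat G u v := by
  classical
  rw [adjNat_coe]
  simp only [input]
  congr 1
  rw [eq_iff_iff]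
  refine ⟨?_, fun h => ⟨u, v, rfl, h⟩⟩
  rintro ⟨u', v', he, h⟩
  have hpair : finProdFinEquiv (u, v) = finProdFinEquiv (u', v') := by
    apply Fin.ext
    simp only [finProdFinEquiv_apply_val]
    linarith
  obtain ⟨rfl, rfl⟩ := Prod.mk.inj (finProdFinEquiv.injective hpair)
  exact h

theorem sum_input_mem : ∑ i ∈ Finset.range (n * n), (input G k).mem i = 2 * G.edgeSet.ncard := by
  classical
  have hmem (z : Fin n × Fin n) : (input G k).mem (finProdFinEquiv z) = adjNat G z.1 z.2 := by
    rw [finProdFinEquiv_apply_val, add_comm, mul_comm, input_mem_coe]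
  rw [Finset.sum_range, ← finProdFinEquiv.sum_comp]
  simp only [hmem, adjNat_coe]
  rw [Fintype.sum_prod_type, Set.ncard_eq_toFinset_card', ← SimpleGraph.edgeFinset,
    ← G.sum_degrees_eq_twice_card_edges]
  simp [SimpleGraph.degree, SimpleGraph.neighborFinset_eq_filter]

theorem two_mul_ncard_edgeSet_le : 2 * G.edgeSet.ncard ≤ n * n := by
  rw [← sum_input_mem G 0]
  exact (Finset.sum_le_sum fun i _ => input_mem_le_one G 0 i).trans (by simp)

end Input

/-- A word length for the computation: for `N ≥ n + k + 2` all numbers in a run on `n` vertices with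
precision `k` have at most this many bits. -/
def wordLength (N : ℕ) : ℕ := 8 * N ^ 3

section WordLength

variable {N n m k e x : ℕ}

theorem lt_two_pow_wordLength (hx : x ≤ 2 ^ e) (he : e < wordLength N) : x < 2 ^ wordLength N :=
  hx.trans_lt (Nat.pow_lt_pow_right (by norm_num) he)

theorem lt_two_pow_wordLength_of_le (hx : x ≤ wordLength N) : x < 2 ^ wordLength N :=
  hx.trans_lt Nat.lt_two_pow_self

theorem pow_le_two_pow_mul (hx : x ≤ 2 ^ e) (hm : m ≤ N) : x ^ m ≤ 2 ^ (e * N) :=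
  calc x ^ m ≤ (2 ^ e) ^ m := Nat.pow_le_pow_left hx m
    _ = 2 ^ (e * m) := by rw [pow_mul]
    _ ≤ 2 ^ (e * N) := Nat.pow_le_pow_right (by norm_num) (Nat.mul_le_mul_left _ hm)

theorem pow_lt_two_pow_wordLength (hN : 1 ≤ N) (hx : x ≤ 2 ^ (7 * N)) (hm : m ≤ N) :
    x ^ m < 2 ^ wordLength N := by
  refine lt_two_pow_wordLength (pow_le_two_pow_mul hx hm) ?_
  rw [wordLength]
  nlinarith [Nat.mul_le_mul_left (N * N) hN, Nat.mul_le_mul hN hN]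

theorem mul_self_le_two_pow (hn : n ≤ N) : n * n ≤ 2 ^ (2 * N) := by
  have hn' : n ≤ 2 ^ N := hn.trans Nat.lt_two_pow_self.le
  rw [two_mul, pow_add]
  exact Nat.mul_le_mul hn' hn'

theorem search_lt_two_pow (hn : n + 2 ≤ N) :
    ((n + 1) ^ 4 + n + 1) ^ (n + 1) < 2 ^ wordLength N := by
  refine pow_lt_two_pow_wordLength (by omega) ?_ (by omega)
  calc (n + 1) ^ 4 + n + 1 ≤ N ^ 4 + N ^ 4 := by
        have h₁ : (n + 1) ^ 4 ≤ N ^ 4 := Nat.pow_le_pow_left (by omega) 4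
        have h₂ : N ≤ N ^ 4 := Nat.le_self_pow (by norm_num) N
        omega
    _ = 2 * N ^ 4 := by ring
    _ ≤ N * N ^ 4 := Nat.mul_le_mul_right _ (by omega)
    _ = N ^ 5 := by ring
    _ ≤ (2 ^ N) ^ 5 := Nat.pow_le_pow_left Nat.lt_two_pow_self.le 5
    _ = 2 ^ (5 * N) := by rw [← pow_mul, mul_comm]
    _ ≤ 2 ^ (7 * N) := Nat.pow_le_pow_right (by norm_num) (by omega)

theorem stack_lt_two_pow (hn : n + 2 ≤ N) :
    n * n + 4 * (n + n * n * n) + 4 < 2 ^ wordLength N := by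
  refine lt_two_pow_wordLength_of_le ?_
  have hcube : (n + 2) ^ 3 ≤ N ^ 3 := Nat.pow_le_pow_left hn 3
  rw [wordLength]
  nlinarith

theorem mul_two_pow_lt_two_pow (hn : n + 2 ≤ N) (hm : m ≤ n) :
    (m + 1) * 2 ^ n < 2 ^ wordLength N := by
  refine lt_two_pow_wordLength (e := N + N) ?_ ?_
  · have hN : N < 2 ^ N := Nat.lt_two_pow_self
    rw [pow_add]
    exact Nat.mul_le_mul (by omega) (Nat.pow_le_pow_right (by norm_num) (by omega))
  · have hcube : N ≤ N ^ 3 := Nat.le_self_pow (by norm_num) N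
    rw [wordLength]
    omega

theorem bisections_lt_two_pow (hN : 1 ≤ N) (hn : n ≤ N) (hk : k ≤ N) :
    n * n + n * n + k < 2 ^ wordLength N := by
  refine lt_two_pow_wordLength_of_le ?_
  rw [wordLength]
  nlinarith [Nat.mul_le_mul hn hn, Nat.mul_le_mul_left (N * N) hN, Nat.mul_le_mul_left N hN]

theorem root_lt_two_pow {X D K : ℕ} (hN : 2 ≤ N) (hX : X ≤ 2 ^ (2 * N + N * N))
    (hD : D ≤ 2 ^ (N * N)) (hK : K ≤ 2 ^ N) (hm : m ≤ N) :
    X * K ^ m < 2 ^ wordLength N ∧ 2 * (X * K + 1) < 2 ^ wordLength N ∧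
      D * (X * K + 1) ^ m < 2 ^ wordLength N := by
  have hsq : 2 * N ≤ N * N := Nat.mul_le_mul_right _ hN
  have hcube : 2 * (N * N) ≤ N ^ 3 := by
    rw [pow_succ, sq, mul_comm]
    exact Nat.mul_le_mul_left _ hN
  have hXK : X * K + 1 ≤ 2 ^ (3 * N + N * N + 1) := by
    have hXK' : X * K ≤ 2 ^ (3 * N + N * N) := by
      refine (Nat.mul_le_mul hX hK).trans_eq ?_
      rw [← pow_add]
      congr 1
      ring
    rw [pow_succ]
    have hone : 1 ≤ 2 ^ (3 * N + N * N) := Nat.one_le_two_pow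
    omega
  refine ⟨lt_two_pow_wordLength (e := (2 * N + N * N) + N * N) ?_ ?_,
    lt_two_pow_wordLength (e := 1 + (3 * N + N * N + 1)) ?_ ?_,
    lt_two_pow_wordLength (e := N * N + (3 * N + N * N + 1) * N) ?_ ?_⟩
  · rw [pow_add _ (2 * N + N * N)]
    exact Nat.mul_le_mul hX (pow_le_two_pow_mul hK hm)
  · rw [wordLength]
    omega
  · rw [pow_add _ 1, pow_one]
    exact Nat.mul_le_mul_left 2 hXK
  · rw [wordLength]
    omega
  · rw [pow_add _ (N * N)]
    exact Nat.mul_le_mul hD (pow_le_two_pow_mul hXK hm)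
  · have hexpand : (3 * N + N * N + 1) * N = 3 * (N * N) + N ^ 3 + N := by ring
    rw [wordLength, hexpand]
    omega

theorem add_mul_self_lt_wordLength (hN : 2 ≤ N) : 2 * N + N * N < wordLength N := by
  have hsq : 2 * N ≤ N * N := Nat.mul_le_mul_right _ hN
  have hcube : 2 * (N * N) ≤ N ^ 3 := by
    rw [pow_succ, sq, mul_comm]
    exact Nat.mul_le_mul_left _ hN
  rw [wordLength]
  omega

end WordLength

theorem bdd_input {n k N : ℕ} (hN : n + k + 2 ≤ N) (G : SimpleGraph (Fin n)) :
    Bdd (wordLength N) (input G k) := by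
  have hword : N ≤ wordLength N := by
    have hcube : N ≤ N ^ 3 := Nat.le_self_pow (by norm_num) N
    rw [wordLength]
    omega
  refine ⟨fun i => lt_two_pow_wordLength_of_le ?_, fun i => lt_two_pow_wordLength_of_le
    ((input_mem_le_one G k i).trans (by omega))⟩
  simp only [input]
  split_ifs <;> omega

/-- The first half of the program, which counts edges and cycles. -/
def countProg : Prog := .const 4 1 ;; .const 40 2 ;; searchProg ;; edgeProg ;; dfsProg

/-- The second half of the program, which computes the estimators from the counts. -/
def estimateProg : Prog := powProg ;; rootProg

/-- A program that calculates the estimators. -/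
def mainProg : Prog := countProg ;; estimateProg

/-- What `countProg` achieves on input `G` and `k`. The number of cycles is only correct if the
search has not been cut off after `n ^ 2` nodes. -/
structure Counted {n : ℕ} (G : SimpleGraph (Fin n)) (k : ℕ) (s : State) : Prop where
  reg_zero : s.reg 0 = n
  reg_one : s.reg 1 = k
  reg_four : s.reg 4 = 1
  reg_five : s.reg 5 = 0
  reg_six : s.reg 6 = searchLen n n
  reg_twenty : s.reg 20 = n * n
  edges : s.reg 21 = 2 * G.edgeSet.ncard
  reg_forty : s.reg 40 = 2
  count_le : s.reg 28 ≤ n * n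
  count_eq : 2 ≤ searchLen n n →
    ∑ v ∈ Finset.range n, (Node.single v).walkSize n (adjNat G) (searchLen n n - 1) ≤ n * n →
    s.reg 28 = G.labelledCopyCount (SimpleGraph.cycleGraph (searchLen n n))

theorem wp_count {n k N : ℕ} (hN : n + k + 2 ≤ N) (G : SimpleGraph (Fin n)) :
    wp (wordLength N) countProg (input G k) fun s t => Counted G k s ∧
      t ≤ n * (n * 7 + 13) + n * n * 4 + n * n * (n * 22 + 22) + n * 11 + 17 := by
  have hn : n + 2 ≤ N := by omega
  have hstack := stack_lt_two_pow hn
  have hword : 2 < 2 ^ wordLength N := lt_two_pow_wordLength_of_le (by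
    rw [wordLength]
    nlinarith [Nat.one_le_pow 3 N (by omega)])
  refine wp_seq (wp_of_vc ⟨by omega, wp_seq (wp_of_vc ⟨hword, ?_⟩)⟩)
  refine wp_seq (wp_frame (wp_search (n := n) (by simp [input]) (by simp) (by simp [input])
    (search_lt_two_pow hn)) ?_)
  rintro s₁ k₁ ⟨g6, hk₁⟩ hreg₁ hmem₁
  have hmem₁' : s₁.mem = (input G k).mem := by rw [hmem₁ (by decide)]; rfl
  refine wp_seq (wp_frame (wp_edge (n := n) (by rw [hreg₁ 0 (by decide)]; simp [input])
    (by rw [hreg₁ 4 (by decide)]; simp) (by simpa [hmem₁'] using input_mem_le_one G k)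
    (by omega)) ?_)
  rintro s₂ k₂ ⟨⟨g20, g21⟩, hk₂⟩ hreg₂ hmem₂
  have hmem₂' : s₂.mem = (input G k).mem := by rw [hmem₂ (by decide), hmem₁']
  rw [hmem₁', sum_input_mem] at g21
  have hreg (r : ℕ) (h₁ : r ∉ searchProg.writes) (h₂ : r ∉ edgeProg.writes) :
    s₂.reg r = (((input G k).setReg 4 1).setReg 40 2).reg r := by rw [hreg₂ r h₂, hreg₁ r h₁]
  have g0 : s₂.reg 0 = n := by rw [hreg 0 (by decide) (by decide)]; simp [input]
  have g1 : s₂.reg 1 = k := by rw [hreg 1 (by decide) (by decide)]; simp [input]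
  have g4 : s₂.reg 4 = 1 := by rw [hreg 4 (by decide) (by decide)]; simp
  have g5 : s₂.reg 5 = 0 := by rw [hreg 5 (by decide) (by decide)]; simp [input]
  have g40 : s₂.reg 40 = 2 := by rw [hreg 40 (by decide) (by decide)]; simp
  rw [← hreg₂ 6 (by decide)] at g6
  refine wp_frame (wp_dfs (adj := adjNat G) g0 g4 g5 g6 g20 g40
    (fun u hu v hv => by rw [hmem₂']; exact input_mem_coe G k ⟨u, hu⟩ ⟨v, hv⟩) (adjNat_le_one G)
    hstack (mul_two_pow_lt_two_pow hn (searchLen_le n n))) ?_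
  rintro s₃ k₃ ⟨⟨hle, hcount⟩, hk₃⟩ hreg₃ -
  refine ⟨?_, by omega⟩
  constructor
  case count_le => exact hle
  case count_eq => exact fun hm hsize => (hcount hsize).trans (sum_walkSum_single_adjNat G hm)
  all_goals rw [hreg₃ _ (by decide)]; assumption

/-- The output of the program on input `G` and `k`, when it has found `c` labelled cycles of length
`m`: the fractions `2 |E| / n` and `reg 2 / 2 ^ k`, where `reg 2` is the integer part of
`2 ^ k * (c - (2 |E| / n) ^ m) ^ (1 / m)`. -/
structure Estimated {n : ℕ} (G : SimpleGraph (Fin n)) (k m c : ℕ) (s : State) : Prop where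
  reg_zero : s.reg 0 = 2 * G.edgeSet.ncard
  reg_one : s.reg 1 = n
  reg_three : s.reg 3 = 2 ^ k
  root : 1 ≤ m →
    n ^ m * s.reg 2 ^ m ≤ (c * n ^ m - (2 * G.edgeSet.ncard) ^ m) * (2 ^ k) ^ m ∧
    (c * n ^ m - (2 * G.edgeSet.ncard) ^ m) * (2 ^ k) ^ m < n ^ m * (s.reg 2 + 1) ^ m

theorem mul_pow_lt_two_pow {n m c : ℕ} (hn : 1 ≤ n) (hm : m ≤ n) (hc : c ≤ n * n) :
    c * n ^ m < 2 ^ (n * n + n * n) := by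
  obtain ⟨j, rfl⟩ : ∃ j, n = j + 1 := ⟨n - 1, by omega⟩
  calc c * (j + 1) ^ m ≤ (j + 1) * (j + 1) * (j + 1) ^ (j + 1) :=
        Nat.mul_le_mul hc (Nat.pow_le_pow_right hn hm)
    _ = (j + 1) ^ (j + 3) := by ring
    _ ≤ (2 ^ j) ^ (j + 3) := Nat.pow_le_pow_left Nat.lt_two_pow_self _
    _ = 2 ^ (j * (j + 3)) := by rw [pow_mul]
    _ < 2 ^ ((j + 1) * (j + 1) + (j + 1) * (j + 1)) :=
        Nat.pow_lt_pow_right (by norm_num) (by nlinarith)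

theorem wp_estimate {n k N : ℕ} {G : SimpleGraph (Fin n)} {s : State} (hN : n + k + 2 ≤ N)
    (h : Counted G k s) :
    wp (wordLength N) estimateProg s fun s' t => Estimated G k (searchLen n n) (s.reg 28) s' ∧
      t ≤ k * 3 + searchLen n n * 9 + (n * n + n * n + k) * (searchLen n n * 3 + 11) + 32 := by
  have hm := searchLen_le n n
  have hsix := h.reg_six
  generalize searchLen n n = m at hm hsix ⊢
  have hword := add_mul_self_lt_wordLength (N := N) (by omega)
  have hnn : n * n ≤ 2 ^ (2 * N) := mul_self_le_two_pow (by omega)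
  have hpow {x : ℕ} (hx : x ≤ 2 ^ (2 * N)) : x ^ m < 2 ^ wordLength N :=
    pow_lt_two_pow_wordLength (by omega)
      (hx.trans (Nat.pow_le_pow_right (by norm_num) (by omega))) (by omega)
  have hkN : 2 ^ k ≤ 2 ^ N := Nat.pow_le_pow_right (by norm_num) (by omega)
  have hD : n ^ m ≤ 2 ^ (N * N) :=
    pow_le_two_pow_mul (Nat.lt_two_pow_self.le.trans (Nat.pow_le_pow_right two_pos (by omega)))
      (by omega)
  have hcD : s.reg 28 * n ^ m ≤ 2 ^ (2 * N + N * N) := by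
    rw [pow_add]
    exact Nat.mul_le_mul (h.count_le.trans hnn) hD
  obtain ⟨hX, hH, hroot⟩ := root_lt_two_pow (m := m) (by omega) ((Nat.sub_le _ _).trans hcD :
    s.reg 28 * n ^ m - (2 * G.edgeSet.ncard) ^ m ≤ _) hD hkN (by omega)
  refine wp_seq (wp_frame (wp_pow h.reg_zero h.reg_one h.reg_four hsix h.edges h.reg_forty
    (lt_two_pow_wordLength hkN (by omega)) (hpow ((Nat.le_mul_self n).trans hnn))
    (hpow ((two_mul_ncard_edgeSet_le G).trans hnn))
    (hpow (Nat.pow_le_pow_right two_pos (by omega)))) ?_)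
  rintro s₁ k₁ ⟨⟨g41, g43, g44, g45⟩, hk₁⟩ hreg -
  refine wp_mono (wp_root (by rw [hreg 1 (by decide), h.reg_one])
    (by rw [hreg 4 (by decide), h.reg_four]) (by rw [hreg 5 (by decide), h.reg_five])
    (by rw [hreg 6 (by decide), hsix]) (by rw [hreg 20 (by decide), h.reg_twenty])
    (hreg 28 (by decide)) (by rw [hreg 40 (by decide), h.reg_forty]) g41 g43 g44 g45
    (bisections_lt_two_pow (by omega) (by omega) (by omega))
    (lt_two_pow_wordLength hcD hword) hX hH hroot) ?_
  rintro s₂ k₂ ⟨⟨e0, e1, e3, hloop⟩, hk₂⟩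
  rw [hreg 21 (by decide), h.edges] at e0
  rw [hreg 0 (by decide), h.reg_zero] at e1
  refine ⟨⟨e0, e1, e3, fun hm₁ => hloop hm₁ (Nat.one_le_pow _ _ (by omega)) ?_⟩, by omega⟩
  rw [pow_add]
  exact Nat.mul_lt_mul_of_pos_right ((Nat.sub_le _ _).trans_lt
    (mul_pow_lt_two_pow (by omega) hm h.count_le)) (by positivity)

theorem wp_main {n k N : ℕ} (hN : n + k + 2 = N) (G : SimpleGraph (Fin n)) :
    wp (wordLength N) mainProg (input G k) fun s' t => (∃ s, Counted G k s ∧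
      Estimated G k (searchLen n n) (s.reg 28) s') ∧ t ≤ 2 ^ 7 * N ^ 3 := by
  refine wp_seq (wp_mono (wp_count hN.le G) ?_)
  rintro s₁ t₁ ⟨hcount, ht₁⟩
  refine wp_mono (wp_estimate hN.le hcount) ?_
  rintro s₂ t₂ ⟨hestimate, ht₂⟩
  refine ⟨⟨s₁, hcount, hestimate⟩, ?_⟩
  have hn : n ≤ N := by omega
  have hk : k ≤ N := by omega
  have hm : searchLen n n ≤ N := (searchLen_le n n).trans hn
  have h₁ : N ≤ N ^ 3 := Nat.le_self_pow (by norm_num) N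
  have h₂ : 2 * N ^ 2 ≤ N ^ 3 := (Nat.mul_le_mul_right _ (by omega)).trans_eq (pow_succ' N 2).symm
  have h₃ : 2 ^ 3 ≤ N ^ 3 := Nat.pow_le_pow_left (by omega) 3
  calc t₁ + t₂ ≤ N * (N * 7 + 13) + N * N * 4 + N * N * (N * 22 + 22) + N * 11 + 17 +
        (N * 3 + N * 9 + (N * N + N * N + N) * (N * 3 + 11) + 32) := by
        refine (Nat.add_le_add ht₁ ht₂).trans ?_
        gcongr
    _ = 28 * N ^ 3 + 58 * N ^ 2 + 47 * N + 49 := by ring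
    _ ≤ 2 ^ 7 * N ^ 3 := by omega

theorem polyTime_mainProg : PolyTime mainProg := by
  refine ⟨18, fun n G k => ?_⟩
  obtain ⟨N, hN⟩ : ∃ N, n + k + 2 = N := ⟨_, rfl⟩
  obtain ⟨s, t, j, he, -, ht, -, hj⟩ := wp_main hN G (bdd_input hN.le G)
  refine ⟨s, t, he, ht.trans ?_⟩
  have hcube : 1 ≤ N ^ 3 := Nat.one_le_pow _ _ (by omega)
  calc j * (3 * wordLength N + 1) ≤ 2 ^ 7 * N ^ 3 * (2 ^ 5 * N ^ 3) := by
        refine Nat.mul_le_mul hj ?_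
        rw [wordLength]
        omega
    _ = 2 ^ 12 * N ^ 6 := by ring
    _ ≤ N ^ 12 * N ^ 6 := Nat.mul_le_mul_right _ (Nat.pow_le_pow_left (by omega) 12)
    _ = (n + k + 2) ^ 18 := by rw [← pow_add, hN]

end RAM

theorem abs_root_sub_le {f : ℝ} {n m lo k A : ℕ} (hn : 0 < n) (hm : m ≠ 0) (hf : 0 ≤ f)
    (hA : f ^ m = A / (n : ℝ) ^ m) (hlo : n ^ m * lo ^ m ≤ A * (2 ^ k) ^ m)
    (hhi : A * (2 ^ k) ^ m < n ^ m * (lo + 1) ^ m) :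
    |f - lo / 2 ^ k| ≤ (1 / 2 : ℝ) ^ k := by
  have hlo' : (lo / 2 ^ k : ℝ) ≤ f := by
    refine le_of_pow_le_pow_left₀ hm hf ?_
    rw [hA, div_pow, div_le_div_iff₀ (by positivity) (by positivity), mul_comm]
    exact_mod_cast hlo
  have hhi' : f < (lo + 1) / 2 ^ k := by
    refine lt_of_pow_lt_pow_left₀ m (by positivity) ?_
    rw [hA, div_pow, div_lt_div_iff₀ (by positivity) (by positivity), mul_comm (_ ^ m) (_ ^ m)]
    exact_mod_cast hhi
  rw [add_div] at hhi'
  rw [abs_of_nonneg (by linarith), one_div_pow]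
  linarith

theorem radicand_eq_div {n : ℕ} (G : SimpleGraph (Fin n)) (hn : 0 < n) (hm : 3 ≤ cycleLength n) :
    radicand G = ((G.labelledCopyCount (SimpleGraph.cycleGraph (cycleLength n)) *
      n ^ cycleLength n : ℕ) - ((2 * G.edgeSet.ncard) ^ cycleLength n : ℕ)) /
        (n : ℝ) ^ cycleLength n := by
  have : NeZero (cycleLength n) := ⟨by omega⟩
  rw [radicand, dHat, cycleCount, ← two_mul_mul_copyCount_cycleGraph hm, div_pow]
  push_cast
  field_simp

namespace RAM

theorem calculates_mainProg {n : ℕ} (G : SimpleGraph (Fin n)) (hm : 3 ≤ cycleLength n)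
    (hlen : searchLen n n = cycleLength n)
    (hsize : ∑ v ∈ Finset.range n,
      (Node.single v).walkSize n (adjNat G) (cycleLength n - 1) ≤ n * n)
    (hrad : 0 ≤ radicand G) : Calculates mainProg G (dHat G) (fHat G) := by
  intro k
  obtain ⟨s, t, -, he, -, -, ⟨s₁, hcount, hout⟩, -⟩ := wp_main rfl G (bdd_input le_rfl G)
  have hn : 0 < n := by have := searchLen_le n n; omega
  obtain ⟨hlo, hhi⟩ := hout.root (by omega)
  rw [hcount.count_eq (by omega) (by rwa [hlen]), hlen] at hlo hhi
  refine ⟨s, t, he, hout.reg_one ▸ hn, ?_, by simp [hout.reg_three], ?_⟩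
  · rw [hout.reg_zero, hout.reg_one, dHat]
    push_cast
    rfl
  have heq := radicand_eq_div G hn hm
  have hle : (2 * G.edgeSet.ncard) ^ cycleLength n ≤
      G.labelledCopyCount (SimpleGraph.cycleGraph (cycleLength n)) * n ^ cycleLength n := by
    rw [heq, le_div_iff₀ (by positivity), zero_mul, sub_nonneg] at hrad
    exact_mod_cast hrad
  rw [hout.reg_three, Nat.cast_pow, Nat.cast_ofNat]
  refine abs_root_sub_le hn (by omega) (Real.rpow_nonneg hrad _) ?_ hlo hhi
  rw [fHat, one_div, Real.rpow_inv_natCast_pow hrad (by omega), heq, Nat.cast_sub hle]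

end RAM

theorem whp_calculates_mainProg {a b : ℝ} (hb : 0 ≤ b) (hba : b ≤ a)
    (hab : (a - b) ^ 2 > 2 * (a + b)) :
    WHP a b fun _ G => RAM.Calculates RAM.mainProg G (dHat G) (fHat G) := by
  have ha : 1 ≤ a := by linarith [(params_bounds hb hba hab).1]
  refine ((whp_sum_walkSize_le hb hba ha).and (hb.trans hba) hb
    (whp_radicand hb hba hab)).mono (hb.trans hba) hb ?_
  filter_upwards [tendsto_cycleLength.eventually_ge_atTop 3, RAM.eventually_searchLen_eq]
    with n hm hlen G ⟨hsize, hrad⟩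
  have : 0 ≤ (a - b) / 2 := by linarith
  exact RAM.calculates_mainProg G hm hlen (hsize hm) (le_trans (by positivity) hrad.1)

theorem mainTheorem12 :
    (∀ a b : ℝ, 0 ≤ b → b ≤ a → (a - b) ^ 2 > 2 * (a + b) →
      IsConsistent a b (fun _ G => dHat G + fHat G) a ∧
      IsConsistent a b (fun _ G => dHat G - fHat G) b) ∧
    ∃ P : RAM.Prog, RAM.PolyTime P ∧
      ∀ a b : ℝ, 0 ≤ b → b ≤ a → (a - b) ^ 2 > 2 * (a + b) →
        Tendsto (fun n : ℕ => ssbmProb n 2 (a / n) (b / n)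
          {z | RAM.Calculates P z.2 (dHat z.2) (fHat z.2)}) atTop (𝓝 1) :=
  ⟨fun _ _ hb hba hab =>
      ⟨isConsistent_dHat_add_fHat hb hba hab, isConsistent_dHat_sub_fHat hb hba hab⟩,
    RAM.mainProg, RAM.polyTime_mainProg,
    fun _ _ hb hba hab => (whp_calculates_mainProg hb hba hab).tendsto_one⟩
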